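/- Let $k\ge 1$, let $M=\mathbb R^{1,4k+1}$ be Minkowski space of dimension $4k+2$ with metric $\mathrm{diag}(-1,1,\dots,1)$, volume form $\mathrm{vol}=dx^0\wedge\dots\wedge dx^{4k+1}$ and inner product $\langle\alpha,\beta\rangle=\frac1{p!}\alpha_{i_1\dots i_p}\beta^{i_1\dots i_p}$ on $p$-forms, and let $\star$ be the Hodge star with $\alpha\wedge\star\beta=\langle\alpha,\beta\rangle\,\mathrm{vol}$; then $\star\star=1$ on $(2k+1)$-forms. Write $G^2=G\wedge\star G$, let $\iota_{da}$ be the interior product with the metric dual of $da$, and put $(\partial a)^2=\eta^{ij}\partial_ia\,\partial_ja$. Let $\Lambda^+$ be the space of selfdual $(2k+1)$-forms, $D\subseteq\Lambda^+$ an open set (for instance $D=\Lambda^+$), and $\mathcal F:\Lambda^+\to\mathbb R$ an arbitrary function that is $C^1$ on $D$. For $Y\in D$ let $X(Y)=\partial\mathcal F/\partial Y$ be the unique anti-selfdual $(2k+1)$-form with $d\mathcal F_Y(\zeta)=2\langle\zeta,X(Y)\rangle$ for all $\zeta\in\Lambda^+$. For a smooth scalar $a$ and smooth $2k$-forms $A$,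 $R$ on $M$ put $F=dA$, $Q=dR$, $H=F+aQ$, and assume that $H+\star H$ takes its values in $D$. Consider the Lagrangian $$L=H^2+2a\,F\wedge Q+\mathcal F(H+\star H)\,\mathrm{vol}.$$ The field equation of $A$ (of $R$, of $a$) says that $\int_C L$ is stationary, for every compact $C\subset M$, under smooth variations of $A$ (of $R$, of $a$) supported in $C$. 1. (Gauge symmetries.) Let $U$ be a smooth $(2k-1)$-form and $\varphi$ a smooth scalar on $M$, and let $\delta L$ be the first variation of $L$. Then $\delta L=0$ under $$\delta a=0,\ \delta A=dU,\ \delta R=0\qquad\text{and}\qquad \delta a=0,\ \delta A=0,\ \delta R=dU,$$ and $\delta L$ is the total derivative $d(2\,\delta A\wedge H)$ of a local smooth current under $$\delta a=0,\quad \delta A=-a\,da\wedge U,\quad \delta R=da\wedge U$$ and, if $(\partial a)^2\ne0$ everywhere, under $$\delta a=\varphi,\quad \delta A=-\frac{a\varphi}{(\partial a)^2}\,\iota_{da}(Q+\star Q),\quad \delta R=\frac{\varphi}{(\partial a)^2}\,\iota_{da}(Q+\star Q).$$ 2. (Field equations.) Assume $(\partial a)^2\neq0$ everywhere and that the field equations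 of $A$ and $R$ hold. Then the field equation of $a$ holds, $\star H-H+\star X-X=0$ with $X=X(H+\star H)$, and $da\wedge dR=0$. Moreover $R$ can be gauged to zero in a neighbourhood of every point: for every $x\in M$ there are an open neighbourhood $V$ of $x$ and smooth $(2k-1)$-forms $U$, $B$ on $M$ such that the fields $a$, $A'=A-a\,da\wedge U$, $R'=R+da\wedge U+dB$ again satisfy all three field equations, and on $V$ one has $R'=0$ and, with $F'=dA'$, $$\star F'-F'+\star X-X=0,\qquad X=X(F'+\star F').$$ If $a$ is a function of one of the coordinates of a smooth global coordinate system $M\cong\mathbb R^{4k+2}$, this holds with $V=M$. 3. (The surviving equation.) If $(\partial a)^2\ne0$ everywhere and $R=0$, the three field equations together are equivalent to the nonlinear selfduality relation $\star F-F+\star X-X=0$ with $X=X(F+\star F)$. -/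

import Mathlib

open scoped ContDiff

noncomputable section

namespace ChiralForm

/-! ## Forms on Minkowski space -/

/-- Minkowski space `ℝ^{1,d-1}` with its standard coordinates `x^0, …, x^{d-1}`. Only the topology,
the smooth structure and the Lebesgue measure of `Fin d → ℝ` are used. -/
abbrev Mink (d : ℕ) : Type := Fin d → ℝ

/-- Exterior forms of degree `p` on Minkowski space, with constant coefficients. -/
abbrev Form (d p : ℕ) : Type := Mink d [⋀^Fin p]→L[ℝ] ℝ

/-- The diagonal entries of the Minkowski metric `diag(-1, 1, …, 1)`. -/
def eta {d : ℕ} (i : Fin d) : ℝ := if (i : ℕ) = 0 then -1 else 1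

/-- The coordinate vector `∂_i`. -/
def e {d : ℕ} (i : Fin d) : Mink d := Pi.single i 1

/-- The component `α_{I_1 … I_p} = α(∂_{I_1}, …, ∂_{I_p})`. -/
def coeff {d p : ℕ} (α : Form d p) (I : Fin p → Fin d) : ℝ := α (fun a => e (I a))

/-- The form `dx^{I_1} ∧ … ∧ dx^{I_p}`, with values
`(w_1, …, w_p) ↦ det (w_a^{I_b})`. -/
def dx {d p : ℕ} (I : Fin p → Fin d) : Form d p :=
  { Matrix.detRowAlternating.compLinearMap (LinearMap.funLeft ℝ ℝ I) with
    cont := by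
      change Continuous fun w : Fin p → Mink d => Matrix.det (Matrix.of fun a b => w a (I b))
      refine Continuous.matrix_det (continuous_pi fun a => continuous_pi fun b => ?_)
      exact (continuous_apply (I b)).comp (continuous_apply a) }

lemma dx_apply {d p : ℕ} (I : Fin p → Fin d) (w : Fin p → Mink d) :
    dx I w = Matrix.det (Matrix.of fun a b => w a (I b)) := rfl

/-- The Levi-Civita symbol: the sign of `K` if `K` is a permutation, and `0` otherwise. -/
def levi {d : ℕ} (K : Fin d → Fin d) : ℝ :=
  Matrix.det (Matrix.of fun a b => if K a = b then (1 : ℝ) else 0)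

/-- The multi-index `(I, J)`. -/
def join {d p q r : ℕ} (h : p + q = r) (I : Fin p → Fin d) (J : Fin q → Fin d) : Fin r → Fin d :=
  Fin.append I J ∘ Fin.cast h.symm

/-- The exterior product
`α ∧ β = (1 / (p! q!)) α_I β_J dx^{I_1} ∧ … ∧ dx^{I_p} ∧ dx^{J_1} ∧ … ∧ dx^{J_q}`. -/
def wedge {d p q r : ℕ} (h : p + q = r) (α : Form d p) (β : Form d q) : Form d r :=
  ((p.factorial * q.factorial : ℝ))⁻¹ •
    ∑ I : Fin p → Fin d, ∑ J : Fin q → Fin d, (coeff α I * coeff β J) • dx (join h I J)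

/-- The product `η^{I_1 I_1} ⋯ η^{I_p I_p}`, which raises the indices `I`. -/
def etaProd {d p : ℕ} (I : Fin p → Fin d) : ℝ := ∏ a, eta (I a)

/-- The Hodge star, `(⋆α)_J = (1 / p!) α^I ε_{I J}`. It is the one for which
`α ∧ ⋆β = ⟨α, β⟩ dx^0 ∧ … ∧ dx^{d-1}`. -/
def hodgeStar {d p q : ℕ} (h : p + q = d) (α : Form d p) : Form d q :=
  ((p.factorial * q.factorial : ℝ))⁻¹ •
    ∑ I : Fin p → Fin d, ∑ J : Fin q → Fin d,
      (etaProd I * coeff α I * levi (join h I J)) • dx J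

/-- The Minkowski inner product of forms, `⟨α, β⟩ = (1 / p!) α_I β^I`. -/
def formInner {d p : ℕ} (α β : Form d p) : ℝ :=
  (p.factorial : ℝ)⁻¹ * ∑ I : Fin p → Fin d, etaProd I * coeff α I * coeff β I

/-- The volume form `dx^0 ∧ … ∧ dx^{d-1}`. -/
def vol (d : ℕ) : Form d d := dx id

/-- The coefficient `f` of a top form `f dx^0 ∧ … ∧ dx^{d-1}`. -/
def density {d : ℕ} (α : Form d d) : ℝ := coeff α id

/-- The interior product `ι_v α` with (the metric dual of) a covector `v`. -/
def interior {d p : ℕ} (v : Mink d →L[ℝ] ℝ) (α : Form d (p + 1)) : Form d p :=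
  α.curryLeft (fun i => eta i * v (e i))

/-- A covector as a form of degree one. -/
def oneForm {d : ℕ} (v : Mink d →L[ℝ] ℝ) : Form d 1 :=
  ContinuousAlternatingMap.ofSubsingleton ℝ (Mink d) ℝ 0 v

/-- The differential `da` of a scalar field, as a field of forms of degree one. -/
def dScalar {d : ℕ} (a : Mink d → ℝ) (x : Mink d) : Form d 1 := oneForm (fderiv ℝ a x)

/-- `(∂a)² = η^{ij} ∂_i a ∂_j a`. -/
def gradSq {d : ℕ} (a : Mink d → ℝ) (x : Mink d) : ℝ := ∑ i, eta i * (fderiv ℝ a x (e i)) ^ 2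

/-- The exterior derivative, with the degree of the result given up to an equality. -/
def extD {d p q : ℕ} (h : p + 1 = q) (α : Mink d → Form d p) (x : Mink d) : Form d q :=
  h ▸ extDeriv α x

/-! ## The Hodge star is an involution on forms of degree `2k+1` in dimension `4k+2` -/

lemma coeff_perm {d p : ℕ} (α : Form d p) (I : Fin p → Fin d) (σ : Equiv.Perm (Fin p)) :
    coeff α (I ∘ σ) = (Equiv.Perm.sign σ : ℝ) * coeff α I := by
  have := α.toAlternatingMap.map_perm (fun a => e (I a)) σ
  simpa [coeff, Function.comp_def, Units.smul_def] using this

lemma coeff_eq_zero {d p : ℕ} (α : Form d p) {I : Fin p → Fin d}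
    (h : ¬ Function.Injective I) : coeff α I = 0 := by
  simp only [Function.Injective, not_forall] at h
  obtain ⟨a, b, hab, hne⟩ := h
  exact α.map_eq_zero_of_eq _ (by simp [hab]) hne

lemma form_ext {d p : ℕ} {α β : Form d p}
    (h : ∀ I : Fin p → Fin d, Function.Injective I → coeff α I = coeff β I) : α = β := by
  apply ContinuousAlternatingMap.toAlternatingMap_injective
  refine Module.Basis.ext_alternating (Pi.basisFun ℝ (Fin d)) fun v hv => ?_
  simpa [coeff, e] using h v hv

lemma levi_eq_zero {d : ℕ} {K : Fin d → Fin d} (h : ¬ Function.Injective K) : levi K = 0 := by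
  simp only [Function.Injective, not_forall] at h
  obtain ⟨a, b, hab, hne⟩ := h
  exact Matrix.det_zero_of_row_eq hne (by ext c; simp [hab])

lemma levi_comp {d : ℕ} (K : Fin d → Fin d) (τ : Equiv.Perm (Fin d)) :
    levi (K ∘ τ) = (Equiv.Perm.sign τ : ℝ) * levi K := by
  have := Matrix.det_permute (R := ℝ) τ (Matrix.of fun a b => if K a = b then (1 : ℝ) else 0)
  rw [levi, levi, ← this]
  rfl

lemma levi_sq {d : ℕ} {K : Fin d → Fin d} (h : Function.Injective K) : levi K * levi K = 1 := by
  have h1 : levi (id : Fin d → Fin d) = 1 := by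
    exact Matrix.det_one (n := Fin d) (R := ℝ)
  have h2 := levi_comp id (Equiv.ofBijective K (Finite.injective_iff_bijective.1 h))
  rw [h1, mul_one] at h2
  change levi K = _ at h2
  rw [h2]
  norm_cast
  simp

lemma coeff_dx {d q : ℕ} (J K : Fin q → Fin d) :
    coeff (dx J) K = ∑ σ : Equiv.Perm (Fin q), (Equiv.Perm.sign σ : ℝ) *
      if J = K ∘ σ then 1 else 0 := by
  rw [coeff, dx_apply, Matrix.det_apply]
  refine Finset.sum_congr rfl fun σ _ => ?_
  have : (∏ i, (Matrix.of fun a b => (e (K a) : Mink d) (J b)) (σ i) i : ℝ) =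
      if J = K ∘ σ then 1 else 0 := by
    simp only [Matrix.of_apply, e, Pi.single_apply]
    rw [Finset.prod_ite_zero]
    simp [funext_iff]
  rw [this, Units.smul_def, zsmul_eq_mul]

lemma join_left {d p q r : ℕ} (h : p + q = r) (I : Fin p → Fin d) (J : Fin q → Fin d)
    (a : Fin p) : join h I J (Fin.cast h (Fin.castAdd q a)) = I a := by
  simp [join]

lemma join_right {d p q r : ℕ} (h : p + q = r) (I : Fin p → Fin d) (J : Fin q → Fin d)
    (a : Fin q) : join h I J (Fin.cast h (Fin.natAdd p a)) = J a := by
  simp [join]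

lemma exists_join_perm {d p q r : ℕ} (h : p + q = r) (σ : Equiv.Perm (Fin p))
    (τ : Equiv.Perm (Fin q)) : ∃ ρ : Equiv.Perm (Fin r),
      Equiv.Perm.sign ρ = Equiv.Perm.sign σ * Equiv.Perm.sign τ ∧
      ∀ (I : Fin p → Fin d) (J : Fin q → Fin d),
        join h (I ∘ σ) (J ∘ τ) = join h I J ∘ ρ := by
  subst h
  refine ⟨finSumFinEquiv.permCongr (Equiv.Perm.sumCongr σ τ), ?_, fun I J => ?_⟩
  · simp [Equiv.Perm.sign_permCongr]
  · ext i
    refine Fin.addCases (fun a => ?_) (fun a => ?_) i <;>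
    simp [join, Equiv.permCongr_apply]

/-- The component of the Hodge dual along the indices that are complementary to `I`. -/
lemma coeff_hodgeStar {d p q : ℕ} (h : p + q = d) (α : Form d p) (I : Fin p → Fin d)
    (K : Fin q → Fin d) (hIK : Function.Injective (join h I K)) :
    coeff (hodgeStar h α) K = etaProd I * coeff α I * levi (join h I K) := by
  have hKinj : Function.Injective K := fun a b hab => by
    have := hIK (by rw [join_right, join_right, hab] :
      join h I K (Fin.cast h (Fin.natAdd p a)) = join h I K (Fin.cast h (Fin.natAdd p b)))
    simpa [Fin.ext_iff] using this
  have hIinj : Function.Injective I := fun a b hab => by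
    have := hIK (by rw [join_left, join_left, hab] :
      join h I K (Fin.cast h (Fin.castAdd q a)) = join h I K (Fin.cast h (Fin.castAdd q b)))
    simpa [Fin.ext_iff] using this
  have hlin : coeff (hodgeStar h α) K = ((p.factorial * q.factorial : ℝ))⁻¹ *
      ∑ I' : Fin p → Fin d, ∑ J : Fin q → Fin d,
        (etaProd I' * coeff α I' * levi (join h I' J)) * coeff (dx J) K := by
    simp [hodgeStar, coeff, ContinuousAlternatingMap.sum_apply]
  have hterm : ∀ (σ : Equiv.Perm (Fin p)) (τ : Equiv.Perm (Fin q)),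
      etaProd (I ∘ σ) * coeff α (I ∘ σ) * levi (join h (I ∘ σ) (K ∘ τ)) *
        (Equiv.Perm.sign τ : ℝ) = etaProd I * coeff α I * levi (join h I K) := by
    intro σ τ
    obtain ⟨ρ, hρ, hj⟩ := exists_join_perm (d := d) h σ τ
    have he : etaProd (I ∘ σ) = etaProd I := Equiv.prod_comp σ (fun a => eta (I a))
    have hs : (Equiv.Perm.sign σ : ℝ) * (Equiv.Perm.sign σ : ℝ) = 1 := by norm_cast; simp
    have ht : (Equiv.Perm.sign τ : ℝ) * (Equiv.Perm.sign τ : ℝ) = 1 := by norm_cast; simp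
    rw [hj, levi_comp, coeff_perm, he, hρ]
    push_cast
    linear_combination (etaProd I * coeff α I * levi (join h I K)) *
      ((Equiv.Perm.sign τ : ℝ) * (Equiv.Perm.sign τ : ℝ) * hs + ht)
  have hI : ∀ τ : Equiv.Perm (Fin q), ∑ I' : Fin p → Fin d,
      etaProd I' * coeff α I' * levi (join h I' (K ∘ τ)) * (Equiv.Perm.sign τ : ℝ) =
      p.factorial * (etaProd I * coeff α I * levi (join h I K)) := by
    intro τ
    have hsub : ∑ σ : Equiv.Perm (Fin p),
        etaProd (I ∘ σ) * coeff α (I ∘ σ) * levi (join h (I ∘ σ) (K ∘ τ)) *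
          (Equiv.Perm.sign τ : ℝ) = ∑ I' : Fin p → Fin d,
        etaProd I' * coeff α I' * levi (join h I' (K ∘ τ)) * (Equiv.Perm.sign τ : ℝ) := by
      have hinj : Function.Injective (fun σ : Equiv.Perm (Fin p) => I ∘ σ) := fun σ σ' hσ =>
        Equiv.ext fun a => hIinj (congrFun hσ a)
      rw [← Finset.sum_image (g := fun σ : Equiv.Perm (Fin p) => I ∘ σ)
        (f := fun I' => etaProd I' * coeff α I' * levi (join h I' (K ∘ τ)) *
          (Equiv.Perm.sign τ : ℝ)) (fun x _ y _ hxy => hinj hxy)]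
      refine Finset.sum_subset (Finset.subset_univ _) fun I' _ hI' => ?_
      by_cases hI'inj : Function.Injective (join h I' (K ∘ τ))
      swap
      · rw [levi_eq_zero hI'inj]; ring
      exfalso
      apply hI'
      have hex : ∀ a, ∃ b, I b = I' a := by
        intro a
        obtain ⟨c, hc⟩ := (Finite.injective_iff_surjective.1 hIK) (I' a)
        obtain ⟨c', rfl⟩ : ∃ c' : Fin (p + q), Fin.cast h c' = c := ⟨Fin.cast h.symm c, rfl⟩
        revert hc
        refine Fin.addCases (fun b hb => ?_) (fun b hb => ?_) c'
        · exact ⟨b, by rw [← hb, join_left]⟩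
        · exfalso
          rw [join_right] at hb
          have := hI'inj (by rw [join_left, join_right]; simp [hb] :
            join h I' (K ∘ τ) (Fin.cast h (Fin.castAdd q a)) =
              join h I' (K ∘ τ) (Fin.cast h (Fin.natAdd p (τ.symm b))))
          have h' := congrArg Fin.val this
          simp at h'
          omega
      choose s hs using hex
      have hI'i : Function.Injective I' := fun a b hab => by
        have := hI'inj (by rw [join_left, join_left, hab] :
          join h I' (K ∘ τ) (Fin.cast h (Fin.castAdd q a)) =
            join h I' (K ∘ τ) (Fin.cast h (Fin.castAdd q b)))
        simpa [Fin.ext_iff] using this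
      have hsinj : Function.Injective s := fun a b hab => hI'i (by rw [← hs, ← hs, hab])
      refine Finset.mem_image.2 ⟨Equiv.ofBijective s (Finite.injective_iff_bijective.1 hsinj),
        Finset.mem_univ _, ?_⟩
      ext a
      simp [hs]
    rw [← hsub, Finset.sum_congr rfl (fun σ _ => hterm σ τ)]
    simp [Finset.card_univ, Fintype.card_perm]
  have hJ : ∑ I' : Fin p → Fin d, ∑ J : Fin q → Fin d,
      (etaProd I' * coeff α I' * levi (join h I' J)) * coeff (dx J) K =
      ∑ τ : Equiv.Perm (Fin q), ∑ I' : Fin p → Fin d,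
        etaProd I' * coeff α I' * levi (join h I' (K ∘ τ)) * (Equiv.Perm.sign τ : ℝ) := by
    rw [Finset.sum_comm (s := (Finset.univ : Finset (Equiv.Perm (Fin q))))]
    refine Finset.sum_congr rfl fun I' _ => ?_
    simp_rw [coeff_dx, Finset.mul_sum]
    rw [Finset.sum_comm]
    refine Finset.sum_congr rfl fun τ _ => ?_
    rw [Finset.sum_eq_single (K ∘ τ)]
    · simp
    · intro J _ hJ
      simp [hJ]
    · simp
  rw [hlin, hJ, Finset.sum_congr rfl (fun τ _ => hI τ)]
  have hp : (p.factorial : ℝ) ≠ 0 := by positivity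
  have hq : (q.factorial : ℝ) ≠ 0 := by positivity
  simp [Finset.card_univ, Fintype.card_perm]
  field_simp

lemma sign_sumComm (n : ℕ) : Equiv.Perm.sign (Equiv.sumComm (Fin n) (Fin n)) = (-1) ^ n := by
  rw [← Equiv.Perm.sign_permCongr ((Equiv.boolProdEquivSum (Fin n)).symm.trans
    (Equiv.prodComm Bool (Fin n)))]
  have : ((Equiv.boolProdEquivSum (Fin n)).symm.trans (Equiv.prodComm Bool (Fin n))).permCongr
      (Equiv.sumComm (Fin n) (Fin n)) =
      Equiv.prodCongrRight fun _ => Equiv.swap false true := by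
    ext ⟨a, b⟩ <;> cases b <;> rfl
  rw [this, Equiv.Perm.sign_prodCongrRight]
  simp

lemma levi_join_comm {n d : ℕ} (h : n + n = d) (I J : Fin n → Fin d) :
    levi (join h J I) = (-1) ^ n * levi (join h I J) := by
  subst h
  have : join rfl J I = join rfl I J ∘ finSumFinEquiv.permCongr (Equiv.sumComm (Fin n) (Fin n)) := by
    ext i
    refine Fin.addCases (fun a => ?_) (fun a => ?_) i <;>
    simp [join, Equiv.permCongr_apply, -Fin.natAdd_eq_addNat]
  rw [this, levi_comp, Equiv.Perm.sign_permCongr, sign_sumComm]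
  push_cast
  rfl

lemma prod_eta (d : ℕ) : ∏ i : Fin (d + 1), eta i = -1 := by
  simp [eta]

lemma exists_join {p q d : ℕ} (h : p + q = d) (I : Fin p → Fin d) (hI : Function.Injective I) :
    ∃ K : Fin q → Fin d, Function.Injective (join h I K) := by
  subst h
  obtain ⟨g, hg⟩ := Finset.exists_equiv_extend_of_card_eq (α := Fin (p + q)) (t := Finset.univ)
    (by simp) (s := Finset.univ.image (Fin.castAdd q))
    (f := fun i => if hi : (i : ℕ) < p then I ⟨i, hi⟩ else i) (by simp)
    (by
      intro a ha b hb hab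
      simp only [Finset.coe_image, Finset.coe_univ, Set.image_univ, Set.mem_range] at ha hb
      obtain ⟨a, rfl⟩ := ha
      obtain ⟨b, rfl⟩ := hb
      simp at hab
      rw [hI hab])
  refine ⟨fun b => g (Fin.natAdd p b), ?_⟩
  have : join rfl I (fun b => ((g (Fin.natAdd p b) : Finset.univ) : Fin (p + q))) =
      fun i => ((g i : Finset.univ) : Fin (p + q)) := by
    ext i
    refine Fin.addCases (fun a => ?_) (fun a => ?_) i
    · rw [hg _ (by simp)]
      simp [join]
    · simp [join]
  rw [this]
  exact Subtype.val_injective.comp g.injective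

lemma hodgeStar_hodgeStar {k : ℕ} (h : (2 * k + 1) + (2 * k + 1) = 4 * k + 2)
    (α : Form (4 * k + 2) (2 * k + 1)) : hodgeStar h (hodgeStar h α) = α := by
  refine form_ext fun I hI => ?_
  obtain ⟨K, hK⟩ := exists_join h I hI
  have hc := levi_join_comm h I K
  have hsq := levi_sq hK
  have hodd : (-1 : ℝ) ^ (2 * k + 1) = -1 := by rw [pow_succ, pow_mul]; simp
  rw [hodd] at hc
  have hK' : Function.Injective (join h K I) := by
    by_contra hn
    rw [levi_eq_zero hn] at hc
    have : levi (join h I K) = 0 := by linarith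
    rw [this] at hsq
    norm_num at hsq
  have hη : etaProd I * etaProd K = -1 := by
    have h1 : ∏ i : Fin (4 * k + 2), eta (join h I K i) = -1 := by
      rw [← prod_eta (4 * k + 1)]
      exact Equiv.prod_comp (Equiv.ofBijective _ (Finite.injective_iff_bijective.1 hK)) eta
    rw [← h1, ← Equiv.prod_comp (finSumFinEquiv.trans (finCongr h)), Fintype.prod_sum_type]
    simp [etaProd, join, -Fin.natAdd_eq_addNat]
  rw [coeff_hodgeStar h _ K I hK', coeff_hodgeStar h _ I K hK, hc]
  linear_combination (-(coeff α I) * (levi (join h I K) * levi (join h I K))) * hη +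
    coeff α I * hsq

lemma coeff_add {d p : ℕ} (α β : Form d p) (I : Fin p → Fin d) :
    coeff (α + β) I = coeff α I + coeff β I := rfl

lemma coeff_smul {d p : ℕ} (c : ℝ) (α : Form d p) (I : Fin p → Fin d) :
    coeff (c • α) I = c * coeff α I := rfl

lemma hodgeStar_add {d p q : ℕ} (h : p + q = d) (α β : Form d p) :
    hodgeStar h (α + β) = hodgeStar h α + hodgeStar h β := by
  simp only [hodgeStar, coeff_add, ← smul_add, ← Finset.sum_add_distrib, ← add_smul, mul_add,
    add_mul]

lemma hodgeStar_smul {d p q : ℕ} (h : p + q = d) (c : ℝ) (α : Form d p) :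
    hodgeStar h (c • α) = c • hodgeStar h α := by
  simp only [hodgeStar, coeff_smul]
  rw [smul_comm c]
  simp only [Finset.smul_sum (r := c), smul_smul, mul_assoc, mul_left_comm c]

/-! ## Self-dual forms and the gradient of a function of a self-dual form -/

/-- Minkowski spacetime of dimension `4k+2`. -/
abbrev Spacetime (k : ℕ) : Type := Mink (4 * k + 2)

/-- Forms of degree `p` on spacetime. -/
abbrev SForm (k p : ℕ) : Type := Form (4 * k + 2) p

/-- The Hodge star on forms of the middle degree `2k+1`. -/
def hodge {k : ℕ} (G : SForm k (2 * k + 1)) : SForm k (2 * k + 1) :=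
  hodgeStar (by omega) G

/-- The exterior product of two forms of the middle degree `2k+1`. -/
def wedgeMid {k : ℕ} (G G' : SForm k (2 * k + 1)) : SForm k (4 * k + 2) :=
  wedge (by omega) G G'

/-- The space `Λ⁺` of self-dual forms of degree `2k+1`. -/
def SelfDual (k : ℕ) : Submodule ℝ (SForm k (2 * k + 1)) where
  carrier := {Y | hodge Y = Y}
  add_mem' {Y Z} hY hZ := by
    change hodge (Y + Z) = Y + Z
    rw [hodge, hodgeStar_add]
    exact congrArg₂ (· + ·) hY hZ
  zero_mem' := by
    change hodge 0 = 0
    have := hodgeStar_smul (p := 2 * k + 1) (q := 2 * k + 1) (d := 4 * k + 2) (by omega) 0 0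
    simpa [hodge] using this
  smul_mem' c Y hY := by
    change hodge (c • Y) = c • Y
    rw [hodge, hodgeStar_smul]
    exact congrArg (c • ·) hY

/-- The self-dual form `G + ⋆G`. -/
def sd {k : ℕ} (G : SForm k (2 * k + 1)) : SelfDual k :=
  ⟨G + hodge G, by
    change hodge (G + hodge G) = G + hodge G
    rw [hodge, hodgeStar_add]
    exact (congrArg (hodge G + ·) (hodgeStar_hodgeStar _ G)).trans (add_comm _ _)⟩

/-- The form `X = ∂𝓕/∂Y` at the self-dual form `Y`, for a function `𝓕` of a self-dual form. Its
components are the derivatives of `𝓕` in the directions of the self-dual parts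
`(dx^I + ⋆ dx^I) / 2`, with the indices lowered, and it is normalised by
`d𝓕 = 2 ⟨dY, X⟩`. -/
def gradForm {k : ℕ} (𝓕 : SelfDual k → ℝ) (Y : SelfDual k) : SForm k (2 * k + 1) :=
  (4 * ((2 * k + 1).factorial : ℝ))⁻¹ •
    ∑ I : Fin (2 * k + 1) → Fin (4 * k + 2), (etaProd I * fderiv ℝ 𝓕 Y (sd (dx I))) • dx I

/-! ## The fields, the Lagrangian and the field equations -/

/-- The scalar `a`, the `2k`-form `A` and the auxiliary `2k`-form `R`. The same type is used for
the variations `(δa, δA, δR)`. -/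
structure Fields (k : ℕ) where
  a : Spacetime k → ℝ
  A : Spacetime k → SForm k (2 * k)
  R : Spacetime k → SForm k (2 * k)

namespace Fields

variable {k : ℕ}

/-- The fields are smooth. -/
def Smooth (Φ : Fields k) : Prop :=
  ContDiff ℝ ∞ Φ.a ∧ ContDiff ℝ ∞ Φ.A ∧ ContDiff ℝ ∞ Φ.R

/-- The varied fields `Φ + t δ`. -/
def shift (Φ δ : Fields k) (t : ℝ) : Fields k where
  a x := Φ.a x + t * δ.a x
  A x := Φ.A x + t • δ.A x
  R x := Φ.R x + t • δ.R x

/-- `F = dA`. -/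
def F (Φ : Fields k) (x : Spacetime k) : SForm k (2 * k + 1) := extDeriv Φ.A x

/-- `Q = dR`. -/
def Q (Φ : Fields k) (x : Spacetime k) : SForm k (2 * k + 1) := extDeriv Φ.R x

/-- `H = F + a Q`. -/
def H (Φ : Fields k) (x : Spacetime k) : SForm k (2 * k + 1) := Φ.F x + Φ.a x • Φ.Q x

end Fields

variable {k : ℕ}

/-- The Lagrangian `H ∧ ⋆H + 2 a F ∧ Q + 𝓕(H + ⋆H)`, as a top form. -/
def lagrangian (𝓕 : SelfDual k → ℝ) (Φ : Fields k) (x : Spacetime k) : SForm k (4 * k + 2) :=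
  wedgeMid (Φ.H x) (hodge (Φ.H x)) + (2 * Φ.a x) • wedgeMid (Φ.F x) (Φ.Q x) +
    𝓕 (sd (Φ.H x)) • vol (4 * k + 2)

/-- The action `∫_C L` over a region `C`. -/
def action (𝓕 : SelfDual k → ℝ) (C : Set (Spacetime k)) (Φ : Fields k) : ℝ :=
  ∫ x in C, density (lagrangian 𝓕 Φ x)

/-- The field equation of `A`: the action over every compact region is stationary under the
variations of `A` that are supported in the region. -/
def EqA (𝓕 : SelfDual k → ℝ) (Φ : Fields k) : Prop :=
  ∀ C : Set (Spacetime k), IsCompact C →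
    ∀ α : Spacetime k → SForm k (2 * k), ContDiff ℝ ∞ α → tsupport α ⊆ C →
      HasDerivAt (fun t : ℝ => action 𝓕 C (Φ.shift ⟨0, α, 0⟩ t)) 0 0

/-- The field equation of `R`. -/
def EqR (𝓕 : SelfDual k → ℝ) (Φ : Fields k) : Prop :=
  ∀ C : Set (Spacetime k), IsCompact C →
    ∀ ρ : Spacetime k → SForm k (2 * k), ContDiff ℝ ∞ ρ → tsupport ρ ⊆ C →
      HasDerivAt (fun t : ℝ => action 𝓕 C (Φ.shift ⟨0, 0, ρ⟩ t)) 0 0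

/-- The field equation of the scalar `a`. -/
def EqScalar (𝓕 : SelfDual k → ℝ) (Φ : Fields k) : Prop :=
  ∀ C : Set (Spacetime k), IsCompact C →
    ∀ φ : Spacetime k → ℝ, ContDiff ℝ ∞ φ → tsupport φ ⊆ C →
      HasDerivAt (fun t : ℝ => action 𝓕 C (Φ.shift ⟨φ, 0, 0⟩ t)) 0 0

/-- The nonlinear self-duality relation `⋆G - G + ⋆X - X = 0` of a `(2k+1)`-form `G`, where
`X = ∂𝓕/∂Y` at `Y = G + ⋆G`. -/
def NonlinearSelfDual (𝓕 : SelfDual k → ℝ) (G : SForm k (2 * k + 1)) : Prop :=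
  hodge G - G + hodge (gradForm 𝓕 (sd G)) - gradForm 𝓕 (sd G) = 0

/-! ## The gauge transformations -/

/-- `da ∧ U` for a `(2k-1)`-form `U`. -/
def daWedge (hk : 1 ≤ k) (a : Spacetime k → ℝ) (U : Spacetime k → SForm k (2 * k - 1))
    (x : Spacetime k) : SForm k (2 * k) :=
  wedge (by omega) (dScalar a x) (U x)

/-- `δa = 0, δA = dU, δR = 0`. -/
def gaugeA (hk : 1 ≤ k) (U : Spacetime k → SForm k (2 * k - 1)) : Fields k :=
  ⟨0, extD (by omega) U, 0⟩

/-- `δa = 0, δA = 0, δR = dU`. -/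
def gaugeR (hk : 1 ≤ k) (U : Spacetime k → SForm k (2 * k - 1)) : Fields k :=
  ⟨0, 0, extD (by omega) U⟩

/-- `δa = 0, δA = -a da ∧ U, δR = da ∧ U`. -/
def gaugeAR (hk : 1 ≤ k) (Φ : Fields k) (U : Spacetime k → SForm k (2 * k - 1)) : Fields k :=
  ⟨0, fun x => -Φ.a x • daWedge hk Φ.a U x, daWedge hk Φ.a U⟩

/-- `(φ / (∂a)²) ι_{da} (Q + ⋆Q)`. -/
def pstForm (Φ : Fields k) (φ : Spacetime k → ℝ) (x : Spacetime k) : SForm k (2 * k) :=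
  (φ x / gradSq Φ.a x) • interior (fderiv ℝ Φ.a x) (Φ.Q x + hodge (Φ.Q x))

/-- `δa = φ, δA = -(a φ / (∂a)²) ι_{da} (Q + ⋆Q), δR = (φ / (∂a)²) ι_{da} (Q + ⋆Q)`. -/
def gaugePST (Φ : Fields k) (φ : Spacetime k → ℝ) : Fields k :=
  ⟨φ, fun x => -Φ.a x • pstForm Φ φ x, pstForm Φ φ⟩

/-- The first variation of the Lagrangian in the direction `δ` is the total derivative `dK`. -/
def VariesBy (𝓕 : SelfDual k → ℝ) (Φ δ : Fields k)
    (K : Spacetime k → SForm k (4 * k + 1)) : Prop :=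
  ContDiff ℝ ∞ K ∧
    ∀ x, HasDerivAt (fun t : ℝ => lagrangian 𝓕 (Φ.shift δ t) x) (extD rfl K x) 0

/-- The local current `2 δA ∧ H`. -/
def current (Φ δ : Fields k) (x : Spacetime k) : SForm k (4 * k + 1) :=
  (2 : ℝ) • wedge (by omega) (δ.A x) (Φ.H x)

/-- `R` can be gauged to zero on `V`: there are gauge transformations
`R ↦ R + da ∧ U, A ↦ A - a da ∧ U` and `R ↦ R + dB` after which the fields still solve the field
equations, `R` vanishes on `V`, and `F` satisfies the nonlinear self-duality relation on `V`. -/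
def GaugesAway (hk : 1 ≤ k) (𝓕 : SelfDual k → ℝ) (Φ : Fields k) (V : Set (Spacetime k)) : Prop :=
  ∃ U B : Spacetime k → SForm k (2 * k - 1), ContDiff ℝ ∞ U ∧ ContDiff ℝ ∞ B ∧
    ∃ Φ' : Fields k, Φ' = (Φ.shift (gaugeAR hk Φ U) 1).shift (gaugeR hk B) 1 ∧
      Φ'.Smooth ∧ EqA 𝓕 Φ' ∧ EqR 𝓕 Φ' ∧ EqScalar 𝓕 Φ' ∧
      ∀ x ∈ V, Φ'.R x = 0 ∧ NonlinearSelfDual 𝓕 (Φ'.F x)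

/-- `a` is a function of one of the coordinates of a smooth coordinate system on the whole of
spacetime. -/
def IsGlobalCoordinate (a : Spacetime k → ℝ) : Prop :=
  ∃ (Ψ Ψ' : Spacetime k → Spacetime k) (g : ℝ → ℝ), ContDiff ℝ ∞ Ψ ∧ ContDiff ℝ ∞ Ψ' ∧
    Function.LeftInverse Ψ' Ψ ∧ Function.RightInverse Ψ' Ψ ∧ ∀ x, a x = g (Ψ x 0)

end ChiralForm

end

open ChiralForm

/-!
Everything rests on a formula for the first variation of the Lagrangian. Let
`E = ⋆H - H + ⋆X - X` be the left-hand side of the nonlinear self-duality relation; it is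
anti-self-dual. Since `X` is anti-self-dual and `G ∧ G = 0` in odd degree,
`δL = 2 δH ∧ E + 2 δF ∧ (H + aQ) + 2a² δQ ∧ Q`, where `δH = δF + δa Q + a δQ` (`variation_eq`).

Gauge symmetries. Closed `δA` and `δR` with `δa = 0` have `δF = δQ = 0`. If `δA = -a δR`, then
`δL = 2 δH ∧ E + d(2 δA ∧ H)` and `δH = δa Q - da ∧ δR` (`variation_of_eq_neg_smul`). For
`δa = 0`, `δR = da ∧ U` this gives `δH = 0`. For the symmetry that shifts `a`, the identity
`da ∧ ι_{da} S + ⋆(da ∧ ι_{da} S) = (∂a)² S` of self-dual forms `S` shows that `δH` is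
anti-self-dual, so that `δH ∧ E = 0`, as for any two anti-self-dual forms.

Field equations. In the weak sense, the equations of `A` and `R` are `dE = -2 da ∧ Q` and
`d(aE) = -2a da ∧ Q`. Together they give `da ∧ E = 0`, and an anti-self-dual form that is
annihilated by a covector which is not null is zero (`eq_zero_of_covWedge_eq_zero`). Hence `E = 0`
and `da ∧ Q = 0` (`defect_eq_zero_and_daQ_eq_zero`). Conversely, these two relations imply the
equations of `A` and `R`, and also that of `a`, because a variation of `a` alone has
`δL = 2 δa Q ∧ E`.

Gauging `R` away. Take coordinates such that `a` is a function of the first, and let `h_t` be the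
dilation of the other coordinates by `t`. In the homotopy formula `R - h_0^* R = K dR + d K R` the
pullback `h_0^* R` vanishes, because `h_0` has rank one and `R` has degree at least two. Since `h_t`
preserves `a`, the relation `da ∧ dR = 0` implies `da ∧ K dR = 0`. As `da` is not null, `K dR` is
then `da ∧ S` for an explicit smooth form `S`, and `U = -S`, `B = -K R` gauge `R` to zero
(`exists_potentials_of_homotopy`). Locally, the coordinates come from the inverse function theorem;
their inverse is multiplied by a bump function, so that all forms are smooth on the whole of
spacetime.
-/

noncomputable section

namespace ChiralForm

/-! ### Expansion of forms in the coordinate basis -/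

section Algebra

variable {d p q r : ℕ}

lemma dx_comp (I : Fin p → Fin d) (σ : Equiv.Perm (Fin p)) :
    dx (I ∘ σ) = (Equiv.Perm.sign σ : ℝ) • dx I := by
  ext w
  exact Matrix.det_permute' σ (Matrix.of fun a b => w a (I b))

lemma coeff_dx_comm (I J : Fin p → Fin d) : coeff (dx I) J = coeff (dx J) I := by
  rw [coeff, dx_apply, coeff, dx_apply, ← Matrix.det_transpose]
  congr 1
  ext a b
  simp [e, Pi.single_apply, eq_comm]

lemma etaProd_comp (I : Fin p → Fin d) (σ : Equiv.Perm (Fin p)) :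
    etaProd (I ∘ σ) = etaProd I :=
  Equiv.prod_comp σ fun a => eta (I a)

lemma eta_mul_self (i : Fin d) : eta i * eta i = 1 := by
  unfold eta; split_ifs <;> norm_num

lemma etaProd_mul_self (I : Fin p → Fin d) : etaProd I * etaProd I = 1 := by
  simp [etaProd, ← Finset.prod_mul_distrib, eta_mul_self]

lemma sign_mul_sign (σ : Equiv.Perm (Fin p)) :
    (Equiv.Perm.sign σ : ℝ) * (Equiv.Perm.sign σ : ℝ) = 1 := by
  norm_cast; simp

/-- Contracting the components of `dx^I` with an antisymmetric family picks out, up to the factor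
`p!`, its member at `I`. -/
lemma sum_coeff_dx_smul {M : Type*} [AddCommGroup M] [Module ℝ M] (g : (Fin p → Fin d) → M)
    (hg : ∀ I (σ : Equiv.Perm (Fin p)), g (I ∘ σ) = (Equiv.Perm.sign σ : ℝ) • g I)
    (I : Fin p → Fin d) :
    ∑ J, coeff (dx I) J • g J = (p.factorial : ℝ) • g I := by
  simp_rw [coeff_dx_comm I, coeff_dx, Finset.sum_smul]
  rw [Finset.sum_comm]
  have h : ∀ σ : Equiv.Perm (Fin p), ∑ J : Fin p → Fin d,
      ((Equiv.Perm.sign σ : ℝ) * if J = I ∘ σ then 1 else 0) • g J = g I := by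
    intro σ
    rw [Finset.sum_eq_single (I ∘ σ)]
    · rw [if_pos rfl, hg, mul_one, smul_smul, sign_mul_sign, one_smul]
    · intro J _ hJ
      simp [hJ]
    · simp
  rw [Finset.sum_congr rfl fun σ _ => h σ]
  simp [Fintype.card_perm, Nat.cast_smul_eq_nsmul]

lemma coeff_sum {ι : Type*} (s : Finset ι) (f : ι → Form d p) (I : Fin p → Fin d) :
    coeff (∑ i ∈ s, f i) I = ∑ i ∈ s, coeff (f i) I := by
  simp [coeff, ContinuousAlternatingMap.sum_apply]

lemma coeff_sum_dx (c : (Fin p → Fin d) → ℝ)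
    (hc : ∀ I (σ : Equiv.Perm (Fin p)), c (I ∘ σ) = (Equiv.Perm.sign σ : ℝ) * c I)
    (K : Fin p → Fin d) : coeff (∑ I, c I • dx I) K = p.factorial * c K := by
  rw [coeff_sum]
  simp_rw [coeff_smul, coeff_dx_comm _ K, mul_comm (c _)]
  exact sum_coeff_dx_smul c hc K

/-- The expansion `p! α = α_I dx^I`. -/
lemma sum_coeff_smul_dx (α : Form d p) :
    ∑ I, coeff α I • dx I = (p.factorial : ℝ) • α :=
  form_ext fun K _ => coeff_sum_dx _ (fun I σ => coeff_perm α I σ) K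

lemma eq_smul_sum_dx (α : Form d p) :
    α = (p.factorial : ℝ)⁻¹ • ∑ I, coeff α I • dx I := by
  rw [sum_coeff_smul_dx, smul_smul, inv_mul_cancel₀ (by positivity), one_smul]

/-- A linear map on forms is determined by its values on the forms `dx^I`. -/
lemma form_linearMap_ext {M : Type*} [AddCommGroup M] [Module ℝ M] {f g : Form d p →ₗ[ℝ] M}
    (h : ∀ I, f (dx I) = g (dx I)) : f = g := by
  ext α
  rw [eq_smul_sum_dx α]
  simp [h]

instance instFiniteDimensionalForm : FiniteDimensional ℝ (Form d p) := by
  refine ⟨Submodule.fg_def.2 ⟨Set.range dx, Set.finite_range _, ?_⟩⟩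
  rw [eq_top_iff]
  intro α _
  rw [eq_smul_sum_dx α]
  refine Submodule.smul_mem _ _ (Submodule.sum_mem _ fun I _ => Submodule.smul_mem _ _ ?_)
  exact Submodule.subset_span ⟨I, rfl⟩

/-! ### The exterior product -/

/-- The exterior product as a bilinear map. -/
def wedgeL (h : p + q = r) : Form d p →ₗ[ℝ] Form d q →ₗ[ℝ] Form d r :=
  LinearMap.mk₂ ℝ (wedge h)
    (fun α α' β => by
      simp only [wedge, coeff_add, add_mul, add_smul, Finset.sum_add_distrib, smul_add])
    (fun c α β => by
      simp only [wedge, coeff_smul]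
      rw [smul_comm c]
      simp only [Finset.smul_sum (r := c), smul_smul, mul_assoc])
    (fun α β β' => by
      simp only [wedge, coeff_add, mul_add, add_smul, Finset.sum_add_distrib, smul_add])
    (fun c α β => by
      simp only [wedge, coeff_smul]
      rw [smul_comm c]
      simp only [Finset.smul_sum (r := c), smul_smul, mul_left_comm c])

lemma wedgeL_apply (h : p + q = r) (α : Form d p) (β : Form d q) :
    wedgeL h α β = wedge h α β := rfl

lemma dx_join_comp (h : p + q = r) (I : Fin p → Fin d) (J : Fin q → Fin d)
    (σ : Equiv.Perm (Fin p)) (τ : Equiv.Perm (Fin q)) :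
    dx (join h (I ∘ σ) (J ∘ τ)) =
      (Equiv.Perm.sign σ * Equiv.Perm.sign τ : ℝ) • dx (join h I J) := by
  obtain ⟨ρ, hρ, hj⟩ := exists_join_perm (d := d) h σ τ
  rw [hj, dx_comp, hρ]
  push_cast
  rfl

/-- `dx^I ∧ dx^J = dx^{IJ}`. -/
lemma wedge_dx_dx (h : p + q = r) (I : Fin p → Fin d) (J : Fin q → Fin d) :
    wedge h (dx I) (dx J) = dx (join h I J) := by
  have h1 : ∀ I' : Fin p → Fin d, ∑ J', coeff (dx J) J' • dx (join h I' J') =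
      (q.factorial : ℝ) • dx (join h I' J) := fun I' =>
    sum_coeff_dx_smul (fun J' => dx (join h I' J'))
      (fun K σ => by simpa using dx_join_comp h I' K 1 σ) J
  have h2 := sum_coeff_dx_smul (fun I' => dx (join h I' J))
      (fun K σ => by simpa using dx_join_comp h K J σ 1) I
  simp only [wedge, mul_smul, ← Finset.smul_sum, h1, smul_comm _ (q.factorial : ℝ), h2]
  rw [smul_smul, smul_smul]
  have hp : (p.factorial : ℝ) ≠ 0 := by positivity
  have hq : (q.factorial : ℝ) ≠ 0 := by positivity
  convert one_smul ℝ (dx (join h I J)) using 2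
  field_simp

/-- The exterior product `v ∧ α` of a covector and a form. The degree of the result is given up to
an equality. -/
def covWedge (h : p + 1 = q) (v : Mink d →L[ℝ] ℝ) (α : Form d p) : Form d q :=
  h ▸ ContinuousAlternatingMap.alternatizeUncurryFin (v.smulRight α)

lemma covWedge_rfl_apply (v : Mink d →L[ℝ] ℝ) (α : Form d p) (w : Fin (p + 1) → Mink d) :
    covWedge rfl v α w = ∑ i : Fin (p + 1), (-1) ^ (i : ℕ) * (v (w i) * α (i.removeNth w)) := by
  simp [covWedge, ContinuousAlternatingMap.alternatizeUncurryFin_apply]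

/-- `covWedge` as a bilinear map. -/
def covWedgeL (h : p + 1 = q) : (Mink d →L[ℝ] ℝ) →ₗ[ℝ] Form d p →ₗ[ℝ] Form d q :=
  LinearMap.mk₂ ℝ (covWedge h)
    (fun v v' α => by
      subst h; ext w
      simp [covWedge_rfl_apply, mul_add, add_mul, Finset.sum_add_distrib])
    (fun c v α => by
      subst h; ext w
      simp [covWedge_rfl_apply, Finset.mul_sum, mul_assoc, mul_left_comm c])
    (fun v α α' => by
      subst h; ext w
      simp [covWedge_rfl_apply, mul_add, Finset.sum_add_distrib])
    (fun c v α => by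
      subst h; ext w
      simp [covWedge_rfl_apply, Finset.mul_sum, mul_left_comm c])

lemma covWedgeL_apply (h : p + 1 = q) (v : Mink d →L[ℝ] ℝ) (α : Form d p) :
    covWedgeL h v α = covWedge h v α := rfl

lemma covWedge_zero (h : p + 1 = q) (v : Mink d →L[ℝ] ℝ) : covWedge h v (0 : Form d p) = 0 :=
  map_zero (covWedgeL h v)

lemma covWedge_smul (h : p + 1 = q) (v : Mink d →L[ℝ] ℝ) (c : ℝ) (α : Form d p) :
    covWedge h v (c • α) = c • covWedge h v α :=
  map_smul (covWedgeL h v) c α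

lemma covWedge_add (h : p + 1 = q) (v : Mink d →L[ℝ] ℝ) (α β : Form d p) :
    covWedge h v (α + β) = covWedge h v α + covWedge h v β :=
  map_add (covWedgeL h v) α β

/-- The coordinate covector `dx^i`. -/
def coord (i : Fin d) : Mink d →L[ℝ] ℝ := ContinuousLinearMap.proj i

lemma sum_smul_e (w : Mink d) : ∑ i, w i • e i = w := by
  simpa [e, ← Pi.single_smul] using Finset.univ_sum_single w

lemma sum_apply_smul_coord (v : Mink d →L[ℝ] ℝ) : ∑ i, v (e i) • coord i = v := by
  ext w
  conv_rhs => rw [← sum_smul_e w]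
  simp [coord, mul_comm]

/-- A linear map on covectors is determined by its values on the coordinate covectors. -/
lemma covector_linearMap_ext {M : Type*} [AddCommGroup M] [Module ℝ M]
    {f g : (Mink d →L[ℝ] ℝ) →ₗ[ℝ] M} (h : ∀ i, f (coord i) = g (coord i)) : f = g := by
  ext v
  rw [← sum_apply_smul_coord v]
  simp [h]

/-- `dx^i ∧ dx^I = dx^{iI}`, by expansion of a determinant along its first column. -/
lemma covWedge_coord_dx (i : Fin d) (I : Fin p → Fin d) :
    covWedge rfl (coord i) (dx I) = dx (Fin.cons i I) := by
  ext w
  rw [covWedge_rfl_apply, dx_apply, Matrix.det_succ_column_zero]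
  refine Finset.sum_congr rfl fun a _ => ?_
  rw [mul_assoc]
  rfl

lemma oneForm_coord (i : Fin d) : oneForm (coord i) = dx fun _ : Fin 1 => i := by
  ext w
  rw [dx_apply, Matrix.det_fin_one]
  rfl

/-- The linear map `v ↦ oneForm v`. -/
def oneFormL : (Mink d →L[ℝ] ℝ) →ₗ[ℝ] Form d 1 where
  toFun := oneForm
  map_add' _ _ := rfl
  map_smul' _ _ := rfl

lemma wedge_oneForm (h : 1 + p = q) (v : Mink d →L[ℝ] ℝ) (α : Form d p) :
    wedge h (oneForm v) α = covWedge ((add_comm p 1).trans h) v α := by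
  suffices H : (wedgeL h).comp oneFormL = covWedgeL (d := d) ((add_comm p 1).trans h) from
    LinearMap.congr_fun₂ H v α
  refine covector_linearMap_ext fun i => form_linearMap_ext fun I => ?_
  change wedge h (oneForm (coord i)) (dx I) = covWedge _ (coord i) (dx I)
  obtain rfl : q = p + 1 := by omega
  rw [oneForm_coord, wedge_dx_dx, covWedge_coord_dx]
  congr 1
  ext j
  refine Fin.cases ?_ (fun j => ?_) j
  · have := join_left h (fun _ : Fin 1 => i) I 0
    have e1 : Fin.cast h (Fin.castAdd p 0) = 0 := by ext; simp
    rw [e1] at this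
    rw [this, Fin.cons_zero]
  · have := join_right h (fun _ : Fin 1 => i) I j
    have e2 : Fin.cast h (Fin.natAdd 1 j) = j.succ := by ext; simp
    rw [e2] at this
    simp [this]

lemma join_cons_left (h : p + q = r) (h' : p + 1 + q = r + 1) (i : Fin d) (I : Fin p → Fin d)
    (J : Fin q → Fin d) :
    join h' (Fin.cons i I : Fin (p + 1) → Fin d) J = Fin.cons i (join h I J) := by
  subst h
  ext a
  simp [join, Fin.append_cons]

lemma join_cons_right (h' : p + 1 + q = r) (h'' : p + (q + 1) = r) (i : Fin d) (I : Fin p → Fin d)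
    (J : Fin q → Fin d) :
    join h'' I (Fin.cons i J : Fin (q + 1) → Fin d) =
      join h' ((Fin.cons i I : Fin (p + 1) → Fin d) ∘ finRotate (p + 1)) J := by
  subst h'
  have := Fin.snoc_eq_cons_rotate I i
  ext a
  simp only [join, Fin.append_right_cons, this, Function.comp_def]
  rfl

lemma sign_finRotate_succ (p : ℕ) :
    ((Equiv.Perm.sign (finRotate (p + 1)) : ℤˣ) : ℝ) = (-1) ^ p := by
  simp [sign_finRotate]

/-- `v ∧ (α ∧ β) = (v ∧ α) ∧ β`. -/
lemma covWedge_wedge (h : p + q = r) (h' : p + 1 + q = r + 1) (v : Mink d →L[ℝ] ℝ)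
    (α : Form d p) (β : Form d q) :
    covWedge rfl v (wedge h α β) = wedge h' (covWedge rfl v α) β := by
  have h1 : ∀ i I, ((covWedgeL (d := d) (rfl : r + 1 = r + 1) (coord i)).comp (wedgeL h (dx I))) =
      wedgeL h' (covWedge rfl (coord i) (dx I)) := fun i I => form_linearMap_ext fun J => by
    simp [covWedgeL_apply, wedgeL_apply, covWedge_coord_dx, wedge_dx_dx, join_cons_left h h']
  have h2 : ∀ i, ((covWedgeL (d := d) (rfl : r + 1 = r + 1) (coord i)).comp ((wedgeL h).flip β)) =
      ((wedgeL h').flip β).comp (covWedgeL rfl (coord i)) := fun i => form_linearMap_ext fun I =>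
    LinearMap.congr_fun (h1 i I) β
  have h3 : (covWedgeL (d := d) (rfl : r + 1 = r + 1)).flip (wedge h α β) =
      ((wedgeL h').flip β).comp ((covWedgeL rfl).flip α) := covector_linearMap_ext fun i =>
    LinearMap.congr_fun (h2 i) α
  exact LinearMap.congr_fun h3 v

/-- `v ∧ (α ∧ β) = (-1)^p α ∧ (v ∧ β)`. -/
lemma covWedge_wedge_right (h : p + q = r) (h'' : p + (q + 1) = r + 1) (v : Mink d →L[ℝ] ℝ)
    (α : Form d p) (β : Form d q) :
    covWedge rfl v (wedge h α β) = (-1 : ℝ) ^ p • wedge h'' α (covWedge rfl v β) := by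
  have h' : p + 1 + q = r + 1 := by omega
  have h1 : ∀ i I, ((covWedgeL (d := d) (rfl : r + 1 = r + 1) (coord i)).comp (wedgeL h (dx I))) =
      (-1 : ℝ) ^ p • (wedgeL h'' (dx I)).comp (covWedgeL rfl (coord i)) :=
    fun i I => form_linearMap_ext fun J => by
    simp only [LinearMap.comp_apply, covWedgeL_apply, wedgeL_apply, covWedge_coord_dx,
      wedge_dx_dx, LinearMap.smul_apply]
    rw [← join_cons_left h h', join_cons_right h' h'']
    have := dx_join_comp h' (Fin.cons i I : Fin (p + 1) → Fin d) J (finRotate (p + 1)) 1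
    rw [sign_finRotate_succ] at this
    simp only [Equiv.Perm.coe_one, Function.comp_id, Equiv.Perm.sign_one, Units.val_one,
      Int.cast_one, mul_one] at this
    rw [this, smul_smul, ← pow_add, Even.neg_one_pow ⟨p, rfl⟩, one_smul]
  have h2 : ∀ i, ((covWedgeL (d := d) (rfl : r + 1 = r + 1) (coord i)).comp ((wedgeL h).flip β)) =
      (-1 : ℝ) ^ p • ((wedgeL h'').flip (covWedge rfl (coord i) β)) :=
    fun i => form_linearMap_ext fun I => LinearMap.congr_fun (h1 i I) β
  have h3 : (covWedgeL (d := d) (rfl : r + 1 = r + 1)).flip (wedge h α β) =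
      (-1 : ℝ) ^ p • (wedgeL h'' α).comp ((covWedgeL rfl).flip β) :=
    covector_linearMap_ext fun i => LinearMap.congr_fun (h2 i) α
  exact LinearMap.congr_fun h3 v

lemma covWedge_covWedge_self (h : p + 1 = q) (h' : q + 1 = r) (v : Mink d →L[ℝ] ℝ)
    (α : Form d p) : covWedge h' v (covWedge h v α) = 0 := by
  subst h h'
  have h := ContinuousAlternatingMap.alternatizeUncurryFin_alternatizeUncurryFinCLM_comp_of_symmetric
    (f := v.smulRight (v.smulRight α)) fun x y => by
      ext w
      simp only [ContinuousLinearMap.smulRight_apply, smul_apply,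
        ContinuousAlternatingMap.smul_apply, smul_eq_mul]
      ring
  rw [← h]
  unfold covWedge
  dsimp only
  congr 1
  refine ContinuousLinearMap.ext fun x => ?_
  simp

end Algebra

/-! ### The interior product -/

section Metric

variable {d p q r : ℕ}

/-- The inner product `η^{ij} u_i v_j` of covectors. -/
def covInner (u v : Mink d →L[ℝ] ℝ) : ℝ := ∑ i, eta i * (u (e i) * v (e i))

lemma covInner_self (a : Mink d → ℝ) (x : Mink d) :
    covInner (fderiv ℝ a x) (fderiv ℝ a x) = gradSq a x := by
  simp [covInner, gradSq, sq]

lemma apply_dual (u v : Mink d →L[ℝ] ℝ) :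
    u (fun i => eta i * v (e i)) = covInner u v := by
  conv_lhs => rw [← sum_smul_e fun i => eta i * v (e i)]
  simp only [map_sum, map_smul, smul_eq_mul, covInner]
  exact Finset.sum_congr rfl fun i _ => by ring

lemma removeNth_succ_vecCons {α : Type*} (x : α) (w : Fin (p + 1) → α) (i : Fin (p + 1)) :
    i.succ.removeNth (Matrix.vecCons x w : Fin (p + 2) → α) = Matrix.vecCons x (i.removeNth w) := by
  ext j
  refine Fin.cases ?_ (fun j => ?_) j
  · simp [Fin.removeNth]
  · simp [Fin.removeNth]

/-- The contraction with a vector is an antiderivation of the exterior product with a covector. -/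
lemma curryLeft_covWedge (u : Mink d →L[ℝ] ℝ) (y : Mink d) (α : Form d (p + 1)) :
    (covWedge rfl u α).curryLeft y + covWedge rfl u (α.curryLeft y) = u y • α := by
  ext w
  simp only [ContinuousAlternatingMap.add_apply,
    ContinuousAlternatingMap.curryLeft_apply_apply, covWedge_rfl_apply,
    ContinuousAlternatingMap.smul_apply, smul_eq_mul]
  rw [Fin.sum_univ_succ]
  simp only [removeNth_succ_vecCons, Matrix.cons_val_succ, Matrix.cons_val_zero,
    Fin.val_succ, pow_succ]
  have : (0 : Fin (p + 2)).removeNth (Matrix.vecCons y w) = w := by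
    ext j; simp [Fin.removeNth]
  rw [this]
  simp

/-- `ι_v (u ∧ α) + u ∧ ι_v α = (u, v) α`. -/
lemma interior_covWedge (u v : Mink d →L[ℝ] ℝ) (α : Form d (p + 1)) :
    interior v (covWedge rfl u α) + covWedge rfl u (interior v α) = covInner u v • α := by
  rw [← apply_dual]
  exact curryLeft_covWedge u _ α

/-- A form that is annihilated by the exterior product with a covector that is not null is a
multiple of the covector. -/
lemma eq_covWedge_of_covWedge_eq_zero {v : Mink d →L[ℝ] ℝ} (hv : covInner v v ≠ 0)
    {α : Form d (p + 1)} (h : covWedge rfl v α = 0) :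
    α = covWedge rfl v ((covInner v v)⁻¹ • interior v α) := by
  have h1 := interior_covWedge v v α
  have h2 : interior v (0 : Form d (p + 1 + 1)) = 0 := rfl
  rw [h, h2, zero_add] at h1
  rw [covWedge_smul, h1, smul_smul, inv_mul_cancel₀ hv, one_smul]

lemma interior_interior (v : Mink d →L[ℝ] ℝ) (α : Form d (p + 2)) :
    interior v (interior v α) = 0 := by
  ext w
  refine α.map_eq_zero_of_eq _ (i := 0) (j := 1) ?_ (by simp)
  simp

/-- The interior product as a bilinear map. -/
def interiorL : (Mink d →L[ℝ] ℝ) →ₗ[ℝ] Form d (p + 1) →ₗ[ℝ] Form d p :=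
  LinearMap.mk₂ ℝ interior
    (fun v v' α => by
      ext w
      simp only [interior, ContinuousAlternatingMap.add_apply]
      rw [← ContinuousAlternatingMap.add_apply, ← map_add]
      congr 2
      ext i
      simp [mul_add])
    (fun c v α => by
      ext w
      simp only [interior, ContinuousAlternatingMap.smul_apply]
      rw [← ContinuousAlternatingMap.smul_apply, ← map_smul]
      congr 2
      ext i
      simp [mul_left_comm])
    (fun v α α' => rfl)
    (fun c v α => rfl)

lemma interiorL_apply (v : Mink d →L[ℝ] ℝ) (α : Form d (p + 1)) :
    interiorL v α = interior v α := rfl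

lemma interior_zero (v : Mink d →L[ℝ] ℝ) : interior v (0 : Form d (p + 1)) = 0 := rfl

lemma coeff_interior_coord (i : Fin d) (α : Form d (p + 1)) (I : Fin p → Fin d) :
    coeff (interior (coord i) α) I = eta i * coeff α (Fin.cons i I) := by
  have : (fun j => eta j * coord i (e j)) = eta i • (e i : Mink d) := by
    ext j
    by_cases h : i = j
    · subst h; simp [coord, e]
    · simp [coord, e, Ne.symm h]
  simp only [interior, this, map_smul, coeff_smul]
  simp only [coeff, ContinuousAlternatingMap.curryLeft_apply_apply]
  congr 2
  ext a
  refine Fin.cases ?_ (fun a => ?_) a <;> simp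

/-! ### The Hodge star -/

/-- The Hodge star as a linear map. -/
def hodgeStarL (h : p + q = d) : Form d p →ₗ[ℝ] Form d q where
  toFun := hodgeStar h
  map_add' := hodgeStar_add h
  map_smul' := hodgeStar_smul h

lemma hodgeStarL_apply (h : p + q = d) (α : Form d p) : hodgeStarL h α = hodgeStar h α := rfl

lemma hodgeStar_zero (h : p + q = d) : hodgeStar h (0 : Form d p) = 0 := map_zero (hodgeStarL h)

lemma levi_join_comp (h : p + q = d) (I : Fin p → Fin d) (J : Fin q → Fin d)
    (σ : Equiv.Perm (Fin p)) (τ : Equiv.Perm (Fin q)) :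
    levi (join h (I ∘ σ) (J ∘ τ)) =
      (Equiv.Perm.sign σ * Equiv.Perm.sign τ : ℝ) * levi (join h I J) := by
  obtain ⟨ρ, hρ, hj⟩ := exists_join_perm (d := d) h σ τ
  rw [hj, levi_comp, hρ]
  push_cast
  rfl

/-- `⋆ dx^I` has the components `η^{II} ε_{IK}`. -/
lemma coeff_hodgeStar_dx (h : p + q = d) (I : Fin p → Fin d) (K : Fin q → Fin d) :
    coeff (hodgeStar h (dx I)) K = etaProd I * levi (join h I K) := by
  have h1 : ∀ L : Fin p → Fin d, coeff (∑ J : Fin q → Fin d, levi (join h L J) • dx J) K =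
      q.factorial * levi (join h L K) := fun L =>
    coeff_sum_dx (fun J => levi (join h L J))
      (fun J σ => by simpa using levi_join_comp h L J 1 σ) K
  have h2 := sum_coeff_dx_smul (fun L => etaProd L * levi (join h L K))
      (fun L σ => by
        rw [etaProd_comp]
        have := levi_join_comp h L K σ 1
        simp only [Equiv.Perm.coe_one, Function.comp_id, Equiv.Perm.sign_one, Units.val_one,
          Int.cast_one, mul_one] at this
        rw [this, smul_eq_mul]
        ring) I
  simp only [hodgeStar, coeff_smul, coeff_sum] at h1 ⊢
  simp only [mul_assoc, ← Finset.mul_sum, h1]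
  simp only [smul_eq_mul] at h2
  have h3 : ∑ L : Fin p → Fin d, etaProd L * (coeff (dx I) L * (q.factorial * levi (join h L K))) =
      q.factorial * ∑ L : Fin p → Fin d, coeff (dx I) L * (etaProd L * levi (join h L K)) := by
    rw [Finset.mul_sum]
    exact Finset.sum_congr rfl fun L _ => by ring
  rw [h3, h2]
  have hp : (p.factorial : ℝ) ≠ 0 := by positivity
  have hq : (q.factorial : ℝ) ≠ 0 := by positivity
  field_simp

lemma etaProd_cons (i : Fin d) (I : Fin p → Fin d) :
    etaProd (Fin.cons i I : Fin (p + 1) → Fin d) = eta i * etaProd I := by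
  simp [etaProd, Fin.prod_univ_succ]

/-- The Hodge star exchanges exterior and interior products: `ι_v ⋆α = (-1)^p ⋆(v ∧ α)`. -/
lemma interior_hodgeStar (h : p + (q + 1) = d) (h' : p + 1 + q = d) (v : Mink d →L[ℝ] ℝ)
    (α : Form d p) :
    interior v (hodgeStar h α) = (-1 : ℝ) ^ p • hodgeStar h' (covWedge rfl v α) := by
  have h1 : ∀ i, (interiorL (coord i)).comp (hodgeStarL h) =
      (-1 : ℝ) ^ p • (hodgeStarL h').comp (covWedgeL rfl (coord i)) :=
    fun i => form_linearMap_ext fun I => form_ext fun K _ => by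
      simp only [LinearMap.comp_apply, LinearMap.smul_apply, interiorL_apply, hodgeStarL_apply,
        covWedgeL_apply, coeff_interior_coord, coeff_hodgeStar_dx, covWedge_coord_dx, coeff_smul,
        etaProd_cons, join_cons_right h' h]
      have := levi_join_comp h' (Fin.cons i I : Fin (p + 1) → Fin d) K (finRotate (p + 1)) 1
      rw [sign_finRotate_succ] at this
      simp only [Equiv.Perm.coe_one, Function.comp_id, Equiv.Perm.sign_one, Units.val_one,
        Int.cast_one, mul_one] at this
      rw [this]
      ring
  have h2 : interiorL.flip (hodgeStar h α) =
      (-1 : ℝ) ^ p • (hodgeStarL h').comp ((covWedgeL rfl).flip α) :=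
    covector_linearMap_ext fun i => LinearMap.congr_fun (h1 i) α
  exact LinearMap.congr_fun h2 v

lemma hodgeStar_eq_zero (h : p + q = d) {α : Form d p} (hα : hodgeStar h α = 0) : α = 0 := by
  refine form_ext fun I hI => ?_
  obtain ⟨K, hK⟩ := exists_join h I hI
  have h1 := coeff_hodgeStar h α I K hK
  rw [hα] at h1
  have h2 : coeff (0 : Form d q) K = 0 := rfl
  have h3 : coeff (0 : Form d p) I = 0 := rfl
  rw [h3]
  linear_combination (levi (join h I K) * etaProd I) * (h2 - h1) -
    coeff α I * (etaProd I * etaProd I) * levi_sq hK - coeff α I * etaProd_mul_self I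

/-! ### The pairing of forms of complementary degrees -/

lemma exists_flip (h : p + q = r) (h' : q + p = r) : ∃ ρ : Equiv.Perm (Fin r),
    ∀ (I : Fin p → Fin d) (J : Fin q → Fin d), join h' J I = join h I J ∘ ρ := by
  subst h
  refine ⟨(finCongr h').symm.trans finAddFlip, fun I J => ?_⟩
  ext i
  obtain ⟨i, rfl⟩ := (finCongr h').surjective i
  refine Fin.addCases (fun a => ?_) (fun a => ?_) i <;>
  simp [join, -Fin.natAdd_eq_addNat]

lemma density_dx (K : Fin d → Fin d) : density (dx K) = levi K := by
  rw [density, coeff_dx_comm, coeff, dx_apply, levi]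
  congr 1
  ext a b
  simp [e, Pi.single_apply, eq_comm]

/-- The density of a top form as a linear map. -/
def densityL (d : ℕ) : Form d d →ₗ[ℝ] ℝ where
  toFun := density
  map_add' _ _ := rfl
  map_smul' _ _ := rfl

lemma densityL_apply (α : Form d d) : densityL d α = density α := rfl

lemma density_vol : density (vol d) = 1 := by
  rw [vol, density_dx]
  exact Matrix.det_one (n := Fin d) (R := ℝ)

/-- A top form is determined by its density. -/
lemma density_injective : Function.Injective (density : Form d d → ℝ) := by
  intro α β h
  refine form_ext fun I hI => ?_
  have hα := coeff_perm α id (Equiv.ofBijective I (Finite.injective_iff_bijective.1 hI))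
  have hβ := coeff_perm β id (Equiv.ofBijective I (Finite.injective_iff_bijective.1 hI))
  change coeff α I = _ * density α at hα
  change coeff β I = _ * density β at hβ
  rw [hα, hβ, h]

lemma etaProd_mul_of_injective (h : p + q = d) (hd : d ≠ 0) {I : Fin p → Fin d}
    {K : Fin q → Fin d} (hK : Function.Injective (join h I K)) : etaProd I * etaProd K = -1 := by
  obtain ⟨d, rfl⟩ := Nat.exists_eq_succ_of_ne_zero hd
  have h1 : ∏ i : Fin (d + 1), eta (join h I K i) = -1 := by
    rw [← prod_eta d]
    exact Equiv.prod_comp (Equiv.ofBijective _ (Finite.injective_iff_bijective.1 hK)) eta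
  rw [← h1, ← Equiv.prod_comp (finSumFinEquiv.trans (finCongr h)), Fintype.prod_sum_type]
  simp [etaProd, join, -Fin.natAdd_eq_addNat]

/-- The exterior product with `dx^I` is, up to a nonzero factor, the component of the Hodge dual
along `I`. The sign `s` is that of the exchange of a block of `p` and a block of `q` indices. -/
lemma density_wedge_dx_of_sign (h : p + q = d) (h' : q + p = d) (hd : d ≠ 0) {s : ℝ}
    (hs : ∀ (I : Fin p → Fin d) (J : Fin q → Fin d),
      levi (join h' J I) = s * levi (join h I J)) (hs1 : s * s = 1)
    (I : Fin p → Fin d) (β : Form d q) :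
    density (wedge h (dx I) β) = -s * (etaProd I * coeff (hodgeStar h' β) I) := by
  let f : Form d q →ₗ[ℝ] ℝ :=
    { toFun := fun β => -s * (etaProd I * coeff (hodgeStar h' β) I)
      map_add' := fun β β' => by rw [hodgeStar_add, coeff_add]; ring
      map_smul' := fun c β => by
        rw [hodgeStar_smul, coeff_smul, RingHom.id_apply, smul_eq_mul]; ring }
  suffices H : (densityL d).comp (wedgeL h (dx I)) = f from LinearMap.congr_fun H β
  refine form_linearMap_ext fun J => ?_
  change density (wedge h (dx I) (dx J)) = -s * (etaProd I * coeff (hodgeStar h' (dx J)) I)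
  rw [wedge_dx_dx, density_dx, coeff_hodgeStar_dx, hs]
  by_cases hIJ : Function.Injective (join h I J)
  · have := etaProd_mul_of_injective h hd hIJ
    linear_combination (-levi (join h I J)) * hs1 + (levi (join h I J) * s * s) * this
  · rw [levi_eq_zero hIJ]; ring

/-- The pairing `(ρ, γ) ↦ ρ ∧ γ` of forms of complementary degrees is nondegenerate. -/
lemma eq_zero_of_forall_density_wedge (h : p + q = d) (hd : d ≠ 0) {γ : Form d q}
    (hγ : ∀ I, density (wedge h (dx I) γ) = 0) : γ = 0 := by
  have h' : q + p = d := by omega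
  obtain ⟨ρ, hρ⟩ := exists_flip (d := d) h h'
  refine hodgeStar_eq_zero h' (form_ext fun I _ => ?_)
  have h1 := density_wedge_dx_of_sign h h' hd (s := (Equiv.Perm.sign ρ : ℝ))
    (fun I J => by rw [hρ, levi_comp]) (sign_mul_sign ρ) I γ
  rw [hγ] at h1
  change _ = 0
  linear_combination (-(coeff (hodgeStar h' γ) I) * (etaProd I * etaProd I)) * sign_mul_sign ρ -
    coeff (hodgeStar h' γ) I * etaProd_mul_self I + (Equiv.Perm.sign ρ * etaProd I : ℝ) * h1

/-- The Minkowski inner product of forms as a bilinear form. -/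
def formInnerL : Form d p →ₗ[ℝ] Form d p →ₗ[ℝ] ℝ :=
  LinearMap.mk₂ ℝ formInner
    (fun α α' β => by
      simp only [formInner, coeff_add, mul_add, Finset.sum_add_distrib, add_mul])
    (fun c α β => by
      simp only [formInner, coeff_smul, smul_eq_mul, Finset.mul_sum]
      exact Finset.sum_congr rfl fun _ _ => by ring)
    (fun α β β' => by
      simp only [formInner, coeff_add, ← mul_add, ← Finset.sum_add_distrib])
    (fun c α β => by
      simp only [formInner, coeff_smul, smul_eq_mul, Finset.mul_sum]
      exact Finset.sum_congr rfl fun _ _ => by ring)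

lemma formInner_comm (α β : Form d p) : formInner α β = formInner β α := by
  simp only [formInner]
  congr 1
  exact Finset.sum_congr rfl fun _ _ => by ring

lemma formInner_dx (I : Fin p → Fin d) (β : Form d p) :
    formInner (dx I) β = etaProd I * coeff β I := by
  have := sum_coeff_dx_smul (fun J => etaProd J * coeff β J) (fun J σ => by
    rw [etaProd_comp, coeff_perm, smul_eq_mul]; ring) I
  simp only [smul_eq_mul] at this
  have h3 : ∑ J : Fin p → Fin d, etaProd J * coeff (dx I) J * coeff β J =
      ∑ J : Fin p → Fin d, coeff (dx I) J * (etaProd J * coeff β J) :=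
    Finset.sum_congr rfl fun J _ => by ring
  rw [formInner, h3, this, ← mul_assoc, inv_mul_cancel₀ (by positivity), one_mul]

end Metric

/-! ### Forms of the middle degree -/

section Middle

variable {k : ℕ}

/-- The Hodge star on forms of the middle degree as a linear map. -/
def hodgeL (k : ℕ) : SForm k (2 * k + 1) →ₗ[ℝ] SForm k (2 * k + 1) := hodgeStarL (by omega)

/-- The exterior product of forms of the middle degree as a bilinear map. -/
def wedgeMidL (k : ℕ) :
    SForm k (2 * k + 1) →ₗ[ℝ] SForm k (2 * k + 1) →ₗ[ℝ] SForm k (4 * k + 2) := wedgeL (by omega)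

lemma hodge_hodge (G : SForm k (2 * k + 1)) : hodge (hodge G) = G := hodgeStar_hodgeStar _ G

lemma hodge_add (G G' : SForm k (2 * k + 1)) : hodge (G + G') = hodge G + hodge G' :=
  hodgeStar_add _ G G'

lemma hodge_sub (G G' : SForm k (2 * k + 1)) : hodge (G - G') = hodge G - hodge G' :=
  map_sub (hodgeL k) G G'

lemma hodge_smul (c : ℝ) (G : SForm k (2 * k + 1)) : hodge (c • G) = c • hodge G :=
  hodgeStar_smul _ c G

lemma neg_one_pow_mid (k : ℕ) : (-1 : ℝ) ^ (2 * k + 1) = -1 := by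
  rw [pow_succ, pow_mul]; simp

lemma wedgeMid_add (G G' G'' : SForm k (2 * k + 1)) :
    wedgeMid G (G' + G'') = wedgeMid G G' + wedgeMid G G'' := map_add (wedgeMidL k G) G' G''

lemma wedgeMid_sub (G G' G'' : SForm k (2 * k + 1)) :
    wedgeMid G (G' - G'') = wedgeMid G G' - wedgeMid G G'' := map_sub (wedgeMidL k G) G' G''

lemma wedgeMid_smul (c : ℝ) (G G' : SForm k (2 * k + 1)) :
    wedgeMid G (c • G') = c • wedgeMid G G' := map_smul (wedgeMidL k G) c G'

lemma add_wedgeMid (G G' G'' : SForm k (2 * k + 1)) :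
    wedgeMid (G + G') G'' = wedgeMid G G'' + wedgeMid G' G'' := (wedgeMidL k).map_add₂ G G' G''

lemma sub_wedgeMid (G G' G'' : SForm k (2 * k + 1)) :
    wedgeMid (G - G') G'' = wedgeMid G G'' - wedgeMid G' G'' := (wedgeMidL k).map_sub₂ G G' G''

lemma smul_wedgeMid (c : ℝ) (G G' : SForm k (2 * k + 1)) :
    wedgeMid (c • G) G' = c • wedgeMid G G' := (wedgeMidL k).map_smul₂ c G G'

lemma zero_wedgeMid (G : SForm k (2 * k + 1)) : wedgeMid 0 G = 0 := (wedgeMidL k).map_zero₂ G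

lemma wedgeMid_zero (G : SForm k (2 * k + 1)) : wedgeMid G 0 = 0 := map_zero (wedgeMidL k G)

/-- The exterior product of forms of odd degree is antisymmetric. -/
lemma wedgeMid_comm (G G' : SForm k (2 * k + 1)) : wedgeMid G G' = -wedgeMid G' G := by
  have h : 2 * k + 1 + (2 * k + 1) = 4 * k + 2 := by omega
  have h1 : ∀ I, wedgeMidL k (dx I) = -(wedgeMidL k).flip (dx I) := fun I =>
    form_linearMap_ext fun J => density_injective <| by
      change density (wedge h (dx I) (dx J)) = -density (wedge h (dx J) (dx I))
      rw [wedge_dx_dx, wedge_dx_dx, density_dx, density_dx, levi_join_comm h J I, neg_one_pow_mid]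
      ring
  have h2 : (wedgeMidL k).flip G' = -wedgeMidL k G' := form_linearMap_ext fun I =>
    LinearMap.congr_fun (h1 I) G'
  exact LinearMap.congr_fun h2 G

lemma wedgeMid_self (G : SForm k (2 * k + 1)) : wedgeMid G G = 0 :=
  density_injective <| by
    have h : density (wedgeMid G G) = -density (wedgeMid G G) :=
      congrArg density (wedgeMid_comm G G)
    change _ = (0 : ℝ)
    linarith

/-- `α ∧ β = ⟨α, ⋆β⟩ vol`. -/
lemma density_wedgeMid (α β : SForm k (2 * k + 1)) :
    density (wedgeMid α β) = formInner α (hodge β) := by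
  have h : 2 * k + 1 + (2 * k + 1) = 4 * k + 2 := by omega
  suffices H : (densityL _).comp ((wedgeMidL k).flip β) = formInnerL.flip (hodge β) from
    LinearMap.congr_fun H α
  refine form_linearMap_ext fun I => ?_
  change density (wedge h (dx I) β) = formInner (dx I) (hodgeStar h β)
  rw [density_wedge_dx_of_sign h h (by omega) (s := -1)
    (fun I J => by rw [levi_join_comm h I J, neg_one_pow_mid]) (by norm_num), formInner_dx]
  ring

/-- The Hodge star is antisymmetric on forms of the middle degree. -/
lemma formInner_hodge (α β : SForm k (2 * k + 1)) :
    formInner (hodge α) β = -formInner α (hodge β) := by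
  rw [← density_wedgeMid α β, wedgeMid_comm, formInner_comm, ← density_wedgeMid β α]
  change _ = - -density _
  rw [neg_neg]

/-- The exterior product with an anti-self-dual form depends only on the self-dual part. -/
lemma two_smul_wedgeMid_of_antiSelfDual {E : SForm k (2 * k + 1)} (hE : hodge E = -E)
    (S : SForm k (2 * k + 1)) :
    (2 : ℝ) • wedgeMid S E = wedgeMid (S + hodge S) E := by
  rw [two_smul, add_wedgeMid]
  congr 1
  apply density_injective
  rw [density_wedgeMid, density_wedgeMid, formInner_hodge, hodge_hodge, hE]
  exact (formInnerL S).map_neg E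

/-- An anti-self-dual form that is annihilated by the exterior product with a covector that is not
null vanishes: the Hodge star turns `v ∧ E = 0` into `ι_v E = 0`. -/
lemma eq_zero_of_covWedge_eq_zero {E : SForm k (2 * k + 1)} (hE : hodge E = -E)
    {v : Spacetime k →L[ℝ] ℝ} (hv : covInner v v ≠ 0)
    (h : covWedge (rfl : 2 * k + 1 + 1 = _) v E = 0) : E = 0 := by
  have h1 := interior_hodgeStar (d := 4 * k + 2) (p := 2 * k + 1) (q := 2 * k) (by omega)
    (by omega) v E
  rw [h, hodgeStar_zero, smul_zero] at h1
  change interior v (hodge E) = 0 at h1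
  have h2 : interior v E = 0 := by
    rw [hE] at h1
    have : interior v (-E) = -interior v E := map_neg (interiorL v) E
    rw [this] at h1
    exact neg_eq_zero.1 h1
  have h3 := interior_covWedge v v E
  rw [h, h2, covWedge_zero, interior_zero, add_zero] at h3
  exact (smul_eq_zero.1 h3.symm).resolve_left hv

lemma eq_zero_of_interior_eq_zero {S : SForm k (2 * k + 1)} (hS : hodge S = S)
    {v : Spacetime k →L[ℝ] ℝ} (hv : covInner v v ≠ 0) (h : interior v S = 0) : S = 0 := by
  have h1 := interior_hodgeStar (d := 4 * k + 2) (p := 2 * k + 1) (q := 2 * k) (by omega)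
    (by omega) v S
  change interior v (hodge S) = _ at h1
  rw [hS, h, neg_one_pow_mid, eq_comm, smul_eq_zero] at h1
  have h2 := hodgeStar_eq_zero _ (h1.resolve_left (by norm_num))
  have h3 := interior_covWedge v v S
  rw [h, h2, covWedge_zero, interior_zero, add_zero] at h3
  exact (smul_eq_zero.1 h3.symm).resolve_left hv

/-- A self-dual form is determined by its contraction with a covector `v` that is not null: it is
twice the self-dual part of `v ∧ ι_v S / (v, v)`. -/
lemma covWedge_interior_add_hodge {S : SForm k (2 * k + 1)} (hS : hodge S = S)
    (v : Spacetime k →L[ℝ] ℝ) (hv : covInner v v ≠ 0) :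
    covWedge (rfl : 2 * k + 1 = _) v (interior v S) +
      hodge (covWedge rfl v (interior v S)) = covInner v v • S := by
  set P : SForm k (2 * k + 1) := covWedge rfl v (interior v S) with hP
  have h1 : interior v P = covInner v v • interior v S := by
    have := interior_covWedge v v S
    have h2 := congrArg (interior v) this
    have h3 : interior v (interior v (covWedge rfl v S) + covWedge rfl v (interior v S)) =
        interior v (interior v (covWedge rfl v S)) + interior v (covWedge rfl v (interior v S)) :=
      map_add (interiorL v) _ _
    have h4 : interior v (covInner v v • S) = covInner v v • interior v S :=
      map_smul (interiorL v) _ _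
    rw [h3, h4, interior_interior, zero_add] at h2
    exact h2
  have h2 : interior v (hodge P) = 0 := by
    have := interior_hodgeStar (d := 4 * k + 2) (p := 2 * k + 1) (q := 2 * k) (by omega)
      (by omega) v P
    rw [hP, covWedge_covWedge_self, hodgeStar_zero,
      smul_zero] at this
    exact this
  rw [← sub_eq_zero]
  refine eq_zero_of_interior_eq_zero (v := v) ?_ hv ?_
  · rw [hodge_sub, hodge_add, hodge_hodge, hodge_smul, hS, add_comm (hodge P)]
  · have h5 : interior v (P + hodge P - covInner v v • S) =
      interior v P + interior v (hodge P) - covInner v v • interior v S := by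
      simp only [← interiorL_apply, map_add, map_sub, map_smul]
    rw [h5, h1, h2, add_zero, sub_self]

/-! ### The gradient of a function of a self-dual form -/

/-- The map `G ↦ G + ⋆G` onto the self-dual forms, as a linear map. -/
def sdL (k : ℕ) : SForm k (2 * k + 1) →ₗ[ℝ] SelfDual k where
  toFun := sd
  map_add' G G' := Subtype.ext <| by
    change G + G' + hodge (G + G') = G + hodge G + (G' + hodge G')
    rw [hodge_add]
    abel
  map_smul' c G := Subtype.ext <| by
    change c • G + hodge (c • G) = c • (G + hodge G)
    rw [hodge_smul, smul_add]

lemma sdL_apply (G : SForm k (2 * k + 1)) : sdL k G = sd G := rfl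

lemma sd_hodge (G : SForm k (2 * k + 1)) : sd (hodge G) = sd G := Subtype.ext <| by
  change hodge G + hodge (hodge G) = G + hodge G
  rw [hodge_hodge]
  exact add_comm _ _

lemma sd_coe (ζ : SelfDual k) : sd (ζ : SForm k (2 * k + 1)) = (2 : ℝ) • ζ := Subtype.ext <| by
  have : hodge (ζ : SForm k (2 * k + 1)) = ζ := ζ.2
  change (ζ : SForm k (2 * k + 1)) + hodge (ζ : SForm k (2 * k + 1)) =
    (2 : ℝ) • (ζ : SForm k (2 * k + 1))
  rw [this, two_smul]

lemma four_mul_formInner_gradForm (𝓕 : SelfDual k → ℝ) (Y : SelfDual k)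
    (α : SForm k (2 * k + 1)) :
    4 * formInner α (gradForm 𝓕 Y) = fderiv ℝ 𝓕 Y (sd α) := by
  suffices H : (4 : ℝ) • formInnerL.flip (gradForm 𝓕 Y) =
      (fderiv ℝ 𝓕 Y : SelfDual k →ₗ[ℝ] ℝ).comp (sdL k) from LinearMap.congr_fun H α
  refine form_linearMap_ext fun I => ?_
  change 4 * formInner (dx I) (gradForm 𝓕 Y) = fderiv ℝ 𝓕 Y (sd (dx I))
  rw [formInner_dx, gradForm, coeff_smul, coeff_sum_dx]
  · have : ((2 * k + 1).factorial : ℝ) ≠ 0 := by positivity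
    field_simp
    linear_combination fderiv ℝ 𝓕 Y (sd (dx I)) * etaProd_mul_self I
  · intro J σ
    rw [etaProd_comp, dx_comp, ← sdL_apply, map_smul, map_smul, sdL_apply, smul_eq_mul]
    ring

/-- `X = ∂𝓕/∂Y` is anti-self-dual. -/
lemma hodge_gradForm (𝓕 : SelfDual k → ℝ) (Y : SelfDual k) :
    hodge (gradForm 𝓕 Y) = -gradForm 𝓕 Y := by
  refine form_ext fun I _ => ?_
  have h1 := four_mul_formInner_gradForm 𝓕 Y (dx I)
  have h2 := four_mul_formInner_gradForm 𝓕 Y (hodge (dx I))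
  rw [sd_hodge, ← h1, formInner_hodge, formInner_dx, formInner_dx] at h2
  change _ = -coeff (gradForm 𝓕 Y) I
  linear_combination (-(coeff (hodge (gradForm 𝓕 Y)) I) - coeff (gradForm 𝓕 Y) I) *
    etaProd_mul_self I - (1 / 4) * etaProd I * h2

lemma fderiv_eq_two_mul_formInner (𝓕 : SelfDual k → ℝ) (Y ζ : SelfDual k) :
    fderiv ℝ 𝓕 Y ζ = 2 * formInner (ζ : SForm k (2 * k + 1)) (gradForm 𝓕 Y) := by
  have := four_mul_formInner_gradForm 𝓕 Y ζ
  rw [sd_coe, map_smul, smul_eq_mul] at this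
  linarith

/-- The left side `⋆G - G + ⋆X - X` of the nonlinear self-duality relation. -/
def selfDualDefect (𝓕 : SelfDual k → ℝ) (G : SForm k (2 * k + 1)) : SForm k (2 * k + 1) :=
  hodge G - G + hodge (gradForm 𝓕 (sd G)) - gradForm 𝓕 (sd G)

lemma hodge_selfDualDefect (𝓕 : SelfDual k → ℝ) (G : SForm k (2 * k + 1)) :
    hodge (selfDualDefect 𝓕 G) = -selfDualDefect 𝓕 G := by
  simp only [selfDualDefect, hodge_sub, hodge_add, hodge_hodge]
  abel

/-- The first variation of `𝓕(G + ⋆G) vol`. -/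
lemma fderiv_sd_smul_vol (𝓕 : SelfDual k → ℝ) (G η : SForm k (2 * k + 1)) :
    fderiv ℝ 𝓕 (sd G) (sd η) • vol (4 * k + 2) =
      (2 : ℝ) • wedgeMid η (selfDualDefect 𝓕 G - (hodge G - G)) := by
  have : selfDualDefect 𝓕 G - (hodge G - G) = (2 : ℝ) • hodge (gradForm 𝓕 (sd G)) := by
    rw [selfDualDefect, hodge_gradForm, two_smul]
    abel
  rw [this, wedgeMid_smul]
  apply density_injective
  change fderiv ℝ 𝓕 (sd G) (sd η) * density (vol _) =
    2 * (2 * density (wedgeMid η (hodge (gradForm 𝓕 (sd G)))))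
  rw [density_vol, density_wedgeMid, hodge_hodge, ← four_mul_formInner_gradForm]
  ring

end Middle

open MeasureTheory Filter Topology

/-! ### Calculus of bilinear maps and of the exterior derivative -/

section Bilinear

variable {X E F G : Type*} [NormedAddCommGroup X] [NormedSpace ℝ X]
  [NormedAddCommGroup E] [NormedSpace ℝ E] [FiniteDimensional ℝ E]
  [NormedAddCommGroup F] [NormedSpace ℝ F] [FiniteDimensional ℝ F]
  [NormedAddCommGroup G] [NormedSpace ℝ G]

lemma contDiff_linear {n : WithTop ℕ∞} (f : E →ₗ[ℝ] G) {u : X → E} (hu : ContDiff ℝ n u) :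
    ContDiff ℝ n fun x => f (u x) :=
  f.toContinuousLinearMap.contDiff.comp hu

lemma contDiff_bilinear {n : WithTop ℕ∞} (B : E →ₗ[ℝ] F →ₗ[ℝ] G) {u : X → E} {v : X → F}
    (hu : ContDiff ℝ n u) (hv : ContDiff ℝ n v) : ContDiff ℝ n fun x => B (u x) (v x) :=
  (B.toContinuousBilinearMap.contDiff.comp hu).clm_apply hv

lemma continuousOn_linear {T : Type*} [TopologicalSpace T] {s : Set T} (f : E →ₗ[ℝ] G) {u : T → E}
    (hu : ContinuousOn u s) : ContinuousOn (fun x => f (u x)) s :=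
  f.toContinuousLinearMap.continuous.comp_continuousOn hu

lemma continuousOn_bilinear {T : Type*} [TopologicalSpace T] {s : Set T}
    (B : E →ₗ[ℝ] F →ₗ[ℝ] G) {u : T → E} {v : T → F}
    (hu : ContinuousOn u s) (hv : ContinuousOn v s) : ContinuousOn (fun x => B (u x) (v x)) s :=
  (B.toContinuousBilinearMap.continuous.comp_continuousOn hu).clm_apply hv

lemma fderiv_bilinear_apply (B : E →ₗ[ℝ] F →ₗ[ℝ] G) {u : X → E} {v : X → F} {x : X}
    (hu : DifferentiableAt ℝ u x) (hv : DifferentiableAt ℝ v x) (w : X) :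
    fderiv ℝ (fun x => B (u x) (v x)) x w =
      B (fderiv ℝ u x w) (v x) + B (u x) (fderiv ℝ v x w) := by
  have h := (B.toContinuousBilinearMap.hasFDerivAt.comp x hu.hasFDerivAt).clm_apply hv.hasFDerivAt
  have h2 : HasFDerivAt (fun x => B (u x) (v x)) _ x := h
  rw [h2.fderiv]
  simp [add_comm]

lemma fderiv_linear (f : E →ₗ[ℝ] G) {u : X → E} {x : X} (hu : DifferentiableAt ℝ u x) (w : X) :
    fderiv ℝ (fun x => f (u x)) x w = f (fderiv ℝ u x w) := by
  have h : HasFDerivAt (fun x => f (u x)) _ x :=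
    f.toContinuousLinearMap.hasFDerivAt.comp x hu.hasFDerivAt
  rw [h.fderiv]
  simp

end Bilinear

section Calculus

variable {d p q r : ℕ}

/-- `dθ = dx^i ∧ ∂_i θ`. -/
lemma extDeriv_eq_sum (θ : Mink d → Form d p) (x : Mink d) :
    extDeriv θ x = ∑ i, covWedge rfl (coord i) (fderiv ℝ θ x (e i)) := by
  ext w
  rw [extDeriv, ContinuousAlternatingMap.alternatizeUncurryFin_apply,
    ContinuousAlternatingMap.sum_apply]
  simp only [covWedge_rfl_apply]
  rw [Finset.sum_comm]
  refine Finset.sum_congr rfl fun a _ => ?_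
  conv_lhs => rw [← sum_smul_e (w a)]
  simp [Finset.mul_sum, coord, ContinuousAlternatingMap.sum_apply]

lemma contDiff_extDeriv {θ : Mink d → Form d p} (hθ : ContDiff ℝ ∞ θ) :
    ContDiff ℝ ∞ (extDeriv θ) :=
  ContDiff.comp (g := ContinuousAlternatingMap.alternatizeUncurryFinCLM ℝ (Mink d) ℝ)
    (ContinuousLinearMap.contDiff _) (hθ.fderiv_right (m := ∞) le_rfl)

lemma contDiff_extD (h : p + 1 = q) {θ : Mink d → Form d p} (hθ : ContDiff ℝ ∞ θ) :
    ContDiff ℝ ∞ (extD h θ) := by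
  subst h
  exact contDiff_extDeriv hθ

lemma contDiff_wedge {n : WithTop ℕ∞} (h : p + q = r) {α : Mink d → Form d p}
    {β : Mink d → Form d q} (hα : ContDiff ℝ n α) (hβ : ContDiff ℝ n β) :
    ContDiff ℝ n fun x => wedge h (α x) (β x) :=
  contDiff_bilinear (wedgeL h) hα hβ

lemma contDiff_covWedge {n : WithTop ℕ∞} (h : p + 1 = q) {v : Mink d → Mink d →L[ℝ] ℝ}
    {α : Mink d → Form d p} (hv : ContDiff ℝ n v) (hα : ContDiff ℝ n α) :
    ContDiff ℝ n fun x => covWedge h (v x) (α x) :=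
  contDiff_bilinear (covWedgeL h) hv hα

/-- The Leibniz rule for the product of a form of even degree with a form. -/
lemma extDeriv_wedge_of_even (hp : Even p) (h : p + q = r) (h' : p + 1 + q = r + 1)
    (h'' : p + (q + 1) = r + 1) {α : Mink d → Form d p} {β : Mink d → Form d q} {x : Mink d}
    (hα : DifferentiableAt ℝ α x) (hβ : DifferentiableAt ℝ β x) :
    extDeriv (fun x => wedge h (α x) (β x)) x =
      wedge h' (extDeriv α x) (β x) + wedge h'' (α x) (extDeriv β x) := by
  have h1 : ∀ i, fderiv ℝ (fun x => wedge h (α x) (β x)) x (e i) =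
      wedge h (fderiv ℝ α x (e i)) (β x) + wedge h (α x) (fderiv ℝ β x (e i)) := fun i =>
    fderiv_bilinear_apply (wedgeL h) hα hβ (e i)
  rw [extDeriv_eq_sum, extDeriv_eq_sum, extDeriv_eq_sum]
  simp only [← wedgeL_apply, map_sum, LinearMap.sum_apply]
  rw [← Finset.sum_add_distrib]
  refine Finset.sum_congr rfl fun i _ => ?_
  simp only [wedgeL_apply]
  rw [h1, covWedge_add, covWedge_wedge h h', covWedge_wedge_right h h'', hp.neg_one_pow, one_smul]

/-- The Leibniz rule for the product of a function with a form. -/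
lemma extDeriv_fun_smul_form {f : Mink d → ℝ} {α : Mink d → Form d p} {x : Mink d}
    (hf : DifferentiableAt ℝ f x) (hα : DifferentiableAt ℝ α x) :
    extDeriv (fun x => f x • α x) x =
      covWedge rfl (fderiv ℝ f x) (α x) + f x • extDeriv α x := by
  rw [extDeriv, fderiv_fun_smul hf hα, ContinuousAlternatingMap.alternatizeUncurryFin_add,
    ContinuousAlternatingMap.alternatizeUncurryFin_smul]
  exact add_comm _ _

lemma extDeriv_eq_zero_of_notMem_tsupport {θ : Mink d → Form d p} {x : Mink d}
    (hx : x ∉ tsupport θ) : extDeriv θ x = 0 := by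
  rw [extDeriv, fderiv_of_notMem_tsupport (𝕜 := ℝ) hx]
  exact map_zero (ContinuousAlternatingMap.alternatizeUncurryFinCLM ℝ (Mink d) ℝ)

lemma extDeriv_zero_field (x : Mink d) : extDeriv (0 : Mink d → Form d p) x = 0 :=
  extDeriv_eq_zero_of_notMem_tsupport (by simp)

lemma two_le_infty : minSmoothness ℝ 2 ≤ (∞ : WithTop ℕ∞) := by
  simpa using WithTop.coe_le_coe.2 (le_top : (2 : ℕ∞) ≤ ⊤)

lemma extDeriv_extDeriv_eq_zero {θ : Mink d → Form d p} (hθ : ContDiff ℝ ∞ θ) (x : Mink d) :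
    extDeriv (extDeriv θ) x = 0 :=
  extDeriv_extDeriv_apply (r := ∞) hθ.contDiffAt two_le_infty

/-- `d(da ∧ U) = -da ∧ dU`. -/
lemma extDeriv_covWedge_fderiv {a : Mink d → ℝ} {U : Mink d → Form d p} (ha : ContDiff ℝ ∞ a)
    (hU : ContDiff ℝ ∞ U) (x : Mink d) :
    extDeriv (fun x => covWedge rfl (fderiv ℝ a x) (U x)) x =
      -covWedge rfl (fderiv ℝ a x) (extDeriv U x) := by
  have hd : ∀ {E : Type} [NormedAddCommGroup E] [NormedSpace ℝ E] {f : Mink d → E},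
      ContDiff ℝ ∞ f → Differentiable ℝ f := fun h => h.differentiable (by simp)
  have h1 : (fun x => covWedge rfl (fderiv ℝ a x) (U x)) =
      extDeriv (fun x => a x • U x) - fun x => a x • extDeriv U x := by
    ext1 x
    rw [Pi.sub_apply, extDeriv_fun_smul_form (hd ha x) (hd hU x), add_sub_cancel_right]
  have h2 : ContDiff ℝ ∞ fun x => a x • extDeriv U x := ha.smul (contDiff_extDeriv hU)
  have h3 : ContDiff ℝ ∞ (extDeriv fun x => a x • U x) := contDiff_extDeriv (ha.smul hU)
  rw [h1, sub_eq_add_neg, ← neg_one_smul ℝ fun x => a x • extDeriv U x,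
    extDeriv_add (hd h3 x) ((hd h2 x).const_smul _), extDeriv_smul,
    extDeriv_extDeriv_eq_zero (θ := fun x => a x • U x) (ha.smul hU),
    extDeriv_fun_smul_form (hd ha x) (hd (contDiff_extDeriv hU) x),
    extDeriv_extDeriv_eq_zero hU, smul_zero, add_zero, zero_add, neg_one_smul]

/-! ### Integration of top forms -/

lemma integral_fderiv_eq_zero {f : Mink d → ℝ} (hf : ContDiff ℝ 1 f) (hc : HasCompactSupport f)
    (w : Mink d) : ∫ x, fderiv ℝ f x w = 0 := by
  have h1 : Continuous fun x => fderiv ℝ f x w :=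
    (hf.continuous_fderiv (by simp)).clm_apply continuous_const
  have h2 : HasCompactSupport fun x => fderiv ℝ f x w := hc.fderiv_apply ℝ w
  have := integral_mul_fderiv_eq_neg_fderiv_mul_of_integrable (μ := (volume : Measure (Mink d)))
    (f := fun _ => (1 : ℝ)) (g := f) (v := w) (by simp)
    (by simpa using h1.integrable_of_hasCompactSupport h2)
    (by simpa using hf.continuous.integrable_of_hasCompactSupport hc)
    (fun x _ => differentiableAt_const _) (fun x _ => hf.differentiable (by simp) x)
  simpa using this

/-- Stokes' theorem: the integral of the exterior derivative of a compactly supported form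
vanishes. -/
lemma integral_density_extDeriv {n : ℕ} {θ : Mink (n + 1) → Form (n + 1) n} (hθ : ContDiff ℝ 1 θ)
    (hc : HasCompactSupport θ) : ∫ x, density (extDeriv θ x) = 0 := by
  let f : Fin (n + 1) → Form (n + 1) n →ₗ[ℝ] ℝ := fun i =>
    (densityL (n + 1)).comp (covWedgeL rfl (coord i))
  have hf : ∀ i, ContDiff ℝ 1 fun x => f i (θ x) := fun i => contDiff_linear (f i) hθ
  have hfc : ∀ i, HasCompactSupport fun x => f i (θ x) := fun i => hc.comp_left (map_zero (f i))
  have h1 : ∀ x, density (extDeriv θ x) = ∑ i, fderiv ℝ (fun x => f i (θ x)) x (e i) := by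
    intro x
    rw [extDeriv_eq_sum, ← densityL_apply, map_sum]
    refine Finset.sum_congr rfl fun i _ => ?_
    rw [fderiv_linear _ (hθ.differentiable (by simp) x)]
    rfl
  simp_rw [h1]
  rw [integral_finsetSum]
  · exact Finset.sum_eq_zero fun i _ => integral_fderiv_eq_zero (hf i) (hfc i) _
  · intro i _
    exact (((hf i).continuous_fderiv (by simp)).clm_apply
      continuous_const).integrable_of_hasCompactSupport ((hfc i).fderiv_apply ℝ _)

/-- The fundamental lemma of the calculus of variations, for forms. -/
lemma eq_zero_of_forall_integral_density_wedge (h : p + q = d) (hd : d ≠ 0)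
    {γ : Mink d → Form d q} (hγ : Continuous γ)
    (H : ∀ ρ : Mink d → Form d p, ContDiff ℝ ∞ ρ → HasCompactSupport ρ →
      ∫ x, density (wedge h (ρ x) (γ x)) = 0) (x : Mink d) : γ x = 0 := by
  refine eq_zero_of_forall_density_wedge h hd fun I => ?_
  have hcont : Continuous fun x => density (wedge h (dx I) (γ x)) :=
    ((densityL d).comp (wedgeL h (dx I))).toContinuousLinearMap.continuous.comp hγ
  have h1 : ∀ᵐ x, density (wedge h (dx I) (γ x)) = 0 := by
    refine ae_eq_zero_of_integral_contDiff_smul_eq_zero hcont.locallyIntegrable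
      fun g hg hgc => ?_
    rw [← H (fun x => g x • dx I) (hg.smul contDiff_const) hgc.smul_right]
    refine integral_congr_ae (Eventually.of_forall fun x => ?_)
    have : wedge h (g x • dx I) (γ x) = g x • wedge h (dx I) (γ x) :=
      (wedgeL h).map_smul₂ _ _ _
    simp only [this]
    rfl
  have h2 := (Continuous.ae_eq_iff_eq volume hcont continuous_const).1 h1
  exact congrFun h2 x

/-- Differentiation under the integral sign over a compact set. -/
lemma hasDerivAt_setIntegral_of_isCompact {C : Set (Mink d)} (hC : IsCompact C)
    {N : Set (ℝ × Mink d)} (hN : IsOpen N) (hCN : ∀ x ∈ C, ((0 : ℝ), x) ∈ N)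
    {f f' : ℝ → Mink d → ℝ} (hf : ContinuousOn (fun z : ℝ × Mink d => f z.1 z.2) N)
    (hf' : ContinuousOn (fun z : ℝ × Mink d => f' z.1 z.2) N)
    (hd : ∀ z ∈ N, HasDerivAt (fun t => f t z.2) (f' z.1 z.2) z.1) :
    HasDerivAt (fun t => ∫ x in C, f t x) (∫ x in C, f' 0 x) 0 := by
  obtain ⟨u, v, hu, -, h0u, hCv, huv⟩ := generalized_tube_lemma (isCompact_singleton (x := (0 : ℝ)))
    hC hN (by rintro ⟨t, x⟩ ⟨ht, hx⟩; obtain rfl : t = 0 := ht; exact hCN x hx)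
  obtain ⟨ε, hε, hεu⟩ := Metric.nhds_basis_closedBall.mem_iff.1 (hu.mem_nhds (h0u rfl))
  have hKN : Metric.closedBall (0 : ℝ) ε ×ˢ C ⊆ N :=
    (Set.prod_mono hεu hCv).trans huv
  obtain ⟨b, hb⟩ := ((isCompact_closedBall (0 : ℝ) ε).prod hC).exists_bound_of_continuousOn
    (hf'.mono hKN)
  have hmeas : MeasurableSet C := hC.isClosed.measurableSet
  have slice : ∀ {g : ℝ → Mink d → ℝ}, ContinuousOn (fun z : ℝ × Mink d => g z.1 z.2) N →
      ∀ t ∈ Metric.closedBall (0 : ℝ) ε, ContinuousOn (g t) C := fun hg t ht =>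
    hg.comp (f := fun x => (t, x)) (by fun_prop) fun x hx => hKN ⟨ht, hx⟩
  have h0 : (0 : ℝ) ∈ Metric.closedBall (0 : ℝ) ε := Metric.mem_closedBall_self hε.le
  refine (hasDerivAt_integral_of_dominated_loc_of_deriv_le (bound := fun _ => b)
    (Metric.closedBall_mem_nhds (0 : ℝ) hε) ?_ ?_ ?_ ?_ ?_ ?_).2
  · filter_upwards [Metric.closedBall_mem_nhds (0 : ℝ) hε] with t ht
    exact (slice hf t ht).aestronglyMeasurable hmeas
  · exact (slice hf 0 h0).integrableOn_compact hC
  · exact (slice hf' 0 h0).aestronglyMeasurable hmeas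
  · exact (ae_restrict_iff' hmeas).2 (Eventually.of_forall fun x hx t ht => hb (t, x) ⟨ht, hx⟩)
  · have : IsFiniteMeasure (volume.restrict C) := ⟨by simpa using hC.measure_lt_top⟩
    exact integrable_const b
  · exact (ae_restrict_iff' hmeas).2
      (Eventually.of_forall fun x hx t ht => hd (t, x) (hKN ⟨ht, hx⟩))

end Calculus

/-! ### The first variation of the Lagrangian -/

section Variation

variable {k : ℕ}

lemma hasDerivAt_bilinear {E F G : Type*} [NormedAddCommGroup E] [NormedSpace ℝ E]
    [FiniteDimensional ℝ E] [NormedAddCommGroup F] [NormedSpace ℝ F] [FiniteDimensional ℝ F]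
    [NormedAddCommGroup G] [NormedSpace ℝ G] (B : E →ₗ[ℝ] F →ₗ[ℝ] G) {u : ℝ → E} {v : ℝ → F}
    {u' : E} {v' : F} {t : ℝ} (hu : HasDerivAt u u' t) (hv : HasDerivAt v v' t) :
    HasDerivAt (fun t => B (u t) (v t)) (B u' (v t) + B (u t) v') t := by
  have h := (B.toContinuousBilinearMap.hasFDerivAt.comp_hasDerivAt t hu).clm_apply hv
  exact h

lemma hasDerivAt_clm {E F : Type*} [NormedAddCommGroup E] [NormedSpace ℝ E]
    [NormedAddCommGroup F] [NormedSpace ℝ F] (L : E →L[ℝ] F) {u : ℝ → E} {u' : E} {t : ℝ}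
    (hu : HasDerivAt u u' t) : HasDerivAt (fun t => L (u t)) (L u') t :=
  L.hasFDerivAt.comp_hasDerivAt t hu

lemma hasDerivAt_comp_of_contDiffOn {E : Type*} [NormedAddCommGroup E] [NormedSpace ℝ E]
    {f : E → ℝ} {s : Set E} (hs : IsOpen s) (hf : ContDiffOn ℝ 1 f s) {y : ℝ → E} {y' : E} {t : ℝ}
    (hy : HasDerivAt y y' t) (hys : y t ∈ s) :
    HasDerivAt (fun t => f (y t)) (fderiv ℝ f (y t) y') t :=
  ((hf.differentiableOn (by simp)).differentiableAt
    (hs.mem_nhds hys)).hasFDerivAt.comp_hasDerivAt t hy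

namespace Fields

/-- The first variation of `H` in the direction `δ`. -/
def varH (Φ δ : Fields k) (x : Spacetime k) : SForm k (2 * k + 1) :=
  δ.F x + (δ.a x • Φ.Q x + Φ.a x • δ.Q x)

/-- The self-duality defect `E = ⋆H - H + ⋆X - X` of the fields. -/
def defect (𝓕 : SelfDual k → ℝ) (Φ : Fields k) (x : Spacetime k) : SForm k (2 * k + 1) :=
  selfDualDefect 𝓕 (Φ.H x)

/-- The first variation of the Lagrangian in the direction `δ`, in the form in which the
nonlinear self-duality relation is manifest. -/
def variation (𝓕 : SelfDual k → ℝ) (Φ δ : Fields k) (x : Spacetime k) : SForm k (4 * k + 2) :=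
  (2 : ℝ) • wedgeMid (Φ.varH δ x) (Φ.defect 𝓕 x) +
    (2 : ℝ) • wedgeMid (δ.F x) (Φ.H x + Φ.a x • Φ.Q x) +
    (2 * Φ.a x ^ 2) • wedgeMid (δ.Q x) (Φ.Q x)

variable {Φ δ : Fields k}

lemma Smooth.differentiable_A (h : Φ.Smooth) : Differentiable ℝ Φ.A :=
  h.2.1.differentiable (by simp)

lemma Smooth.differentiable_R (h : Φ.Smooth) : Differentiable ℝ Φ.R :=
  h.2.2.differentiable (by simp)

lemma Smooth.differentiable_a (h : Φ.Smooth) : Differentiable ℝ Φ.a :=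
  h.1.differentiable (by simp)

lemma Smooth.contDiff_F (h : Φ.Smooth) : ContDiff ℝ ∞ Φ.F := contDiff_extDeriv h.2.1

lemma Smooth.contDiff_Q (h : Φ.Smooth) : ContDiff ℝ ∞ Φ.Q := contDiff_extDeriv h.2.2

lemma Smooth.contDiff_H (h : Φ.Smooth) : ContDiff ℝ ∞ Φ.H :=
  h.contDiff_F.add (h.1.smul h.contDiff_Q)

lemma Smooth.shift (h : Φ.Smooth) (h' : δ.Smooth) (t : ℝ) : (Φ.shift δ t).Smooth :=
  ⟨h.1.add (contDiff_const.mul h'.1), h.2.1.add (h'.2.1.const_smul t),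
    h.2.2.add (h'.2.2.const_smul t)⟩

lemma shift_F (h : Φ.Smooth) (h' : δ.Smooth) (t : ℝ) (x : Spacetime k) :
    (Φ.shift δ t).F x = Φ.F x + t • δ.F x := by
  have := extDeriv_add (h.differentiable_A x) ((h'.differentiable_A x).const_smul t)
  rw [extDeriv_smul] at this
  exact this

lemma shift_Q (h : Φ.Smooth) (h' : δ.Smooth) (t : ℝ) (x : Spacetime k) :
    (Φ.shift δ t).Q x = Φ.Q x + t • δ.Q x := by
  have := extDeriv_add (h.differentiable_R x) ((h'.differentiable_R x).const_smul t)
  rw [extDeriv_smul] at this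
  exact this

lemma shift_shift (Φ δ : Fields k) (s t : ℝ) : (Φ.shift δ s).shift δ t = Φ.shift δ (s + t) := by
  simp only [shift, add_mul, add_smul, add_assoc]

lemma shift_zero (Φ δ : Fields k) : Φ.shift δ 0 = Φ := by
  simp [shift]

/-- `dH = da ∧ Q`. -/
lemma extDeriv_H (h : Φ.Smooth) (x : Spacetime k) :
    extDeriv Φ.H x = covWedge rfl (fderiv ℝ Φ.a x) (Φ.Q x) := by
  have h1 : DifferentiableAt ℝ Φ.Q x := h.contDiff_Q.differentiable (by simp) x
  have h2 : DifferentiableAt ℝ Φ.F x := h.contDiff_F.differentiable (by simp) x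
  have h3 : DifferentiableAt ℝ (fun x => Φ.a x • Φ.Q x) x := (h.differentiable_a x).smul h1
  have := extDeriv_add h2 h3
  rw [extDeriv_fun_smul_form (h.differentiable_a x) h1] at this
  change extDeriv Φ.H x = extDeriv (extDeriv Φ.A) x +
    (covWedge rfl (fderiv ℝ Φ.a x) (Φ.Q x) + Φ.a x • extDeriv (extDeriv Φ.R) x) at this
  rw [this, extDeriv_extDeriv_eq_zero h.2.1, extDeriv_extDeriv_eq_zero h.2.2, smul_zero, add_zero,
    zero_add]

end Fields

open Fields

variable {𝓕 : SelfDual k → ℝ} {D : Set (SelfDual k)} {Φ δ : Fields k}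

/-- The map `G ↦ G + ⋆G` onto the self-dual forms, as a continuous linear map. -/
def sdCL (k : ℕ) : SForm k (2 * k + 1) →L[ℝ] SelfDual k :=
  LinearMap.toContinuousLinearMap (F' := SelfDual k) (sdL k)

lemma wedgeMid_hodge_comm (G G' : SForm k (2 * k + 1)) :
    wedgeMid G (hodge G') = wedgeMid G' (hodge G) := by
  apply density_injective
  rw [density_wedgeMid, density_wedgeMid, hodge_hodge, hodge_hodge, formInner_comm]

/-- The first variation of the Lagrangian, term by term, agrees with `Fields.variation`. -/
lemma variation_eq (𝓕 : SelfDual k → ℝ) (Φ δ : Fields k) (x : Spacetime k) :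
    wedgeMid (Φ.varH δ x) (hodge (Φ.H x)) + wedgeMid (Φ.H x) (hodge (Φ.varH δ x)) +
      ((2 * Φ.a x) • (wedgeMid (δ.F x) (Φ.Q x) + wedgeMid (Φ.F x) (δ.Q x)) +
        (2 * δ.a x) • wedgeMid (Φ.F x) (Φ.Q x)) +
      fderiv ℝ 𝓕 (sd (Φ.H x)) (sd (Φ.varH δ x)) • vol (4 * k + 2) = Φ.variation 𝓕 δ x := by
  rw [fderiv_sd_smul_vol, wedgeMid_hodge_comm (Φ.H x), variation, defect]
  generalize selfDualDefect 𝓕 (Φ.H x) = E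
  have h1 : ∀ G, wedgeMid (Φ.varH δ x) G = wedgeMid (δ.F x) G +
      (δ.a x • wedgeMid (Φ.Q x) G + Φ.a x • wedgeMid (δ.Q x) G) := fun G => by
    rw [varH, add_wedgeMid, add_wedgeMid, smul_wedgeMid, smul_wedgeMid]
  have h2 : wedgeMid (Φ.varH δ x) (Φ.H x) =
      wedgeMid (δ.F x) (Φ.H x) + δ.a x • wedgeMid (Φ.Q x) (Φ.F x) +
        Φ.a x • wedgeMid (δ.Q x) (Φ.F x) + Φ.a x ^ 2 • wedgeMid (δ.Q x) (Φ.Q x) := by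
    rw [h1]
    simp only [Fields.H, wedgeMid_add, wedgeMid_smul, wedgeMid_self (Φ.Q x)]
    module
  rw [wedgeMid_sub, wedgeMid_sub, h2, wedgeMid_add, wedgeMid_smul,
    wedgeMid_comm (Φ.Q x) (Φ.F x), wedgeMid_comm (δ.Q x) (Φ.F x)]
  module

/-- The first variation of the Lagrangian. -/
lemma hasDerivAt_lagrangian_zero (hD : IsOpen D) (h𝓕 : ContDiffOn ℝ 1 𝓕 D) (hΦ : Φ.Smooth)
    (hδ : δ.Smooth) {x : Spacetime k} (hx : sd (Φ.H x) ∈ D) :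
    HasDerivAt (fun t : ℝ => lagrangian 𝓕 (Φ.shift δ t) x) (Φ.variation 𝓕 δ x) 0 := by
  have hF : HasDerivAt (fun t : ℝ => (Φ.shift δ t).F x) (δ.F x) 0 := by
    simp_rw [shift_F hΦ hδ]
    simpa using ((hasDerivAt_id (0 : ℝ)).smul_const (δ.F x)).const_add (Φ.F x)
  have hQ : HasDerivAt (fun t : ℝ => (Φ.shift δ t).Q x) (δ.Q x) 0 := by
    simp_rw [shift_Q hΦ hδ]
    simpa using ((hasDerivAt_id (0 : ℝ)).smul_const (δ.Q x)).const_add (Φ.Q x)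
  have ha : HasDerivAt (fun t : ℝ => (Φ.shift δ t).a x) (δ.a x) 0 := by
    simpa [shift] using ((hasDerivAt_id (0 : ℝ)).mul_const (δ.a x)).const_add (Φ.a x)
  have hH : HasDerivAt (fun t : ℝ => (Φ.shift δ t).H x) (Φ.varH δ x) 0 := by
    have := hF.add (ha.smul hQ)
    simp only [shift_zero] at this
    rw [add_comm (Φ.a x • δ.Q x)] at this
    exact this
  have hsd : HasDerivAt (fun t : ℝ => sd ((Φ.shift δ t).H x)) (sd (Φ.varH δ x)) 0 :=
    hasDerivAt_clm (F := SelfDual k) (sdCL k) hH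
  have h𝓕' := (hasDerivAt_comp_of_contDiffOn hD h𝓕 hsd (by rwa [shift_zero])).smul_const
    (vol (4 * k + 2))
  rw [shift_zero] at h𝓕'
  have hW : HasDerivAt (fun t : ℝ => wedgeMid ((Φ.shift δ t).H x) (hodge ((Φ.shift δ t).H x)))
      (wedgeMid (Φ.varH δ x) (hodge (Φ.H x)) + wedgeMid (Φ.H x) (hodge (Φ.varH δ x))) 0 := by
    have h := hasDerivAt_bilinear (wedgeMidL k) hH
      (hasDerivAt_clm (hodgeL k).toContinuousLinearMap hH)
    rw [shift_zero] at h
    exact h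
  have hFQ : HasDerivAt (fun t : ℝ => wedgeMid ((Φ.shift δ t).F x) ((Φ.shift δ t).Q x))
      (wedgeMid (δ.F x) (Φ.Q x) + wedgeMid (Φ.F x) (δ.Q x)) 0 := by
    have h := hasDerivAt_bilinear (wedgeMidL k) hF hQ
    rw [shift_zero] at h
    exact h
  have haFQ : HasDerivAt (fun t : ℝ => (2 * (Φ.shift δ t).a x) •
      wedgeMid ((Φ.shift δ t).F x) ((Φ.shift δ t).Q x))
      ((2 * Φ.a x) • (wedgeMid (δ.F x) (Φ.Q x) + wedgeMid (Φ.F x) (δ.Q x)) +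
        (2 * δ.a x) • wedgeMid (Φ.F x) (Φ.Q x)) 0 := by
    have h := (ha.const_mul 2).smul hFQ
    rw [shift_zero] at h
    exact h
  rw [← variation_eq 𝓕 Φ δ x]
  exact (hW.add haFQ).add h𝓕'

lemma hasDerivAt_lagrangian (hD : IsOpen D) (h𝓕 : ContDiffOn ℝ 1 𝓕 D) (hΦ : Φ.Smooth)
    (hδ : δ.Smooth) {x : Spacetime k} {t : ℝ} (hx : sd ((Φ.shift δ t).H x) ∈ D) :
    HasDerivAt (fun t : ℝ => lagrangian 𝓕 (Φ.shift δ t) x) ((Φ.shift δ t).variation 𝓕 δ x) t := by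
  have h := hasDerivAt_lagrangian_zero hD h𝓕 (hΦ.shift hδ t) hδ hx
  simp only [shift_shift] at h
  rw [← sub_self t] at h
  have h2 := h.comp_sub_const t t
  simpa using h2

lemma continuousOn_gradForm (hD : IsOpen D) (h𝓕 : ContDiffOn ℝ 1 𝓕 D) :
    ContinuousOn (gradForm 𝓕) D := by
  have h := h𝓕.continuousOn_fderiv_of_isOpen hD le_rfl
  have h2 : ContinuousOn (fun Y : SelfDual k => ∑ I : Fin (2 * k + 1) → Fin (4 * k + 2),
      (etaProd I * fderiv ℝ 𝓕 Y (sd (dx I))) • dx I) D :=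
    continuousOn_finsetSum _ fun I _ =>
      (continuousOn_const.mul (h.clm_apply continuousOn_const)).smul continuousOn_const
  exact h2.const_smul (4 * ((2 * k + 1).factorial : ℝ))⁻¹

lemma continuousOn_selfDualDefect {T : Type*} [TopologicalSpace T] {s : Set T} (hD : IsOpen D)
    (h𝓕 : ContDiffOn ℝ 1 𝓕 D) {G : T → SForm k (2 * k + 1)} (hG : ContinuousOn G s)
    (hGD : ∀ x ∈ s, sd (G x) ∈ D) : ContinuousOn (fun x => selfDualDefect 𝓕 (G x)) s := by
  have h1 : ContinuousOn (fun x => gradForm 𝓕 (sd (G x))) s :=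
    (continuousOn_gradForm hD h𝓕).comp ((sdCL k).continuous.comp_continuousOn hG) hGD
  exact (((continuousOn_linear (hodgeL k) hG).sub hG).add
    (continuousOn_linear (hodgeL k) h1)).sub h1

lemma continuous_defect (hD : IsOpen D) (h𝓕 : ContDiffOn ℝ 1 𝓕 D) (hΦ : Φ.Smooth)
    (hΦD : ∀ x, sd (Φ.H x) ∈ D) : Continuous (Φ.defect 𝓕) :=
  continuousOn_univ.1 <|
    continuousOn_selfDualDefect hD h𝓕 hΦ.contDiff_H.continuous.continuousOn fun x _ => hΦD x

lemma continuousOn_wedgeMid {T : Type*} [TopologicalSpace T] {s : Set T}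
    {u v : T → SForm k (2 * k + 1)} (hu : ContinuousOn u s) (hv : ContinuousOn v s) :
    ContinuousOn (fun z => wedgeMid (u z) (v z)) s :=
  continuousOn_bilinear (wedgeMidL k) hu hv

/-- The derivative of the action over a compact region is the integral of the first variation. -/
lemma hasDerivAt_action (hD : IsOpen D) (h𝓕 : ContDiffOn ℝ 1 𝓕 D) (hΦ : Φ.Smooth)
    (hδ : δ.Smooth) (hΦD : ∀ x, sd (Φ.H x) ∈ D) {C : Set (Spacetime k)} (hC : IsCompact C) :
    HasDerivAt (fun t : ℝ => action 𝓕 C (Φ.shift δ t))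
      (∫ x in C, density (Φ.variation 𝓕 δ x)) 0 := by
  -- On this open set, which contains `{0} × C`, the Lagrangian is differentiable in `t`.
  set N : Set (ℝ × Spacetime k) := {z | sd ((Φ.shift δ z.1).H z.2) ∈ D}
  have cF : Continuous fun z : ℝ × Spacetime k => (Φ.shift δ z.1).F z.2 := by
    simp_rw [shift_F hΦ hδ]
    have := hΦ.contDiff_F.continuous
    have := hδ.contDiff_F.continuous
    fun_prop
  have cQ : Continuous fun z : ℝ × Spacetime k => (Φ.shift δ z.1).Q z.2 := by
    simp_rw [shift_Q hΦ hδ]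
    have := hΦ.contDiff_Q.continuous
    have := hδ.contDiff_Q.continuous
    fun_prop
  have ca : Continuous fun z : ℝ × Spacetime k => (Φ.shift δ z.1).a z.2 := by
    have := hΦ.1.continuous
    have := hδ.1.continuous
    simp only [shift]
    fun_prop
  have cH : Continuous fun z : ℝ × Spacetime k => (Φ.shift δ z.1).H z.2 := cF.add (ca.smul cQ)
  have csd : Continuous fun z : ℝ × Spacetime k => sd ((Φ.shift δ z.1).H z.2) :=
    (sdCL k).continuous.comp cH
  have cδF : Continuous fun z : ℝ × Spacetime k => δ.F z.2 :=
    hδ.contDiff_F.continuous.comp continuous_snd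
  have cδQ : Continuous fun z : ℝ × Spacetime k => δ.Q z.2 :=
    hδ.contDiff_Q.continuous.comp continuous_snd
  have cδa : Continuous fun z : ℝ × Spacetime k => δ.a z.2 :=
    hδ.1.continuous.comp continuous_snd
  have hN : IsOpen N := hD.preimage csd
  have key := hasDerivAt_setIntegral_of_isCompact hC hN
    (f := fun t x => density (lagrangian 𝓕 (Φ.shift δ t) x))
    (f' := fun t x => density ((Φ.shift δ t).variation 𝓕 δ x)) ?_ ?_ ?_ ?_
  · simp only [shift_zero] at key
    exact key
  · intro x _
    change sd ((Φ.shift δ 0).H x) ∈ D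
    rw [shift_zero]
    exact hΦD x
  · have c1 := continuousOn_wedgeMid cH.continuousOn (s := N)
      (continuousOn_linear (hodgeL k) cH.continuousOn)
    have c2 := ((continuous_const (y := (2 : ℝ))).mul ca).continuousOn.smul
      (continuousOn_wedgeMid cF.continuousOn (s := N) cQ.continuousOn)
    have c3 := (h𝓕.continuousOn.comp csd.continuousOn fun z (hz : z ∈ N) => hz).smul
      (continuousOn_const (c := vol (4 * k + 2)))
    exact continuousOn_linear (densityL _) ((c1.add c2).add c3)
  · have cE : ContinuousOn (fun z : ℝ × Spacetime k => (Φ.shift δ z.1).defect 𝓕 z.2) N :=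
      continuousOn_selfDualDefect hD h𝓕 cH.continuousOn fun z hz => hz
    have cv : Continuous fun z : ℝ × Spacetime k => (Φ.shift δ z.1).varH δ z.2 :=
      cδF.add ((cδa.smul cQ).add (ca.smul cδQ))
    have c1 := (continuousOn_wedgeMid cv.continuousOn cE).const_smul (2 : ℝ)
    have c2 := (continuousOn_wedgeMid cδF.continuousOn (s := N)
      (cH.add (ca.smul cQ)).continuousOn).const_smul (2 : ℝ)
    have c3 := ((continuous_const (y := (2 : ℝ))).mul (ca.pow 2)).continuousOn.smul
      (continuousOn_wedgeMid cδQ.continuousOn (s := N) cQ.continuousOn)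
    exact continuousOn_linear (densityL _) ((c1.add c2).add c3)
  · intro z hz
    exact (densityL _).toContinuousLinearMap.hasFDerivAt.comp_hasDerivAt z.1
      (hasDerivAt_lagrangian hD h𝓕 hΦ hδ hz)

end Variation

section FieldEquations

open Fields

variable {k : ℕ} {𝓕 : SelfDual k → ℝ} {D : Set (SelfDual k)} {Φ δ : Fields k}

/-! ### The gauge symmetries -/

/-- The exterior product of a `2k`-form with a `(2k+1)`-form. -/
def wedgeCur (α : SForm k (2 * k)) (G : SForm k (2 * k + 1)) : SForm k (4 * k + 1) :=
  wedge (by omega) α G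

/-- The exterior product of a `2k`-form with a `(2k+2)`-form. -/
def wedgeTop (α : SForm k (2 * k)) (γ : SForm k (2 * k + 1 + 1)) : SForm k (4 * k + 2) :=
  wedge (by omega) α γ

/-- The exterior product `v ∧ α` of a covector and a `2k`-form. -/
def cov (v : Spacetime k →L[ℝ] ℝ) (α : SForm k (2 * k)) : SForm k (2 * k + 1) :=
  covWedge rfl v α

/-- The exterior product `v ∧ G` of a covector and a `(2k+1)`-form. -/
def covMid (v : Spacetime k →L[ℝ] ℝ) (G : SForm k (2 * k + 1)) : SForm k (2 * k + 1 + 1) :=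
  covWedge rfl v G

lemma wedgeMid_cov (v : Spacetime k →L[ℝ] ℝ) (α : SForm k (2 * k)) (G : SForm k (2 * k + 1)) :
    wedgeMid (cov v α) G = wedgeTop α (covMid v G) := by
  have h1 := covWedge_wedge (d := 4 * k + 2) (r := 4 * k + 1) (p := 2 * k) (q := 2 * k + 1)
    (by omega) (by omega) v α G
  have h2 := covWedge_wedge_right (d := 4 * k + 2) (r := 4 * k + 1) (p := 2 * k) (q := 2 * k + 1)
    (by omega) (by omega) v α G
  rw [(even_two_mul k).neg_one_pow, one_smul] at h2
  exact h1.symm.trans h2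

lemma smul_wedgeTop (c : ℝ) (α : SForm k (2 * k)) (γ : SForm k (2 * k + 1 + 1)) :
    wedgeTop (c • α) γ = c • wedgeTop α γ := (wedgeL _).map_smul₂ c α γ

lemma wedgeTop_smul (c : ℝ) (α : SForm k (2 * k)) (γ : SForm k (2 * k + 1 + 1)) :
    wedgeTop α (c • γ) = c • wedgeTop α γ := map_smul (wedgeL _ α) c γ

lemma wedgeTop_zero (α : SForm k (2 * k)) : wedgeTop α 0 = 0 := map_zero (wedgeL _ α)

lemma extDeriv_wedgeCur {α : Spacetime k → SForm k (2 * k)}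
    {G : Spacetime k → SForm k (2 * k + 1)} {x : Spacetime k}
    (hα : DifferentiableAt ℝ α x) (hG : DifferentiableAt ℝ G x) :
    extDeriv (fun x => wedgeCur (α x) (G x)) x =
      wedgeMid (extDeriv α x) (G x) + wedgeTop (α x) (extDeriv G x) :=
  extDeriv_wedge_of_even (even_two_mul k) _ _ _ hα hG

lemma daWedge_eq (hk : 1 ≤ k) (a : Spacetime k → ℝ) (U : Spacetime k → SForm k (2 * k - 1))
    (x : Spacetime k) :
    daWedge hk a U x = covWedge (by omega) (fderiv ℝ a x) (U x) := wedge_oneForm _ _ _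

lemma contDiff_fderiv_a (hΦ : Φ.Smooth) : ContDiff ℝ ∞ (fderiv ℝ Φ.a) :=
  hΦ.1.fderiv_right le_rfl

lemma contDiff_daWedge (hk : 1 ≤ k) (hΦ : Φ.Smooth) {U : Spacetime k → SForm k (2 * k - 1)}
    (hU : ContDiff ℝ ∞ U) : ContDiff ℝ ∞ (daWedge hk Φ.a U) := by
  have : daWedge hk Φ.a U = fun x => covWedge (by omega) (fderiv ℝ Φ.a x) (U x) :=
    funext fun x => daWedge_eq hk Φ.a U x
  rw [this]
  exact contDiff_covWedge _ (contDiff_fderiv_a hΦ) hU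

lemma extDeriv_extD {d p q : ℕ} (h : p + 1 = q) {U : Mink d → Form d p} (hU : ContDiff ℝ ∞ U)
    (x : Mink d) : extDeriv (extD h U) x = 0 := by
  subst h
  exact extDeriv_extDeriv_eq_zero hU x

/-- For a variation with `δA = -a δR`, the first variation of the Lagrangian is a total derivative
up to a multiple of the self-duality defect. -/
lemma variation_of_eq_neg_smul (hΦ : Φ.Smooth) (hδ : δ.Smooth)
    (h : ∀ x, δ.A x = -Φ.a x • δ.R x) (x : Spacetime k) :
    Φ.varH δ x = δ.a x • Φ.Q x - cov (fderiv ℝ Φ.a x) (δ.R x) ∧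
    Φ.variation 𝓕 δ x = (2 : ℝ) • wedgeMid (Φ.varH δ x) (Φ.defect 𝓕 x) +
      extDeriv (current Φ δ) x := by
  have hda : DifferentiableAt ℝ (fun x => -Φ.a x) x := (hΦ.differentiable_a x).neg
  have hF : δ.F x = -cov (fderiv ℝ Φ.a x) (δ.R x) - Φ.a x • δ.Q x := by
    have h1 : δ.A = fun x => -Φ.a x • δ.R x := funext h
    have h2 := extDeriv_fun_smul_form hda (hδ.differentiable_R x)
    rw [← h1, fderiv_fun_neg] at h2
    have h3 : covWedge (rfl : 2 * k + 1 = _) (-fderiv ℝ Φ.a x) (δ.R x) =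
      -covWedge rfl (fderiv ℝ Φ.a x) (δ.R x) := (covWedgeL rfl).map_neg₂ _ _
    rw [h3, neg_smul, ← sub_eq_add_neg] at h2
    exact h2
  have hv : Φ.varH δ x = δ.a x • Φ.Q x - cov (fderiv ℝ Φ.a x) (δ.R x) := by
    rw [varH, hF]
    abel
  refine ⟨hv, ?_⟩
  have hcur : extDeriv (current Φ δ) x = (2 : ℝ) • wedgeMid (δ.F x) (Φ.H x) +
      (2 : ℝ) • wedgeTop (δ.A x) (covMid (fderiv ℝ Φ.a x) (Φ.Q x)) := by
    have h1 := extDeriv_wedgeCur (hδ.differentiable_A x)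
      (hΦ.contDiff_H.differentiable (by simp) x)
    rw [extDeriv_H hΦ] at h1
    have h2 : current Φ δ = (2 : ℝ) • fun x => wedgeCur (δ.A x) (Φ.H x) := rfl
    rw [h2, extDeriv_smul, h1, smul_add]
    rfl
  rw [hcur, variation, h x, smul_wedgeTop, ← wedgeMid_cov, wedgeMid_add, wedgeMid_smul]
  have h4 : wedgeMid (δ.F x) (Φ.Q x) = -wedgeMid (cov (fderiv ℝ Φ.a x) (δ.R x)) (Φ.Q x) -
      Φ.a x • wedgeMid (δ.Q x) (Φ.Q x) := by
    rw [hF, sub_wedgeMid, smul_wedgeMid]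
    congr 1
    exact (wedgeMidL k).map_neg₂ _ _
  rw [h4]
  module

lemma variesBy_of_variation (hD : IsOpen D) (h𝓕 : ContDiffOn ℝ 1 𝓕 D) (hΦ : Φ.Smooth)
    (hΦD : ∀ x, sd (Φ.H x) ∈ D) (hδ : δ.Smooth) {K : Spacetime k → SForm k (4 * k + 1)}
    (hK : ContDiff ℝ ∞ K) (h : ∀ x, Φ.variation 𝓕 δ x = extDeriv K x) : VariesBy 𝓕 Φ δ K :=
  ⟨hK, fun x => (hasDerivAt_lagrangian_zero hD h𝓕 hΦ hδ (hΦD x)).congr_deriv (h x)⟩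

lemma contDiff_current (hΦ : Φ.Smooth) (hδ : δ.Smooth) : ContDiff ℝ ∞ (current Φ δ) :=
  (contDiff_wedge _ hδ.2.1 hΦ.contDiff_H).const_smul _

lemma Fields.Q_eq_zero (h : δ.R = 0) (x : Spacetime k) : δ.Q x = 0 := by
  rw [Fields.Q, h]
  exact extDeriv_zero_field x

lemma Fields.F_eq_zero (h : δ.A = 0) (x : Spacetime k) : δ.F x = 0 := by
  rw [Fields.F, h]
  exact extDeriv_zero_field x

lemma variation_eq_zero_of_closed (hF : ∀ x, δ.F x = 0) (hQ : ∀ x, δ.Q x = 0) (ha : δ.a = 0)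
    (x : Spacetime k) : Φ.variation 𝓕 δ x = 0 := by
  simp only [variation, varH, hF, hQ, ha, Pi.zero_apply, zero_smul, smul_zero, add_zero,
    zero_wedgeMid]

lemma variesBy_gaugeA (hD : IsOpen D) (h𝓕 : ContDiffOn ℝ 1 𝓕 D) (hΦ : Φ.Smooth)
    (hΦD : ∀ x, sd (Φ.H x) ∈ D) (hk : 1 ≤ k) {U : Spacetime k → SForm k (2 * k - 1)}
    (hU : ContDiff ℝ ∞ U) : VariesBy 𝓕 Φ (gaugeA hk U) 0 := by
  refine variesBy_of_variation hD h𝓕 hΦ hΦD ⟨contDiff_const, contDiff_extD _ hU, contDiff_const⟩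
    contDiff_const fun x => ?_
  have hF : ∀ x, (gaugeA hk U).F x = 0 := fun x => extDeriv_extD (by omega) hU x
  rw [variation_eq_zero_of_closed hF (Fields.Q_eq_zero rfl) rfl]
  exact (extDeriv_zero_field x).symm

lemma variesBy_gaugeR (hD : IsOpen D) (h𝓕 : ContDiffOn ℝ 1 𝓕 D) (hΦ : Φ.Smooth)
    (hΦD : ∀ x, sd (Φ.H x) ∈ D) (hk : 1 ≤ k) {U : Spacetime k → SForm k (2 * k - 1)}
    (hU : ContDiff ℝ ∞ U) : VariesBy 𝓕 Φ (gaugeR hk U) 0 := by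
  refine variesBy_of_variation hD h𝓕 hΦ hΦD ⟨contDiff_const, contDiff_const, contDiff_extD _ hU⟩
    contDiff_const fun x => ?_
  have hQ : ∀ x, (gaugeR hk U).Q x = 0 := fun x => extDeriv_extD (by omega) hU x
  rw [variation_eq_zero_of_closed (Fields.F_eq_zero rfl) hQ rfl]
  exact (extDeriv_zero_field x).symm

lemma smooth_gaugeAR (hΦ : Φ.Smooth) (hk : 1 ≤ k) {U : Spacetime k → SForm k (2 * k - 1)}
    (hU : ContDiff ℝ ∞ U) : (gaugeAR hk Φ U).Smooth :=
  ⟨contDiff_const, hΦ.1.neg.smul (contDiff_daWedge hk hΦ hU), contDiff_daWedge hk hΦ hU⟩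

lemma varH_gaugeAR (hΦ : Φ.Smooth) (hk : 1 ≤ k) {U : Spacetime k → SForm k (2 * k - 1)}
    (hU : ContDiff ℝ ∞ U) (x : Spacetime k) : Φ.varH (gaugeAR hk Φ U) x = 0 := by
  rw [(variation_of_eq_neg_smul (𝓕 := 0) hΦ (smooth_gaugeAR hΦ hk hU) (fun _ => rfl) x).1]
  have : cov (fderiv ℝ Φ.a x) ((gaugeAR hk Φ U).R x) = 0 := by
    change covWedge rfl _ (daWedge hk Φ.a U x) = 0
    rw [daWedge_eq, covWedge_covWedge_self]
  rw [this, sub_zero]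
  exact zero_smul ℝ _

lemma variesBy_gaugeAR (hD : IsOpen D) (h𝓕 : ContDiffOn ℝ 1 𝓕 D) (hΦ : Φ.Smooth)
    (hΦD : ∀ x, sd (Φ.H x) ∈ D) (hk : 1 ≤ k) {U : Spacetime k → SForm k (2 * k - 1)}
    (hU : ContDiff ℝ ∞ U) :
    VariesBy 𝓕 Φ (gaugeAR hk Φ U) (current Φ (gaugeAR hk Φ U)) := by
  have hδ := smooth_gaugeAR hΦ hk hU
  refine variesBy_of_variation hD h𝓕 hΦ hΦD hδ (contDiff_current hΦ hδ) fun x => ?_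
  rw [(variation_of_eq_neg_smul hΦ hδ (fun _ => rfl) x).2, varH_gaugeAR hΦ hk hU, zero_wedgeMid,
    smul_zero, zero_add]

lemma contDiff_gradSq {d : ℕ} {a : Mink d → ℝ} (ha : ContDiff ℝ ∞ a) : ContDiff ℝ ∞ (gradSq a) := by
  have h : ContDiff ℝ ∞ (fderiv ℝ a) := ha.fderiv_right le_rfl
  unfold gradSq
  exact ContDiff.sum fun i _ => contDiff_const.mul ((h.clm_apply contDiff_const).pow 2)

lemma smooth_gaugePST (hΦ : Φ.Smooth) (hgrad : ∀ x, gradSq Φ.a x ≠ 0) {φ : Spacetime k → ℝ}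
    (hφ : ContDiff ℝ ∞ φ) : (gaugePST Φ φ).Smooth := by
  have h : ContDiff ℝ ∞ (pstForm Φ φ) :=
    (hφ.div (contDiff_gradSq hΦ.1) hgrad).smul
      (contDiff_bilinear interiorL (contDiff_fderiv_a hΦ)
        (hΦ.contDiff_Q.add (contDiff_linear (hodgeL k) hΦ.contDiff_Q)))
  exact ⟨hφ, hΦ.1.neg.smul h, h⟩

lemma variesBy_gaugePST (hD : IsOpen D) (h𝓕 : ContDiffOn ℝ 1 𝓕 D) (hΦ : Φ.Smooth)
    (hΦD : ∀ x, sd (Φ.H x) ∈ D) (hgrad : ∀ x, gradSq Φ.a x ≠ 0) {φ : Spacetime k → ℝ}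
    (hφ : ContDiff ℝ ∞ φ) : VariesBy 𝓕 Φ (gaugePST Φ φ) (current Φ (gaugePST Φ φ)) := by
  have hδ := smooth_gaugePST hΦ hgrad hφ
  refine variesBy_of_variation hD h𝓕 hΦ hΦD hδ (contDiff_current hΦ hδ) fun x => ?_
  obtain ⟨hv, hvar⟩ := variation_of_eq_neg_smul (𝓕 := 𝓕) hΦ hδ (fun _ => rfl) x
  -- The self-dual part of `δH` vanishes, because `ι_{da}` of a self-dual form determines the form.
  have hsd : Φ.varH (gaugePST Φ φ) x + hodge (Φ.varH (gaugePST Φ φ) x) = 0 := by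
    set v := fderiv ℝ Φ.a x
    set S := Φ.Q x + hodge (Φ.Q x)
    have hS : hodge S = S := (sd (Φ.Q x)).2
    have hne : covInner v v ≠ 0 := by rw [covInner_self]; exact hgrad x
    have h1 : cov v ((gaugePST Φ φ).R x) = (φ x / covInner v v) • cov v (interior v S) := by
      rw [covInner_self]
      exact covWedge_smul _ _ _ _
    have h2 := covWedge_interior_add_hodge hS v hne
    change cov v (interior v S) + hodge (cov v (interior v S)) = covInner v v • S at h2
    have h3 : φ x • S = (φ x / covInner v v) • cov v (interior v S) +
        (φ x / covInner v v) • hodge (cov v (interior v S)) := by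
      rw [← smul_add, h2, smul_smul, div_mul_cancel₀ _ hne]
    rw [hv, h1, hodge_sub, hodge_smul, hodge_smul]
    change φ x • Φ.Q x - _ + (φ x • hodge (Φ.Q x) - _) = 0
    have h4 : φ x • Φ.Q x + φ x • hodge (Φ.Q x) = φ x • S := (smul_add _ _ _).symm
    rw [sub_add_sub_comm, h4, h3, sub_self]
  have h0 := two_smul_wedgeMid_of_antiSelfDual (hodge_selfDualDefect 𝓕 (Φ.H x))
    (Φ.varH (gaugePST Φ φ) x)
  rw [hsd, zero_wedgeMid] at h0
  change (2 : ℝ) • wedgeMid _ (Φ.defect 𝓕 x) = 0 at h0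
  rw [hvar, h0, zero_add]

/-! ### The field equations -/

lemma variation_eq_zero_of_notMem {x : Spacetime k} (ha : x ∉ tsupport δ.a) (hA : x ∉ tsupport δ.A)
    (hR : x ∉ tsupport δ.R) : Φ.variation 𝓕 δ x = 0 := by
  have h1 : δ.a x = 0 := image_eq_zero_of_notMem_tsupport ha
  have h2 : δ.F x = 0 := extDeriv_eq_zero_of_notMem_tsupport hA
  have h3 : δ.Q x = 0 := extDeriv_eq_zero_of_notMem_tsupport hR
  simp only [variation, varH, h1, h2, h3, zero_smul, smul_zero, add_zero, zero_wedgeMid]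

/-- The action over a compact region is stationary under a variation supported in the region if and
only if the integral of the first variation vanishes. -/
lemma hasDerivAt_action_zero_iff (hD : IsOpen D) (h𝓕 : ContDiffOn ℝ 1 𝓕 D) (hΦ : Φ.Smooth)
    (hΦD : ∀ x, sd (Φ.H x) ∈ D) (hδ : δ.Smooth) {C : Set (Spacetime k)} (hC : IsCompact C)
    (ha : tsupport δ.a ⊆ C) (hA : tsupport δ.A ⊆ C) (hR : tsupport δ.R ⊆ C) :
    HasDerivAt (fun t : ℝ => action 𝓕 C (Φ.shift δ t)) 0 0 ↔
      ∫ x, density (Φ.variation 𝓕 δ x) = 0 := by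
  have h := hasDerivAt_action hD h𝓕 hΦ hδ hΦD hC
  rw [setIntegral_eq_integral_of_forall_compl_eq_zero fun x hx => by
    rw [variation_eq_zero_of_notMem (fun h => hx (ha h)) (fun h => hx (hA h)) fun h => hx (hR h)]
    rfl] at h
  exact ⟨fun h' => h.unique h', fun h' => h' ▸ h⟩

lemma smooth_varA {α : Spacetime k → SForm k (2 * k)} (hα : ContDiff ℝ ∞ α) :
    (⟨0, α, 0⟩ : Fields k).Smooth := ⟨contDiff_const, hα, contDiff_const⟩

lemma smooth_varR {ρ : Spacetime k → SForm k (2 * k)} (hρ : ContDiff ℝ ∞ ρ) :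
    (⟨0, 0, ρ⟩ : Fields k).Smooth := ⟨contDiff_const, contDiff_const, hρ⟩

lemma tsupport_zero_subset {X E : Type*} [TopologicalSpace X] [Zero E] (C : Set X) :
    tsupport (0 : X → E) ⊆ C := by simp [tsupport]

lemma eqA_iff (hD : IsOpen D) (h𝓕 : ContDiffOn ℝ 1 𝓕 D) (hΦ : Φ.Smooth)
    (hΦD : ∀ x, sd (Φ.H x) ∈ D) :
    EqA 𝓕 Φ ↔ ∀ α : Spacetime k → SForm k (2 * k), ContDiff ℝ ∞ α → HasCompactSupport α →
      ∫ x, density (Φ.variation 𝓕 ⟨0, α, 0⟩ x) = 0 := by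
  refine ⟨fun h α hα hc => ?_, fun h C hC α hα hαC => ?_⟩
  · exact (hasDerivAt_action_zero_iff hD h𝓕 hΦ hΦD (smooth_varA hα) hc.isCompact
      (tsupport_zero_subset _) subset_rfl (tsupport_zero_subset _)).1
      (h _ hc.isCompact α hα subset_rfl)
  · exact (hasDerivAt_action_zero_iff hD h𝓕 hΦ hΦD (smooth_varA hα) hC
      (tsupport_zero_subset _) hαC (tsupport_zero_subset _)).2
      (h α hα (hC.of_isClosed_subset (isClosed_tsupport _) hαC))

lemma eqR_iff (hD : IsOpen D) (h𝓕 : ContDiffOn ℝ 1 𝓕 D) (hΦ : Φ.Smooth)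
    (hΦD : ∀ x, sd (Φ.H x) ∈ D) :
    EqR 𝓕 Φ ↔ ∀ ρ : Spacetime k → SForm k (2 * k), ContDiff ℝ ∞ ρ → HasCompactSupport ρ →
      ∫ x, density (Φ.variation 𝓕 ⟨0, 0, ρ⟩ x) = 0 := by
  refine ⟨fun h ρ hρ hc => ?_, fun h C hC ρ hρ hρC => ?_⟩
  · exact (hasDerivAt_action_zero_iff hD h𝓕 hΦ hΦD (smooth_varR hρ) hc.isCompact
      (tsupport_zero_subset _) (tsupport_zero_subset _) subset_rfl).1
      (h _ hc.isCompact ρ hρ subset_rfl)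
  · exact (hasDerivAt_action_zero_iff hD h𝓕 hΦ hΦD (smooth_varR hρ) hC
      (tsupport_zero_subset _) (tsupport_zero_subset _) hρC).2
      (h ρ hρ (hC.of_isClosed_subset (isClosed_tsupport _) hρC))

lemma continuous_density_wedgeMid {u v : Spacetime k → SForm k (2 * k + 1)} (hu : Continuous u)
    (hv : Continuous v) : Continuous fun x => density (wedgeMid (u x) (v x)) :=
  continuousOn_univ.1 <| continuousOn_linear (densityL _) <|
    continuousOn_wedgeMid hu.continuousOn hv.continuousOn

lemma hasCompactSupport_extDeriv {d p : ℕ} {θ : Mink d → Form d p} (h : HasCompactSupport θ) :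
    HasCompactSupport (extDeriv θ) :=
  h.mono' fun _ hx => by_contra fun hx' => hx (extDeriv_eq_zero_of_notMem_tsupport hx')

lemma hasCompactSupport_wedgeMid {u : Spacetime k → SForm k (2 * k + 1)} (hu : HasCompactSupport u)
    (v : Spacetime k → SForm k (2 * k + 1)) :
    HasCompactSupport fun x => density (wedgeMid (u x) (v x)) :=
  hu.mono fun x hx hx' => hx (by
    change density (wedgeMid (u x) (v x)) = 0
    rw [hx', zero_wedgeMid]
    rfl)

lemma contDiff_smul_form {d p : ℕ} {f : Mink d → ℝ} {θ : Mink d → Form d p} (hf : ContDiff ℝ ∞ f)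
    (hθ : ContDiff ℝ ∞ θ) : ContDiff ℝ ∞ fun x => f x • θ x := hf.smul hθ

lemma hasCompactSupport_smul_form {d p : ℕ} (f : Mink d → ℝ) {θ : Mink d → Form d p}
    (hθ : HasCompactSupport θ) : HasCompactSupport fun x => f x • θ x :=
  hθ.mono fun x hx hx' => hx (by
    change f x • θ x = 0
    rw [hx', smul_zero])

lemma integrable_wedgeMid {u v : Spacetime k → SForm k (2 * k + 1)} (hu : Continuous u)
    (hv : Continuous v) (hc : HasCompactSupport u) :
    Integrable fun x => density (wedgeMid (u x) (v x)) :=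
  (continuous_density_wedgeMid hu hv).integrable_of_hasCompactSupport
    (hasCompactSupport_wedgeMid hc v)

/-- Integration by parts: `∫ dα ∧ G = -∫ α ∧ dG`. -/
lemma integral_extDeriv_wedgeMid {α : Spacetime k → SForm k (2 * k)}
    {G : Spacetime k → SForm k (2 * k + 1)} (hα : ContDiff ℝ ∞ α) (hc : HasCompactSupport α)
    (hG : ContDiff ℝ ∞ G) :
    ∫ x, density (wedgeMid (extDeriv α x) (G x)) =
      -∫ x, density (wedgeTop (α x) (extDeriv G x)) := by
  have h0 : HasCompactSupport fun x => wedgeCur (α x) (G x) :=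
    hc.mono fun x hx hx' => hx (by
      change wedgeCur (α x) (G x) = 0
      rw [hx']
      exact (wedgeL _).map_zero₂ _)
  have h1 := integral_density_extDeriv (n := 4 * k + 1)
    ((contDiff_wedge (by omega) hα hG).of_le (by simp) :
      ContDiff ℝ 1 fun x => wedgeCur (α x) (G x)) h0
  have h2 : ∀ x, density (extDeriv (fun x => wedgeCur (α x) (G x)) x) =
      density (wedgeMid (extDeriv α x) (G x)) + density (wedgeTop (α x) (extDeriv G x)) :=
    fun x => by
      rw [extDeriv_wedgeCur (hα.differentiable (by simp) x) (hG.differentiable (by simp) x)]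
      rfl
  have h3 : ∫ x, (density (wedgeMid (extDeriv α x) (G x)) +
      density (wedgeTop (α x) (extDeriv G x))) = 0 := by
    rw [← h1]
    exact integral_congr_ae (Eventually.of_forall fun x => (h2 x).symm)
  rw [integral_add] at h3
  · linarith
  · exact integrable_wedgeMid (contDiff_extDeriv hα).continuous hG.continuous
      (hasCompactSupport_extDeriv hc)
  · refine Continuous.integrable_of_hasCompactSupport ?_ (hc.mono fun x hx hx' => hx ?_)
    · exact (contDiff_linear (densityL _)
        (contDiff_wedge (by omega) hα (contDiff_extDeriv hG))).continuous
    · change density (wedgeTop (α x) (extDeriv G x)) = 0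
      rw [hx']
      exact congrArg density ((wedgeL _).map_zero₂ _)

lemma Fields.variation_varA (α : Spacetime k → SForm k (2 * k)) (x : Spacetime k) :
    Φ.variation 𝓕 ⟨0, α, 0⟩ x = (2 : ℝ) • wedgeMid (extDeriv α x) (Φ.defect 𝓕 x) +
      (2 : ℝ) • wedgeMid (extDeriv α x) (Φ.H x + Φ.a x • Φ.Q x) := by
  have hQ : (⟨0, α, 0⟩ : Fields k).Q x = 0 := Fields.Q_eq_zero rfl x
  simp only [variation, varH, hQ, zero_wedgeMid, smul_zero, add_zero, Pi.zero_apply, zero_smul]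
  rfl

lemma Fields.variation_varR (ρ : Spacetime k → SForm k (2 * k)) (x : Spacetime k) :
    Φ.variation 𝓕 ⟨0, 0, ρ⟩ x = (2 * Φ.a x) • wedgeMid (extDeriv ρ x) (Φ.defect 𝓕 x) +
      (2 : ℝ) • wedgeMid (extDeriv ρ x) (Φ.a x ^ 2 • Φ.Q x) := by
  have hF : (⟨0, 0, ρ⟩ : Fields k).F x = 0 := Fields.F_eq_zero rfl x
  simp only [variation, varH, hF, zero_wedgeMid, smul_zero, zero_add, Pi.zero_apply,
    zero_smul, wedgeMid_smul, smul_wedgeMid, smul_smul, add_zero]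
  rfl

lemma Fields.variation_varScalar (φ : Spacetime k → ℝ) (x : Spacetime k) :
    Φ.variation 𝓕 ⟨φ, 0, 0⟩ x = (2 : ℝ) • wedgeMid (φ x • Φ.Q x) (Φ.defect 𝓕 x) := by
  have hF : (⟨φ, 0, 0⟩ : Fields k).F x = 0 := Fields.F_eq_zero rfl x
  have hQ : (⟨φ, 0, 0⟩ : Fields k).Q x = 0 := Fields.Q_eq_zero rfl x
  simp only [variation, varH, hF, hQ, zero_wedgeMid, smul_zero, zero_add, add_zero]

/-- `da ∧ Q`. -/
def Fields.daQ (Φ : Fields k) (x : Spacetime k) : SForm k (2 * k + 1 + 1) :=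
  covMid (fderiv ℝ Φ.a x) (Φ.Q x)

lemma extDeriv_smul_Q (hΦ : Φ.Smooth) {f : Spacetime k → ℝ} {x : Spacetime k}
    (hf : DifferentiableAt ℝ f x) :
    extDeriv (fun x => f x • Φ.Q x) x = covMid (fderiv ℝ f x) (Φ.Q x) := by
  have h1 : DifferentiableAt ℝ Φ.Q x := hΦ.contDiff_Q.differentiable (by simp) x
  rw [extDeriv_fun_smul_form hf h1]
  change _ + f x • extDeriv (extDeriv Φ.R) x = _
  rw [extDeriv_extDeriv_eq_zero hΦ.2.2, smul_zero, add_zero]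
  rfl

/-- The weak form of the field equation of `A`. -/
lemma integral_variation_varA (hD : IsOpen D) (h𝓕 : ContDiffOn ℝ 1 𝓕 D) (hΦ : Φ.Smooth)
    (hΦD : ∀ x, sd (Φ.H x) ∈ D) {α : Spacetime k → SForm k (2 * k)} (hα : ContDiff ℝ ∞ α)
    (hc : HasCompactSupport α) :
    ∫ x, density (Φ.variation 𝓕 ⟨0, α, 0⟩ x) =
      2 * (∫ x, density (wedgeMid (extDeriv α x) (Φ.defect 𝓕 x))) -
        4 * ∫ x, density (wedgeTop (α x) (Φ.daQ x)) := by
  have hG : ContDiff ℝ ∞ fun x => Φ.H x + Φ.a x • Φ.Q x :=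
    hΦ.contDiff_H.add (contDiff_smul_form hΦ.1 hΦ.contDiff_Q)
  have hdG : ∀ x, extDeriv (fun x => Φ.H x + Φ.a x • Φ.Q x) x = (2 : ℝ) • Φ.daQ x := fun x => by
    have h1 : ContDiff ℝ ∞ fun x => Φ.a x • Φ.Q x := hΦ.1.smul hΦ.contDiff_Q
    rw [extDeriv_fun_add (hΦ.contDiff_H.differentiable (by simp) x)
      (h1.differentiable (by simp) x), extDeriv_H hΦ,
      extDeriv_smul_Q hΦ (hΦ.differentiable_a x), two_smul]
    rfl
  have h1 := integral_extDeriv_wedgeMid hα hc hG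
  simp only [hdG, wedgeTop_smul] at h1
  have h2 : ∀ x, density ((2 : ℝ) • wedgeTop (α x) (Φ.daQ x)) =
    2 * density (wedgeTop (α x) (Φ.daQ x)) := fun x => rfl
  simp only [h2, integral_const_mul] at h1
  have h3 : ∀ x, density (Φ.variation 𝓕 ⟨0, α, 0⟩ x) =
      2 * density (wedgeMid (extDeriv α x) (Φ.defect 𝓕 x)) +
      2 * density (wedgeMid (extDeriv α x) (Φ.H x + Φ.a x • Φ.Q x)) := fun x => by
    rw [Fields.variation_varA]
    rfl
  have hdα := (contDiff_extDeriv hα).continuous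
  have hdc := hasCompactSupport_extDeriv hc
  simp only [h3]
  rw [integral_add ((integrable_wedgeMid hdα (continuous_defect hD h𝓕 hΦ hΦD) hdc).const_mul 2)
    ((integrable_wedgeMid hdα hG.continuous hdc).const_mul 2), integral_const_mul,
    integral_const_mul, h1]
  ring

/-- The weak form of the field equation of `R`. -/
lemma integral_variation_varR (hD : IsOpen D) (h𝓕 : ContDiffOn ℝ 1 𝓕 D) (hΦ : Φ.Smooth)
    (hΦD : ∀ x, sd (Φ.H x) ∈ D) {ρ : Spacetime k → SForm k (2 * k)} (hρ : ContDiff ℝ ∞ ρ)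
    (hc : HasCompactSupport ρ) :
    ∫ x, density (Φ.variation 𝓕 ⟨0, 0, ρ⟩ x) =
      2 * (∫ x, density (wedgeMid (Φ.a x • extDeriv ρ x) (Φ.defect 𝓕 x))) -
        4 * ∫ x, density (wedgeTop (Φ.a x • ρ x) (Φ.daQ x)) := by
  have hG : ContDiff ℝ ∞ fun x => Φ.a x ^ 2 • Φ.Q x :=
    contDiff_smul_form (hΦ.1.pow 2) hΦ.contDiff_Q
  have hdG : ∀ x, extDeriv (fun x => Φ.a x ^ 2 • Φ.Q x) x = (2 * Φ.a x) • Φ.daQ x := fun x => by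
    have ha := hΦ.differentiable_a x
    rw [extDeriv_smul_Q hΦ (ha.fun_pow 2), fderiv_fun_pow 2 ha]
    have : (2 • Φ.a x ^ (2 - 1)) • fderiv ℝ Φ.a x = (2 * Φ.a x) • fderiv ℝ Φ.a x := by
      simp
    rw [this]
    exact (covWedgeL rfl).map_smul₂ _ _ _
  have h1 := integral_extDeriv_wedgeMid hρ hc hG
  have h2 : ∀ x, density (wedgeTop (ρ x) ((2 * Φ.a x) • Φ.daQ x)) =
      2 * density (wedgeTop (Φ.a x • ρ x) (Φ.daQ x)) := fun x => by
    rw [wedgeTop_smul, mul_smul, ← smul_wedgeTop]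
    rfl
  simp only [hdG, h2, integral_const_mul] at h1
  have h3 : ∀ x, density (Φ.variation 𝓕 ⟨0, 0, ρ⟩ x) =
      2 * density (wedgeMid (Φ.a x • extDeriv ρ x) (Φ.defect 𝓕 x)) +
      2 * density (wedgeMid (extDeriv ρ x) (Φ.a x ^ 2 • Φ.Q x)) := fun x => by
    rw [Fields.variation_varR, mul_smul, ← smul_wedgeMid]
    rfl
  have hdρ := (contDiff_extDeriv hρ).continuous
  have hdc := hasCompactSupport_extDeriv hc
  have hadρ : Continuous fun x => Φ.a x • extDeriv ρ x :=
    (contDiff_smul_form hΦ.1 (contDiff_extDeriv hρ)).continuous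
  have hadc : HasCompactSupport fun x => Φ.a x • extDeriv ρ x :=
    hasCompactSupport_smul_form _ hdc
  simp only [h3]
  rw [integral_add ((integrable_wedgeMid hadρ
    (continuous_defect hD h𝓕 hΦ hΦD) hadc).const_mul 2)
    ((integrable_wedgeMid hdρ hG.continuous hdc).const_mul 2), integral_const_mul,
    integral_const_mul, h1]
  ring

lemma contDiff_daQ (hΦ : Φ.Smooth) : ContDiff ℝ ∞ Φ.daQ :=
  contDiff_covWedge rfl (contDiff_fderiv_a hΦ) hΦ.contDiff_Q

/-- The fundamental lemma of the calculus of variations, for the field equations. -/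
lemma eq_zero_of_forall_integral_wedgeTop {γ : Spacetime k → SForm k (2 * k + 1 + 1)}
    (hγ : Continuous γ) (H : ∀ ρ : Spacetime k → SForm k (2 * k), ContDiff ℝ ∞ ρ →
      HasCompactSupport ρ → ∫ x, density (wedgeTop (ρ x) (γ x)) = 0) (x : Spacetime k) :
    γ x = 0 :=
  eq_zero_of_forall_integral_density_wedge (by omega) (by omega) hγ H x

/-- Testing the equation of `A` with `aρ` and that of `R` with `ρ` gives
`∫ ρ ∧ da ∧ E = 0`, so that `da ∧ E = 0`. -/
lemma covMid_defect_eq_zero (hD : IsOpen D) (h𝓕 : ContDiffOn ℝ 1 𝓕 D) (hΦ : Φ.Smooth)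
    (hΦD : ∀ x, sd (Φ.H x) ∈ D) (hA : EqA 𝓕 Φ) (hR : EqR 𝓕 Φ) (x : Spacetime k) :
    covMid (fderiv ℝ Φ.a x) (Φ.defect 𝓕 x) = 0 := by
  have hE := continuous_defect hD h𝓕 hΦ hΦD
  rw [eqA_iff hD h𝓕 hΦ hΦD] at hA
  rw [eqR_iff hD h𝓕 hΦ hΦD] at hR
  have hcont : Continuous fun x => covMid (fderiv ℝ Φ.a x) (Φ.defect 𝓕 x) :=
    continuousOn_univ.1 (continuousOn_bilinear (covWedgeL rfl)
        (contDiff_fderiv_a hΦ).continuous.continuousOn hE.continuousOn)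
  refine eq_zero_of_forall_integral_wedgeTop hcont (fun ρ hρ hc => ?_) x
  have haρ : ContDiff ℝ ∞ fun x => Φ.a x • ρ x := contDiff_smul_form hΦ.1 hρ
  have hac : HasCompactSupport fun x => Φ.a x • ρ x := hasCompactSupport_smul_form _ hc
  have h1 := integral_variation_varA hD h𝓕 hΦ hΦD haρ hac
  have h2 := integral_variation_varR hD h𝓕 hΦ hΦD hρ hc
  rw [hA _ haρ hac] at h1
  rw [hR _ hρ hc] at h2
  have h3 : ∀ x, density (wedgeMid (extDeriv (fun x => Φ.a x • ρ x) x) (Φ.defect 𝓕 x)) =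
      density (wedgeMid (cov (fderiv ℝ Φ.a x) (ρ x)) (Φ.defect 𝓕 x)) +
      density (wedgeMid (Φ.a x • extDeriv ρ x) (Φ.defect 𝓕 x)) := fun x => by
    rw [extDeriv_fun_smul_form (hΦ.differentiable_a x) (hρ.differentiable (by simp) x),
      add_wedgeMid]
    rfl
  have hcov : Continuous fun x => cov (fderiv ℝ Φ.a x) (ρ x) :=
    (contDiff_covWedge rfl (contDiff_fderiv_a hΦ) hρ).continuous
  have hcovc : HasCompactSupport fun x => cov (fderiv ℝ Φ.a x) (ρ x) :=
    hc.mono fun x hx hx' => hx <| by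
      change cov (fderiv ℝ Φ.a x) (ρ x) = 0
      rw [hx']
      exact covWedge_zero _ _
  have hadρ : Continuous fun x => Φ.a x • extDeriv ρ x :=
    (contDiff_smul_form hΦ.1 (contDiff_extDeriv hρ)).continuous
  have hadc : HasCompactSupport fun x => Φ.a x • extDeriv ρ x :=
    hasCompactSupport_smul_form _ (hasCompactSupport_extDeriv hc)
  simp only [h3] at h1
  rw [integral_add (integrable_wedgeMid hcov hE hcovc) (integrable_wedgeMid hadρ hE hadc)] at h1
  simp only [← wedgeMid_cov]
  linarith

/-- The field equations of `A` and `R` imply the nonlinear self-duality relation and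
`da ∧ Q = 0`: since `E` is anti-self-dual and `da` is not null, `da ∧ E = 0` forces `E = 0`, and
what is left of the equation of `A` is `da ∧ Q = 0`. -/
lemma defect_eq_zero_and_daQ_eq_zero (hD : IsOpen D) (h𝓕 : ContDiffOn ℝ 1 𝓕 D) (hΦ : Φ.Smooth)
    (hΦD : ∀ x, sd (Φ.H x) ∈ D) (hgrad : ∀ x, gradSq Φ.a x ≠ 0) (hA : EqA 𝓕 Φ) (hR : EqR 𝓕 Φ) :
    (∀ x, Φ.defect 𝓕 x = 0) ∧ ∀ x, Φ.daQ x = 0 := by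
  have hE0 : ∀ x, Φ.defect 𝓕 x = 0 := fun x =>
    eq_zero_of_covWedge_eq_zero (hodge_selfDualDefect 𝓕 (Φ.H x)) (v := fderiv ℝ Φ.a x)
      (by rw [covInner_self]; exact hgrad x) (covMid_defect_eq_zero hD h𝓕 hΦ hΦD hA hR x)
  refine ⟨hE0, eq_zero_of_forall_integral_wedgeTop (contDiff_daQ hΦ).continuous
    fun α hα hc => ?_⟩
  rw [eqA_iff hD h𝓕 hΦ hΦD] at hA
  have h1 := integral_variation_varA hD h𝓕 hΦ hΦD hα hc
  rw [hA α hα hc] at h1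
  have h0 : density (0 : SForm k (4 * k + 2)) = 0 := rfl
  simp only [hE0, wedgeMid_zero, h0, integral_zero] at h1
  linarith

/-- The nonlinear self-duality relation and `da ∧ Q = 0` imply the three field equations. -/
lemma fieldEquations_of_defect_eq_zero (hD : IsOpen D) (h𝓕 : ContDiffOn ℝ 1 𝓕 D) (hΦ : Φ.Smooth)
    (hΦD : ∀ x, sd (Φ.H x) ∈ D) (hE : ∀ x, Φ.defect 𝓕 x = 0) (hQ : ∀ x, Φ.daQ x = 0) :
    EqA 𝓕 Φ ∧ EqR 𝓕 Φ ∧ EqScalar 𝓕 Φ := by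
  have h0 : density (0 : SForm k (4 * k + 2)) = 0 := rfl
  refine ⟨?_, ?_, ?_⟩
  · rw [eqA_iff hD h𝓕 hΦ hΦD]
    intro α hα hc
    rw [integral_variation_varA hD h𝓕 hΦ hΦD hα hc]
    simp only [hE, hQ, wedgeMid_zero, wedgeTop_zero, h0, integral_zero, mul_zero, sub_zero]
  · rw [eqR_iff hD h𝓕 hΦ hΦD]
    intro ρ hρ hc
    rw [integral_variation_varR hD h𝓕 hΦ hΦD hρ hc]
    simp only [hE, hQ, wedgeMid_zero, wedgeTop_zero, h0, integral_zero, mul_zero, sub_zero]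
  · intro C hC φ hφ hφC
    have hδ : (⟨φ, 0, 0⟩ : Fields k).Smooth := ⟨hφ, contDiff_const, contDiff_const⟩
    refine (hasDerivAt_action_zero_iff hD h𝓕 hΦ hΦD hδ hC hφC
      (tsupport_zero_subset _) (tsupport_zero_subset _)).2 ?_
    simp only [Fields.variation_varScalar, hE, wedgeMid_zero, smul_zero, h0, integral_zero]

end FieldEquations

/-! ### Smoothness of form-valued maps and of integrals depending on a parameter -/

section Homotopy

variable {d p q : ℕ}

lemma contDiff_form_of_coeff {X : Type*} [NormedAddCommGroup X] [NormedSpace ℝ X]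
    {n : WithTop ℕ∞} {α : X → Form d p} (h : ∀ I, ContDiff ℝ n fun x => coeff (α x) I) :
    ContDiff ℝ n α := by
  have : α = fun x => (p.factorial : ℝ)⁻¹ • ∑ I, coeff (α x) I • dx I :=
    funext fun x => eq_smul_sum_dx (α x)
  rw [this]
  have hs : ContDiff ℝ n fun x => ∑ I, coeff (α x) I • (dx I : Form d p) :=
    ContDiff.sum fun I _ => (h I).smul contDiff_const
  exact hs.const_smul _

lemma contDiff_dx_apply {X : Type*} [NormedAddCommGroup X] [NormedSpace ℝ X]
    {n : WithTop ℕ∞} (I : Fin p → Fin d) {w : X → Fin p → Mink d}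
    (hw : ∀ i, ContDiff ℝ n fun x => w x i) : ContDiff ℝ n fun x => dx I (w x) := by
  simp only [dx_apply, Matrix.det_apply]
  refine ContDiff.sum fun σ _ => ContDiff.const_smul _ (contDiff_prod fun i _ => ?_)
  exact contDiff_pi.1 (hw (σ i)) (I i)

lemma contDiff_form_apply {X : Type*} [NormedAddCommGroup X] [NormedSpace ℝ X]
    {n : WithTop ℕ∞} {α : X → Form d p} (hα : ContDiff ℝ n α) {w : X → Fin p → Mink d}
    (hw : ∀ i, ContDiff ℝ n fun x => w x i) : ContDiff ℝ n fun x => α x (w x) := by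
  have h1 : ∀ I : Fin p → Fin d, ContDiff ℝ n fun x => coeff (α x) I := fun I =>
    contDiff_linear ({ toFun := fun β => coeff β I, map_add' := fun _ _ => rfl,
                       map_smul' := fun _ _ => rfl } : Form d p →ₗ[ℝ] ℝ) hα
  have : (fun x => α x (w x)) = fun x =>
      (p.factorial : ℝ)⁻¹ * ∑ I, coeff (α x) I * dx I (w x) := funext fun x => by
    conv_lhs => rw [eq_smul_sum_dx (α x)]
    simp [ContinuousAlternatingMap.sum_apply]
  rw [this]
  exact contDiff_const.mul (ContDiff.sum fun I _ => (h1 I).mul (contDiff_dx_apply I hw))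

/-- Differentiation under the integral sign for a smooth integrand. -/
lemma hasFDerivAt_intervalIntegral {E F : Type} [NormedAddCommGroup E] [NormedSpace ℝ E]
    [FiniteDimensional ℝ E] [NormedAddCommGroup F] [NormedSpace ℝ F] {f : ℝ × E → F}
    (hf : ContDiff ℝ 1 f) (x₀ : E) :
    HasFDerivAt (fun x => ∫ t in (0 : ℝ)..1, f (t, x))
      (∫ t in (0 : ℝ)..1, (fderiv ℝ f (t, x₀)).comp (ContinuousLinearMap.inr ℝ ℝ E)) x₀ := by
  have hc : Continuous fun z : ℝ × E =>
      (fderiv ℝ f z).comp (ContinuousLinearMap.inr ℝ ℝ E) :=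
    (hf.continuous_fderiv (by simp)).clm_comp continuous_const
  obtain ⟨b, hb⟩ := ((isCompact_Icc (a := (0 : ℝ)) (b := 1)).prod
    (isCompact_closedBall x₀ 1)).exists_bound_of_continuousOn hc.continuousOn
  have slice : ∀ x : E, Continuous fun t : ℝ => (t, x) := fun x => by fun_prop
  refine intervalIntegral.hasFDerivAt_integral_of_dominated_of_fderiv_le
    (F := fun x t => f (t, x))
    (F' := fun x t => (fderiv ℝ f (t, x)).comp (ContinuousLinearMap.inr ℝ ℝ E))
    (bound := fun _ => b) (Metric.closedBall_mem_nhds x₀ one_pos) ?_ ?_ ?_ ?_ ?_ ?_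
  · exact Eventually.of_forall fun x =>
      (hf.continuous.comp (slice x)).aestronglyMeasurable
  · exact (hf.continuous.comp (slice x₀)).intervalIntegrable _ _
  · exact (hc.comp (slice x₀)).aestronglyMeasurable
  · refine Eventually.of_forall fun t ht x hx => hb (t, x) ⟨?_, hx⟩
    rw [Set.uIoc_of_le zero_le_one] at ht
    exact ⟨ht.1.le, ht.2⟩
  · exact intervalIntegrable_const
  · refine Eventually.of_forall fun t _ x _ => ?_
    have h1 : HasFDerivAt f _ (t, x) := (hf.differentiable (by simp) (t, x)).hasFDerivAt
    exact h1.comp x (hasFDerivAt_prodMk_right t x)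

lemma contDiff_intervalIntegral_nat {E : Type} [NormedAddCommGroup E] [NormedSpace ℝ E]
    [FiniteDimensional ℝ E] (n : ℕ) : ∀ {F : Type} [NormedAddCommGroup F] [NormedSpace ℝ F]
    {f : ℝ × E → F}, ContDiff ℝ ∞ f →
      ContDiff ℝ n fun x => ∫ t in (0 : ℝ)..1, f (t, x) := by
  induction n with
  | zero =>
    intro F _ _ f hf
    exact contDiff_zero.2 <| continuous_iff_continuousAt.2 fun x =>
      (hasFDerivAt_intervalIntegral (hf.of_le (by simp)) x).continuousAt
  | succ n ih =>
    intro F _ _ f hf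
    have h1 : ∀ x, HasFDerivAt _ _ x := hasFDerivAt_intervalIntegral (hf.of_le (by simp))
    push_cast
    refine contDiff_succ_iff_fderiv.2 ⟨fun x => (h1 x).differentiableAt, by simp, ?_⟩
    have h2 : (fderiv ℝ fun x => ∫ t in (0 : ℝ)..1, f (t, x)) = fun x =>
        ∫ t in (0 : ℝ)..1, (fderiv ℝ f (t, x)).comp (ContinuousLinearMap.inr ℝ ℝ E) :=
      funext fun x => (h1 x).fderiv
    rw [h2]
    exact ih (f := fun z => (fderiv ℝ f z).comp (ContinuousLinearMap.inr ℝ ℝ E))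
      ((hf.fderiv_right le_rfl).clm_comp contDiff_const)

lemma contDiff_intervalIntegral {E F : Type} [NormedAddCommGroup E] [NormedSpace ℝ E]
    [FiniteDimensional ℝ E] [NormedAddCommGroup F] [NormedSpace ℝ F] {f : ℝ × E → F}
    (hf : ContDiff ℝ ∞ f) : ContDiff ℝ ∞ fun x => ∫ t in (0 : ℝ)..1, f (t, x) :=
  contDiff_infty.2 fun n => contDiff_intervalIntegral_nat n hf

/-! ### The homotopy formula -/

/-- The contraction with `∂_t` of the pullback of a form along a homotopy `h`, restricted to the
slice at the time `t`. -/
def homotopyContr (h : ℝ × Mink d → Mink d) (R : Mink d → Form d (p + 1)) (z : ℝ × Mink d) :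
    Form d p :=
  ((R (h z)).curryLeft (fderiv ℝ h z (1, 0))).compContinuousLinearMap
    ((fderiv ℝ h z).comp (ContinuousLinearMap.inr ℝ ℝ (Mink d)))

lemma homotopyContr_apply (h : ℝ × Mink d → Mink d) (R : Mink d → Form d (p + 1))
    (z : ℝ × Mink d) (w : Fin p → Mink d) :
    homotopyContr h R z w =
      (R (h z)).compContinuousLinearMap (fderiv ℝ h z)
        (Matrix.vecCons (1, 0) fun i => ((0 : ℝ), w i)) := by
  change (R (h z)) _ = (R (h z)) _
  congr 1
  ext i
  refine Fin.cases ?_ (fun i => ?_) i <;> simp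

lemma contDiff_homotopyContr {h : ℝ × Mink d → Mink d} (hh : ContDiff ℝ ∞ h)
    {R : Mink d → Form d (p + 1)} (hR : ContDiff ℝ ∞ R) : ContDiff ℝ ∞ (homotopyContr h R) := by
  have hd : ContDiff ℝ ∞ (fderiv ℝ h) := hh.fderiv_right le_rfl
  refine contDiff_form_of_coeff fun I => ?_
  refine contDiff_form_apply (hR.comp hh) (w := fun z => Matrix.vecCons (fderiv ℝ h z (1, 0))
    fun i => fderiv ℝ h z (0, e (I i))) fun i => ?_
  refine Fin.cases ?_ (fun i => ?_) i
  · exact hd.clm_apply contDiff_const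
  · exact hd.clm_apply contDiff_const

/-- The homotopy operator `K` of a homotopy `h`. -/
def homotopyOp (h : ℝ × Mink d → Mink d) (R : Mink d → Form d (p + 1)) (x : Mink d) : Form d p :=
  ∫ t in (0 : ℝ)..1, homotopyContr h R (t, x)

lemma contDiff_homotopyOp {h : ℝ × Mink d → Mink d} (hh : ContDiff ℝ ∞ h)
    {R : Mink d → Form d (p + 1)} (hR : ContDiff ℝ ∞ R) : ContDiff ℝ ∞ (homotopyOp h R) :=
  contDiff_intervalIntegral (contDiff_homotopyContr hh hR)

lemma continuous_slice (x : Mink d) : Continuous fun t : ℝ => (t, x) := by fun_prop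

lemma fderiv_slice {F : Type*} [NormedAddCommGroup F] [NormedSpace ℝ F] {f : ℝ × Mink d → F}
    {t : ℝ} {x : Mink d} (hf : DifferentiableAt ℝ f (t, x)) :
    fderiv ℝ (fun y => f (t, y)) x =
      (fderiv ℝ f (t, x)).comp (ContinuousLinearMap.inr ℝ ℝ (Mink d)) :=
  (hf.hasFDerivAt.comp x (hasFDerivAt_prodMk_right t x)).fderiv

lemma clm_fderiv_intervalIntegral {E F G : Type} [NormedAddCommGroup E] [NormedSpace ℝ E]
    [FiniteDimensional ℝ E] [NormedAddCommGroup F] [NormedSpace ℝ F] [CompleteSpace F]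
    [NormedAddCommGroup G] [NormedSpace ℝ G] [CompleteSpace G] {f : ℝ × E → F}
    (hf : ContDiff ℝ 1 f) (T : (E →L[ℝ] F) →L[ℝ] G) (x : E) :
    T (fderiv ℝ (fun x => ∫ t in (0 : ℝ)..1, f (t, x)) x) =
      ∫ t in (0 : ℝ)..1, T (fderiv ℝ (fun y => f (t, y)) x) := by
  have hc : Continuous fun t : ℝ =>
      (fderiv ℝ f (t, x)).comp (ContinuousLinearMap.inr ℝ ℝ E) :=
    ((hf.continuous_fderiv (by simp)).comp (by fun_prop : Continuous fun t : ℝ => (t, x))).clm_comp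
      continuous_const
  rw [(hasFDerivAt_intervalIntegral hf x).fderiv,
    ← ContinuousLinearMap.intervalIntegral_comp_comm _ (hc.intervalIntegrable _ _)]
  refine intervalIntegral.integral_congr fun t _ => ?_
  have h1 : HasFDerivAt f _ (t, x) := (hf.differentiable (by simp) (t, x)).hasFDerivAt
  exact congrArg T (h1.comp x (hasFDerivAt_prodMk_right t x)).fderiv.symm

lemma extDeriv_homotopyOp {h : ℝ × Mink d → Mink d} (hh : ContDiff ℝ ∞ h)
    {R : Mink d → Form d (p + 1)} (hR : ContDiff ℝ ∞ R) (x : Mink d) :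
    extDeriv (homotopyOp h R) x =
      ∫ t in (0 : ℝ)..1, extDeriv (fun y => homotopyContr h R (t, y)) x :=
  clm_fderiv_intervalIntegral ((contDiff_homotopyContr hh hR).of_le (by simp))
    (ContinuousAlternatingMap.alternatizeUncurryFinCLM ℝ (Mink d) ℝ) x

/-- The derivative of the pullback of a form along a homotopy: the exterior derivative of the
pullback to the product with the time axis, evaluated on `∂_t` and on vectors of the slice. -/
lemma hasDerivAt_pullback_homotopy {h : ℝ × Mink d → Mink d} (hh : ContDiff ℝ ∞ h)
    {R : Mink d → Form d (p + 1)} (hR : ContDiff ℝ ∞ R) (t : ℝ) (x : Mink d)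
    (w : Fin (p + 1) → Mink d) :
    HasDerivAt (fun t : ℝ => (R (h (t, x))).compContinuousLinearMap (fderiv ℝ h (t, x))
        fun i => ((0 : ℝ), w i))
      ((homotopyContr h (extDeriv R) (t, x) +
        extDeriv (fun y => homotopyContr h R (t, y)) x) w) t := by
  set Ω : ℝ × Mink d → (ℝ × Mink d) [⋀^Fin (p + 1)]→L[ℝ] ℝ := fun z =>
    (R (h z)).compContinuousLinearMap (fderiv ℝ h z) with hΩ
  have hd : Differentiable ℝ (fderiv ℝ h) :=
    (hh.fderiv_right (m := ∞) le_rfl).differentiable (by simp)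
  have hRh : Differentiable ℝ fun z => R (h z) := (hR.comp hh).differentiable (by simp)
  have hΩd : DifferentiableAt ℝ Ω (t, x) :=
    (hRh (t, x)).continuousAlternatingMapCompContinuousLinearMap (hd (t, x))
  have hκ : Differentiable ℝ (homotopyContr h R) :=
    (contDiff_homotopyContr hh hR).differentiable (by simp)
  have h1 := extDeriv_pullback (x := (t, x)) (hR.differentiable (by simp) (h (t, x)))
    hh.contDiffAt two_le_infty
  have h2 := extDeriv_apply hΩd (Matrix.vecCons (1, 0) fun i => ((0 : ℝ), w i))
  rw [h1, ← homotopyContr_apply, Fin.sum_univ_succ] at h2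
  simp only [removeNth_succ_vecCons, Matrix.cons_val_succ, Matrix.cons_val_zero, Fin.val_succ,
    Fin.val_zero, pow_zero, one_smul] at h2
  have h3 : (0 : Fin (p + 2)).removeNth
      (Matrix.vecCons ((1 : ℝ), (0 : Mink d)) fun i => ((0 : ℝ), w i)) =
      fun i => ((0 : ℝ), w i) := by
    ext1 j; simp [Fin.removeNth]
  rw [h3] at h2
  have h4 : ∀ i : Fin (p + 1), fderiv ℝ (fun z => Ω z (Matrix.vecCons (1, 0)
      (i.removeNth fun i => ((0 : ℝ), w i)))) (t, x) (0, w i) =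
      fderiv ℝ (fun y => homotopyContr h R (t, y) (i.removeNth w)) x (w i) := fun i => by
    have h5 : (fun z => Ω z (Matrix.vecCons (1, 0) (i.removeNth fun i => ((0 : ℝ), w i)))) =
        fun z => homotopyContr h R z (i.removeNth w) := funext fun z =>
      (homotopyContr_apply h R z (i.removeNth w)).symm
    have h6 : DifferentiableAt ℝ (fun z => homotopyContr h R z (i.removeNth w)) (t, x) :=
      (hκ (t, x)).continuousAlternatingMap_apply_const _
    rw [h5, fderiv_slice h6]
    rfl
  have hslice : DifferentiableAt ℝ (fun y => homotopyContr h R (t, y)) x :=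
    (hκ (t, x)).comp x (by fun_prop)
  have h7 : HasDerivAt (fun s : ℝ => Ω (s, x) fun i => ((0 : ℝ), w i))
      (fderiv ℝ (fun z => Ω z fun i => ((0 : ℝ), w i)) (t, x) (1, 0)) t := by
    have hA : HasFDerivAt (fun z => Ω z fun i => ((0 : ℝ), w i))
        (fderiv ℝ (fun z => Ω z fun i => ((0 : ℝ), w i)) (t, x)) (t, x) :=
      (hΩd.continuousAlternatingMap_apply_const (fun i => ((0 : ℝ), w i))).hasFDerivAt
    have hB : HasDerivAt (fun s : ℝ => (s, x)) ((1 : ℝ), (0 : Mink d)) t :=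
      (hasDerivAt_id' t).prodMk (hasDerivAt_const t x)
    exact hA.comp_hasDerivAt t hB
  refine h7.congr_deriv ?_
  rw [ContinuousAlternatingMap.add_apply, extDeriv_apply hslice, h2]
  simp only [h4, pow_succ]
  simp

/-- The homotopy formula `h_1^* R - h_0^* R = K dR + d K R`. -/
lemma pullback_sub_pullback {h : ℝ × Mink d → Mink d} (hh : ContDiff ℝ ∞ h)
    {R : Mink d → Form d (p + 1)} (hR : ContDiff ℝ ∞ R) (x : Mink d) :
    (R (h (1, x))).compContinuousLinearMap (fderiv ℝ (fun y => h (1, y)) x) -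
      (R (h (0, x))).compContinuousLinearMap (fderiv ℝ (fun y => h (0, y)) x) =
      homotopyOp h (extDeriv R) x + extDeriv (homotopyOp h R) x := by
  have hκ := contDiff_homotopyContr hh hR
  have c1 : Continuous fun t : ℝ => homotopyContr h (extDeriv R) (t, x) :=
    (contDiff_homotopyContr hh (contDiff_extDeriv hR)).continuous.comp (continuous_slice x)
  have c2 : Continuous fun t : ℝ => extDeriv (fun y => homotopyContr h R (t, y)) x := by
    have : (fun t : ℝ => extDeriv (fun y => homotopyContr h R (t, y)) x) = fun t : ℝ =>
      (ContinuousAlternatingMap.alternatizeUncurryFinCLM ℝ (Mink d) ℝ)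
        ((fderiv ℝ (homotopyContr h R) (t, x)).comp
          (ContinuousLinearMap.inr ℝ ℝ (Mink d))) := funext fun t => by
      rw [← fderiv_slice (hκ.differentiable (by simp) _)]
      rfl
    rw [this]
    exact (ContinuousLinearMap.continuous _).comp
      (((hκ.continuous_fderiv (by simp)).clm_comp continuous_const).comp (continuous_slice x))
  rw [extDeriv_homotopyOp hh hR, homotopyOp, ← intervalIntegral.integral_add
    (c1.intervalIntegrable _ _) (c2.intervalIntegrable _ _)]
  ext w
  let ev : Form d (p + 1) →L[ℝ] ℝ := ContinuousAlternatingMap.apply ℝ (Mink d) ℝ w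
  have h1 : (∫ t in (0 : ℝ)..1, (homotopyContr h (extDeriv R) (t, x) +
      extDeriv (fun y => homotopyContr h R (t, y)) x)) w =
      ∫ t in (0 : ℝ)..1, (homotopyContr h (extDeriv R) (t, x) +
        extDeriv (fun y => homotopyContr h R (t, y)) x) w :=
    (ev.intervalIntegral_comp_comm ((c1.add c2).intervalIntegrable 0 1)).symm
  rw [h1, intervalIntegral.integral_eq_sub_of_hasDerivAt
    (fun t _ => hasDerivAt_pullback_homotopy hh hR t x w)
    ((ev.continuous.comp (c1.add c2)).intervalIntegrable 0 1)]
  have h2 : ∀ t : ℝ, (R (h (t, x))).compContinuousLinearMap (fderiv ℝ (fun y => h (t, y)) x) w =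
      (R (h (t, x))).compContinuousLinearMap (fderiv ℝ h (t, x)) fun i => ((0 : ℝ), w i) :=
    fun t => by
      rw [fderiv_slice (hh.differentiable (by simp) _)]
      rfl
  rw [ContinuousAlternatingMap.sub_apply, h2, h2]

end Homotopy

/-! ### Potentials of the form `da ∧ U + dB` -/

section Potential

variable {d p q : ℕ}

lemma covWedge_compContinuousLinearMap (v : Mink d →L[ℝ] ℝ) (α : Form d p)
    (M : Mink d →L[ℝ] Mink d) :
    (covWedge rfl v α).compContinuousLinearMap M =
      covWedge rfl (v.comp M) (α.compContinuousLinearMap M) := by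
  ext w
  rw [ContinuousAlternatingMap.compContinuousLinearMap_apply, covWedge_rfl_apply,
    covWedge_rfl_apply]
  rfl

/-- A form of degree at least two pulls back to zero along a map of rank one. -/
lemma compContinuousLinearMap_smulRight (hp : 1 ≤ p) (α : Form d (p + 1)) (l : Mink d →L[ℝ] ℝ)
    (u : Mink d) : α.compContinuousLinearMap (l.smulRight u) = 0 := by
  ext w
  rw [ContinuousAlternatingMap.compContinuousLinearMap_apply]
  have h1 : (⇑(l.smulRight u) ∘ w) = fun i => l (w i) • u := rfl
  have h2 : (α fun _ => u) = 0 :=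
    α.map_eq_zero_of_eq _ (i := 0) (j := ⟨1, by omega⟩) rfl (by simp [Fin.ext_iff])
  rw [h1, α.map_smul_univ, h2, smul_zero]
  rfl

/-- If a homotopy preserves `a` and `da ∧ β = 0`, then `da` also annihilates the contraction of the
pullback of `β` with `∂_t`. -/
lemma covWedge_homotopyContr_eq_zero {h : ℝ × Mink d → Mink d} (hh : ContDiff ℝ ∞ h)
    {a : Mink d → ℝ} (ha : ContDiff ℝ ∞ a) {β : Mink d → Form d (p + 1 + 1)} {t : ℝ} {x : Mink d}
    (hgrad : gradSq a (h (t, x)) ≠ 0) (hβ : covWedge rfl (fderiv ℝ a (h (t, x))) (β (h (t, x))) = 0)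
    (hpres : ∀ᶠ z in 𝓝 (t, x), a (h z) = a z.2) :
    covWedge rfl (fderiv ℝ a x) (homotopyContr h β (t, x)) = 0 := by
  set u := fderiv ℝ a (h (t, x)) with hu
  set M := (fderiv ℝ h (t, x)).comp (ContinuousLinearMap.inr ℝ ℝ (Mink d)) with hM
  have hchain : u.comp (fderiv ℝ h (t, x)) =
      (fderiv ℝ a x).comp (ContinuousLinearMap.snd ℝ ℝ (Mink d)) := by
    have h1 : HasFDerivAt (fun z => a (h z)) (u.comp (fderiv ℝ h (t, x))) (t, x) :=
      ((ha.differentiable (by simp) _).hasFDerivAt).comp (t, x)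
        (hh.differentiable (by simp) _).hasFDerivAt
    have h2 : HasFDerivAt (fun z : ℝ × Mink d => a z.2)
        ((fderiv ℝ a x).comp (ContinuousLinearMap.snd ℝ ℝ (Mink d))) (t, x) :=
      HasFDerivAt.comp (g := a) (t, x) (ha.differentiable (by simp) x).hasFDerivAt
        hasFDerivAt_snd
    exact h1.unique (h2.congr_of_eventuallyEq hpres)
  have hy : u (fderiv ℝ h (t, x) (1, 0)) = 0 := by
    have := DFunLike.congr_fun hchain ((1 : ℝ), (0 : Mink d))
    simpa using this
  have huM : u.comp M = fderiv ℝ a x := by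
    ext1 w
    have := DFunLike.congr_fun hchain ((0 : ℝ), w)
    simpa [hM] using this
  have hne : covInner u u ≠ 0 := by rw [covInner_self]; exact hgrad
  set T := (covInner u u)⁻¹ • interior u (β (h (t, x))) with hT
  have h1 := curryLeft_covWedge u (fderiv ℝ h (t, x) (1, 0)) T
  rw [← eq_covWedge_of_covWedge_eq_zero hne hβ, hy, zero_smul] at h1
  have h2 : homotopyContr h β (t, x) = -covWedge rfl (fderiv ℝ a x)
      ((T.curryLeft (fderiv ℝ h (t, x) (1, 0))).compContinuousLinearMap M) := by
    rw [← huM, ← covWedge_compContinuousLinearMap]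
    change ((β (h (t, x))).curryLeft (fderiv ℝ h (t, x) (1, 0))).compContinuousLinearMap M = _
    rw [eq_neg_of_add_eq_zero_left h1]
    rfl
  rw [h2, ← neg_one_smul ℝ, covWedge_smul, covWedge_covWedge_self, smul_zero]

lemma clm_intervalIntegral_eq_zero {F G : Type*} [NormedAddCommGroup F] [NormedSpace ℝ F]
    [CompleteSpace F] [NormedAddCommGroup G] [NormedSpace ℝ G] [CompleteSpace G] (T : F →L[ℝ] G)
    {f : ℝ → F} (hf : Continuous f) (h : ∀ t ∈ Set.Icc (0 : ℝ) 1, T (f t) = 0) :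
    T (∫ t in (0 : ℝ)..1, f t) = 0 := by
  rw [← T.intervalIntegral_comp_comm (hf.intervalIntegrable _ _)]
  refine (intervalIntegral.integral_congr fun t ht => ?_).trans intervalIntegral.integral_zero
  rw [Set.uIcc_of_le zero_le_one] at ht
  exact h t ht

/-- Let `da ∧ dR = 0`. A homotopy on `V` from a map of rank one to the identity that preserves `a`
gives potentials with `R = -(da ∧ U + dB)` on `V`: in the homotopy formula the term `K dR` is
annihilated by `da`, hence is a multiple of `da`. The times range over a neighbourhood of `[0, 1]`,
so that the relation `a ∘ h_t = a` can be differentiated. -/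
lemma exists_potentials_of_homotopy (hq : p + 1 = q) (hp : 1 ≤ p) {h : ℝ × Mink d → Mink d}
    (hh : ContDiff ℝ ∞ h) {a : Mink d → ℝ} (ha : ContDiff ℝ ∞ a) (hgrad : ∀ x, gradSq a x ≠ 0)
    {R : Mink d → Form d q} (hR : ContDiff ℝ ∞ R)
    (hdR : ∀ x, covWedge rfl (fderiv ℝ a x) (extDeriv R x) = 0) {V : Set (Mink d)} (hV : IsOpen V)
    (h_one : ∀ x ∈ V, h (1, x) = x)
    (h_pres : ∀ x ∈ V, ∀ t ∈ Set.Ioo (-2 : ℝ) 2, a (h (t, x)) = a x)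
    (h_rank : ∀ x ∈ V, ∃ (l : Mink d →L[ℝ] ℝ) (u : Mink d),
      fderiv ℝ (fun y => h (0, y)) x = l.smulRight u) :
    ∃ U B : Mink d → Form d p, ContDiff ℝ ∞ U ∧ ContDiff ℝ ∞ B ∧
      ∀ x ∈ V, R x + covWedge hq (fderiv ℝ a x) (U x) + extD hq B x = 0 := by
  subst hq
  have hda : ContDiff ℝ ∞ (fderiv ℝ a) := ha.fderiv_right le_rfl
  have hK := contDiff_homotopyOp hh (contDiff_extDeriv hR)
  have hU : ContDiff ℝ ∞ fun x =>
      (-(gradSq a x)⁻¹) • interior (fderiv ℝ a x) (homotopyOp h (extDeriv R) x) :=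
    contDiff_smul_form ((contDiff_gradSq ha).inv hgrad).neg (contDiff_bilinear interiorL hda hK)
  have hB : ContDiff ℝ ∞ fun x => (-1 : ℝ) • homotopyOp h R x :=
    (contDiff_homotopyOp hh hR).const_smul _
  refine ⟨_, _, hU, hB, fun x hx => ?_⟩
  have h1 : covWedge rfl (fderiv ℝ a x) (homotopyOp h (extDeriv R) x) = 0 := by
    refine clm_intervalIntegral_eq_zero
      (LinearMap.toContinuousLinearMap (covWedgeL rfl (fderiv ℝ a x)))
      ((contDiff_homotopyContr hh (contDiff_extDeriv hR)).continuous.comp (continuous_slice x))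
      fun t ht => ?_
    refine covWedge_homotopyContr_eq_zero hh ha (hgrad _) (hdR _) ?_
    have hmem : Set.Ioo (-2 : ℝ) 2 ×ˢ V ∈ 𝓝 (t, x) :=
      (isOpen_Ioo.prod hV).mem_nhds ⟨⟨by linarith [ht.1], by linarith [ht.2]⟩, hx⟩
    filter_upwards [hmem] with z hz using h_pres z.2 hz.2 z.1 hz.1
  have hne : covInner (fderiv ℝ a x) (fderiv ℝ a x) ≠ 0 := by rw [covInner_self]; exact hgrad x
  have h2 := eq_covWedge_of_covWedge_eq_zero hne h1
  rw [covInner_self, covWedge_smul] at h2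
  have h3 := pullback_sub_pullback hh hR x
  obtain ⟨l, u, hlu⟩ := h_rank x hx
  have h4 : fderiv ℝ (fun y => h (1, y)) x = ContinuousLinearMap.id ℝ (Mink d) := by
    have : (fun y => h (1, y)) =ᶠ[𝓝 x] fun y => y := by
      filter_upwards [hV.mem_nhds hx] with y hy using h_one y hy
    rw [this.fderiv_eq]
    exact fderiv_fun_id
  rw [hlu, compContinuousLinearMap_smulRight hp, h4, h_one x hx, sub_zero] at h3
  have h5 : R x = homotopyOp h (extDeriv R) x + extDeriv (homotopyOp h R) x := h3
  change R x + covWedge rfl (fderiv ℝ a x) _ + extDeriv ((-1 : ℝ) • homotopyOp h R) x = 0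
  rw [extDeriv_smul, covWedge_smul]
  linear_combination (norm := module) h5 + h2

end Potential

/-! ### Coordinates in which the scalar is a function of one coordinate -/

section Coordinates

variable {k : ℕ}

/-- The dilation by `t` of all coordinates but the first. -/
def retract (z : ℝ × Spacetime k) : Spacetime k := fun i => if i = 0 then z.2 i else z.1 * z.2 i

lemma contDiff_retract : ContDiff ℝ ∞ (retract (k := k)) := by
  refine contDiff_pi.2 fun i => ?_
  have h2 : ContDiff ℝ ∞ fun z : ℝ × Spacetime k => z.2 i := contDiff_pi.1 contDiff_snd i
  by_cases h : i = 0
  · simpa only [retract, if_pos h] using h2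
  · simpa only [retract, if_neg h] using contDiff_fst.mul h2

lemma retract_one (y : Spacetime k) : retract (1, y) = y := by
  ext i; simp [retract]

lemma retract_apply_zero (z : ℝ × Spacetime k) : retract z 0 = z.2 0 := if_pos rfl

lemma retract_zero (y : Spacetime k) : retract (0, y) = y 0 • e 0 := by
  ext i
  by_cases h : i = 0
  · subst h; simp [retract, e]
  · simp [retract, e, h]

/-- Let `Ψ` be coordinates on `V` such that the dilations of all coordinates but the first preserve
`a`. Then a form `R` with `da ∧ dR = 0` has potentials on `V`: at the time zero the dilations map to
the axis of the first coordinate, so that they deform the identity into a map of rank one. -/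
lemma exists_potentials_of_coordinates {p q : ℕ} (hq : p + 1 = q) (hp : 1 ≤ p)
    {Ψ Ψ' : Spacetime k → Spacetime k} (hΨ : ContDiff ℝ ∞ Ψ) (hΨ' : ContDiff ℝ ∞ Ψ')
    {a : Spacetime k → ℝ} (ha : ContDiff ℝ ∞ a) (hgrad : ∀ x, gradSq a x ≠ 0)
    {R : Spacetime k → SForm k q} (hR : ContDiff ℝ ∞ R)
    (hdR : ∀ x, covWedge rfl (fderiv ℝ a x) (extDeriv R x) = 0) {V : Set (Spacetime k)}
    (hV : IsOpen V) (hinv : ∀ x ∈ V, Ψ' (Ψ x) = x)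
    (hpres : ∀ x ∈ V, ∀ t ∈ Set.Ioo (-2 : ℝ) 2, a (Ψ' (retract (t, Ψ x))) = a x) :
    ∃ U B : Spacetime k → SForm k p, ContDiff ℝ ∞ U ∧ ContDiff ℝ ∞ B ∧
      ∀ x ∈ V, R x + covWedge hq (fderiv ℝ a x) (U x) + extD hq B x = 0 := by
  have hh : ContDiff ℝ ∞ fun z : ℝ × Spacetime k => Ψ' (retract (z.1, Ψ z.2)) :=
    hΨ'.comp (contDiff_retract.comp (contDiff_fst.prodMk (hΨ.comp contDiff_snd)))
  refine exists_potentials_of_homotopy hq hp hh ha hgrad hR hdR hV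
    (fun x hx => by simp only [retract_one, hinv x hx]) hpres fun x _ => ?_
  refine ⟨(ContinuousLinearMap.proj (R := ℝ) (0 : Fin (4 * k + 2))).comp (fderiv ℝ Ψ x),
    fderiv ℝ Ψ' (Ψ x 0 • e 0) (e 0), ?_⟩
  simp only [retract_zero]
  have h1 : HasFDerivAt (fun y => Ψ y 0)
      ((ContinuousLinearMap.proj (R := ℝ) (0 : Fin (4 * k + 2))).comp (fderiv ℝ Ψ x)) x :=
    hasFDerivAt_pi'.1 (hΨ.differentiable (by simp) x).hasFDerivAt 0
  have h2 := h1.smul_const (e 0 : Spacetime k)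
  have h3 : HasFDerivAt Ψ' _ (Ψ x 0 • e 0) := (hΨ'.differentiable (by simp) _).hasFDerivAt
  refine (h3.comp x h2).fderiv.trans ?_
  ext1 w
  simp

/-- The coordinates in which `a` replaces the `j`-th Cartesian coordinate, with the origin of the
others at `x₀`. The coordinate `a` comes first. -/
def adapted (a : Spacetime k → ℝ) (j : Fin (4 * k + 2)) (x₀ x : Spacetime k) : Spacetime k :=
  fun i => if i = 0 then a x else x (Equiv.swap 0 j i) - x₀ (Equiv.swap 0 j i)

lemma contDiff_adapted {a : Spacetime k → ℝ} (ha : ContDiff ℝ ∞ a) (j : Fin (4 * k + 2))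
    (x₀ : Spacetime k) : ContDiff ℝ ∞ (adapted a j x₀) := by
  refine contDiff_pi.2 fun i => ?_
  by_cases h : i = 0
  · simpa only [adapted, if_pos h] using ha
  · simp only [adapted, if_neg h]
    fun_prop

lemma exists_equiv_hasFDerivAt_adapted {a : Spacetime k → ℝ} (ha : ContDiff ℝ ∞ a)
    {j : Fin (4 * k + 2)} (x₀ : Spacetime k) {x : Spacetime k} (hj : fderiv ℝ a x (e j) ≠ 0) :
    ∃ L : Spacetime k ≃L[ℝ] Spacetime k,
      HasFDerivAt (adapted a j x₀) (L : Spacetime k →L[ℝ] Spacetime k) x := by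
  set L := fderiv ℝ (adapted a j x₀) x with hL
  have hd : HasFDerivAt (adapted a j x₀) L x :=
    ((contDiff_adapted ha j x₀).differentiable (by simp) x).hasFDerivAt
  have h0 : ∀ w, L w 0 = fderiv ℝ a x w := fun w => by
    have h1 := hasFDerivAt_pi'.1 hd 0
    have h2 : (fun y => adapted a j x₀ y 0) = a := funext fun y => if_pos rfl
    rw [h2] at h1
    rw [h1.fderiv]
    rfl
  have hi : ∀ i ≠ 0, ∀ w, L w i = w (Equiv.swap 0 j i) := fun i hi w => by
    have h1 := hasFDerivAt_pi'.1 hd i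
    have h2 : (fun y => adapted a j x₀ y i) =
        fun y => y (Equiv.swap 0 j i) - x₀ (Equiv.swap 0 j i) := funext fun y => if_neg hi
    rw [h2] at h1
    have h3 : HasFDerivAt (fun y : Spacetime k => y (Equiv.swap 0 j i) - x₀ (Equiv.swap 0 j i))
        (ContinuousLinearMap.proj (R := ℝ) (φ := fun _ : Fin (4 * k + 2) => ℝ)
          (Equiv.swap 0 j i)) x :=
      (hasFDerivAt_apply (𝕜 := ℝ) (Equiv.swap 0 j i) x).sub_const _
    exact DFunLike.congr_fun (h1.unique h3) w
  have hinj : Function.Injective (L : Spacetime k →ₗ[ℝ] Spacetime k) := by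
    rw [injective_iff_map_eq_zero]
    intro w hw
    have hw' : L w = 0 := hw
    have h1 : ∀ m ≠ j, w m = 0 := fun m hm => by
      have h2 : Equiv.swap 0 j m ≠ 0 := fun h =>
        hm ((Equiv.swap 0 j).injective (h.trans (Equiv.swap_apply_right 0 j).symm))
      have h3 := hi _ h2 w
      rw [hw', Equiv.swap_apply_self] at h3
      exact h3.symm
    have h2 : w = w j • e j := by
      ext m
      by_cases hm : m = j
      · subst hm; simp [e]
      · simp [e, hm, h1 m hm]
    have h3 := h0 w
    rw [hw', h2, map_smul, smul_eq_mul, Pi.zero_apply] at h3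
    rw [h2, (mul_eq_zero.1 h3.symm).resolve_right hj, zero_smul]
  refine ⟨(LinearEquiv.ofInjectiveEndo (L : Spacetime k →ₗ[ℝ] Spacetime k)
    hinj).toContinuousLinearEquiv, ?_⟩
  have : (((LinearEquiv.ofInjectiveEndo (L : Spacetime k →ₗ[ℝ] Spacetime k)
      hinj).toContinuousLinearEquiv : Spacetime k ≃L[ℝ] Spacetime k) :
      Spacetime k →L[ℝ] Spacetime k) = L := by
    ext1 w
    rfl
  rw [this]
  exact hd

/-- Around every point where `da ≠ 0` there are coordinates of which `a` is the first. The
inverse of the coordinate system is cut off, so that it is defined and smooth everywhere. -/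
lemma exists_local_coordinates {a : Spacetime k → ℝ} (ha : ContDiff ℝ ∞ a) (x₀ : Spacetime k)
    (hgrad : gradSq a x₀ ≠ 0) : ∃ (Ψ Ψ' : Spacetime k → Spacetime k) (V : Set (Spacetime k)),
      ContDiff ℝ ∞ Ψ ∧ ContDiff ℝ ∞ Ψ' ∧ IsOpen V ∧ x₀ ∈ V ∧ (∀ x ∈ V, Ψ' (Ψ x) = x) ∧
      ∀ x ∈ V, ∀ t ∈ Set.Ioo (-2 : ℝ) 2, a (Ψ' (retract (t, Ψ x))) = a x := by
  obtain ⟨j, hj⟩ : ∃ j, fderiv ℝ a x₀ (e j) ≠ 0 := by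
    by_contra! h
    exact hgrad (by simp [gradSq, h])
  set Ψ := adapted a j x₀ with hΨdef
  have hΨ : ContDiff ℝ ∞ Ψ := contDiff_adapted ha j x₀
  obtain ⟨L, hL⟩ := exists_equiv_hasFDerivAt_adapted ha x₀ hj
  set P := (hΨ.contDiffAt (x := x₀)).toOpenPartialHomeomorph Ψ hL (by simp) with hP
  have hPcoe : ⇑P = Ψ := rfl
  have hx₀ : x₀ ∈ P.source := ContDiffAt.mem_toOpenPartialHomeomorph_source _ hL _
  set y₀ := Ψ x₀ with hy₀
  set N := P.target ∩ P.symm ⁻¹' {x | fderiv ℝ a x (e j) ≠ 0} with hN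
  have hda : Continuous fun x => fderiv ℝ a x (e j) :=
    (ha.continuous_fderiv (by simp)).clm_apply continuous_const
  have hNo : IsOpen N := P.isOpen_inter_preimage_symm (isOpen_ne_fun hda continuous_const)
  have hy₀N : y₀ ∈ N := by
    refine ⟨P.map_source hx₀, ?_⟩
    change fderiv ℝ a (P.symm (P x₀)) (e j) ≠ 0
    rwa [P.left_inv hx₀]
  have hsymm : ∀ y ∈ N, ContDiffAt ℝ ∞ P.symm y := fun y hy => by
    obtain ⟨L', hL'⟩ := exists_equiv_hasFDerivAt_adapted ha x₀ hy.2
    exact P.contDiffAt_symm hy.1 hL' hΨ.contDiffAt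
  obtain ⟨r, hr, hrN⟩ := Metric.nhds_basis_closedBall.mem_iff.1 (hNo.mem_nhds hy₀N)
  let f : ContDiffBump y₀ := ⟨r / 2, r, by positivity, by linarith⟩
  have hΨ' : ContDiff ℝ ∞ fun y => f y • P.symm y := by
    refine contDiff_iff_contDiffAt.2 fun y => ?_
    by_cases hy : y ∈ tsupport f
    · rw [f.tsupport_eq] at hy
      exact f.contDiff.contDiffAt.smul (hsymm y (hrN hy))
    · have h0 : (fun y => f y • P.symm y) =ᶠ[𝓝 y] fun _ => 0 := by
        filter_upwards [notMem_tsupport_iff_eventuallyEq.1 hy] with z hz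
        rw [hz, Pi.zero_apply, zero_smul]
      exact contDiffAt_const.congr_of_eventuallyEq h0
  have hcut : ∀ y ∈ Metric.ball y₀ (r / 2), f y • P.symm y = P.symm y := fun y hy => by
    rw [f.one_of_mem_closedBall (Metric.ball_subset_closedBall hy), one_smul]
  refine ⟨Ψ, fun y => f y • P.symm y, P.source ∩ Ψ ⁻¹' Metric.ball y₀ (r / 4), hΨ, hΨ',
    P.open_source.inter (Metric.isOpen_ball.preimage hΨ.continuous),
    ⟨hx₀, Metric.mem_ball_self (by positivity)⟩, fun x hx => ?_, fun x hx t ht => ?_⟩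
  · exact (hcut _ (Metric.ball_subset_ball (by linarith) hx.2)).trans (P.left_inv hx.1)
  -- The dilations fix the centre `y₀`, and for `|t| < 2` they at most double distances from it.
  · have hmem : retract (t, Ψ x) ∈ Metric.ball y₀ (r / 2) := by
      have h1 : dist (Ψ x) y₀ < r / 4 := hx.2
      rw [Metric.mem_ball, dist_pi_lt_iff (by positivity)]
      intro i
      have h2 : dist (Ψ x i) (y₀ i) < r / 4 := (dist_le_pi_dist _ _ i).trans_lt h1
      by_cases h : i = 0
      · simp only [retract, if_pos h]
        linarith
      · have h3 : y₀ i = 0 := by simp [hy₀, hΨdef, adapted, h]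
        have h4 : |t| < 2 := abs_lt.2 ⟨ht.1, ht.2⟩
        simp only [retract, if_neg h]
        rw [h3, dist_zero_right, Real.norm_eq_abs] at h2 ⊢
        rw [abs_mul]
        nlinarith [abs_nonneg (Ψ x i), abs_nonneg t]
    have htarget : retract (t, Ψ x) ∈ P.target :=
      (hrN (Metric.ball_subset_closedBall (Metric.ball_subset_ball (by linarith) hmem))).1
    have ha0 : ∀ z, Ψ z 0 = a z := fun z => if_pos rfl
    refine (congrArg a (hcut _ hmem)).trans ?_
    have hright : Ψ (P.symm (retract (t, Ψ x))) = retract (t, Ψ x) := P.right_inv htarget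
    rw [← ha0, hright, retract_apply_zero]
    exact ha0 x

end Coordinates

/-! ### Gauging the auxiliary form away -/

section Gauging

open Fields

variable {k : ℕ} {𝓕 : SelfDual k → ℝ} {D : Set (SelfDual k)} {Φ : Fields k}

lemma extDeriv_covWedge_fderiv_extD {d p q : ℕ} (h : p + 1 = q) {a : Mink d → ℝ}
    {U : Mink d → Form d p} (ha : ContDiff ℝ ∞ a) (hU : ContDiff ℝ ∞ U) (x : Mink d) :
    extDeriv (fun x => covWedge h (fderiv ℝ a x) (U x)) x =
      -covWedge rfl (fderiv ℝ a x) (extD h U x) := by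
  subst h
  exact extDeriv_covWedge_fderiv ha hU x

/-- The transformation with parameter `U` changes neither `H` nor `da ∧ Q`, and the one with
parameter `B` changes neither `F` nor `Q`. Hence the transformed fields solve the field equations,
and `F = H` where `R` vanishes. -/
lemma gaugesAway_of_potentials (hD : IsOpen D) (h𝓕 : ContDiffOn ℝ 1 𝓕 D) (hΦ : Φ.Smooth)
    (hΦD : ∀ x, sd (Φ.H x) ∈ D) (hE : ∀ x, Φ.defect 𝓕 x = 0) (hQ : ∀ x, Φ.daQ x = 0)
    (hk : 1 ≤ k) {V : Set (Spacetime k)} (hV : IsOpen V) {U B : Spacetime k → SForm k (2 * k - 1)}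
    (hU : ContDiff ℝ ∞ U) (hB : ContDiff ℝ ∞ B)
    (hUB : ∀ x ∈ V, Φ.R x + covWedge (by omega) (fderiv ℝ Φ.a x) (U x) +
      extD (by omega) B x = 0) : GaugesAway hk 𝓕 Φ V := by
  set δ := gaugeAR hk Φ U with hδdef
  set ε := gaugeR hk B with hεdef
  have hδ : δ.Smooth := smooth_gaugeAR hΦ hk hU
  have hε : ε.Smooth := ⟨contDiff_const, contDiff_const, contDiff_extD _ hB⟩
  set Φ' := (Φ.shift δ 1).shift ε 1 with hΦ'def
  have hΦ' : Φ'.Smooth := (hΦ.shift hδ 1).shift hε 1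
  have ha : Φ'.a = Φ.a := by
    ext x
    simp [hΦ'def, hδdef, hεdef, shift, gaugeAR, gaugeR]
  have hF : ∀ x, Φ'.F x = Φ.F x + δ.F x := fun x => by
    rw [hΦ'def, shift_F (hΦ.shift hδ 1) hε, shift_F hΦ hδ, Fields.F_eq_zero (δ := ε) rfl]
    simp
  have hεQ : ∀ x, ε.Q x = 0 := fun x => extDeriv_extD (by omega) hB x
  have hQ' : ∀ x, Φ'.Q x = Φ.Q x + δ.Q x := fun x => by
    rw [hΦ'def, shift_Q (hΦ.shift hδ 1) hε, shift_Q hΦ hδ, hεQ]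
    simp
  have hH : ∀ x, Φ'.H x = Φ.H x := fun x => by
    have h1 := varH_gaugeAR hΦ hk hU x
    have h2 : Φ.varH δ x = δ.F x + Φ.a x • δ.Q x + δ.a x • Φ.Q x := by
      rw [varH]; module
    rw [h2] at h1
    have h3 : δ.a x • Φ.Q x = 0 := zero_smul ℝ _
    rw [h3, add_zero] at h1
    rw [Fields.H, hF, hQ', ha, Fields.H, smul_add, add_add_add_comm, h1, add_zero]
  have hδQ : ∀ x, covMid (fderiv ℝ Φ.a x) (δ.Q x) = 0 := fun x => by
    have h1 : δ.R = fun x => covWedge (by omega) (fderiv ℝ Φ.a x) (U x) :=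
      funext fun x => daWedge_eq hk Φ.a U x
    have h2 : δ.Q x = -covWedge rfl (fderiv ℝ Φ.a x) (extD (by omega) U x) := by
      rw [Fields.Q, h1]
      exact extDeriv_covWedge_fderiv_extD _ hΦ.1 hU x
    rw [h2, covMid, ← neg_one_smul ℝ, covWedge_smul, covWedge_covWedge_self, smul_zero]
  have hE' : ∀ x, Φ'.defect 𝓕 x = 0 := fun x => by
    have := hE x
    rw [Fields.defect] at this ⊢
    rw [hH, this]
  have hdaQ' : ∀ x, Φ'.daQ x = 0 := fun x => by
    have h1 := hQ x
    rw [Fields.daQ] at h1 ⊢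
    rw [ha, hQ', covMid, covWedge_add]
    exact (congrArg₂ (· + ·) h1 (hδQ x)).trans (add_zero _)
  have hfe := fieldEquations_of_defect_eq_zero hD h𝓕 hΦ' (fun x => by rw [hH]; exact hΦD x)
    hE' hdaQ'
  have hR' : ∀ x ∈ V, Φ'.R x = 0 := fun x hx => by
    rw [← hUB x hx, ← daWedge_eq hk]
    simp [hΦ'def, hδdef, hεdef, shift, gaugeAR, gaugeR]
  refine ⟨U, B, hU, hB, Φ', rfl, hΦ', hfe.1, hfe.2.1, hfe.2.2, fun x hx => ⟨hR' x hx, ?_⟩⟩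
  have h1 : Φ'.Q x = 0 := by
    have : Φ'.R =ᶠ[𝓝 x] 0 := by
      filter_upwards [hV.mem_nhds hx] with y hy using hR' y hy
    rw [Fields.Q, this.extDeriv_eq]
    exact extDeriv_zero_field x
  have h2 : Φ'.F x = Φ'.H x := by rw [Fields.H, h1, smul_zero, add_zero]
  rw [h2]
  exact hE' x

lemma gaugesAway_nhds (hD : IsOpen D) (h𝓕 : ContDiffOn ℝ 1 𝓕 D) (hΦ : Φ.Smooth)
    (hΦD : ∀ x, sd (Φ.H x) ∈ D) (hgrad : ∀ x, gradSq Φ.a x ≠ 0) (hE : ∀ x, Φ.defect 𝓕 x = 0)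
    (hQ : ∀ x, Φ.daQ x = 0) (hk : 1 ≤ k) (x₀ : Spacetime k) :
    ∃ V : Set (Spacetime k), IsOpen V ∧ x₀ ∈ V ∧ GaugesAway hk 𝓕 Φ V := by
  obtain ⟨Ψ, Ψ', V, hΨ, hΨ', hV, hx₀, hinv, hpres⟩ :=
    exists_local_coordinates hΦ.1 x₀ (hgrad x₀)
  obtain ⟨U, B, hU, hB, hUB⟩ := exists_potentials_of_coordinates (p := 2 * k - 1) (by omega)
    (by omega) hΨ hΨ' hΦ.1 hgrad hΦ.2.2 hQ hV hinv hpres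
  exact ⟨V, hV, hx₀, gaugesAway_of_potentials hD h𝓕 hΦ hΦD hE hQ hk hV hU hB hUB⟩

lemma gaugesAway_univ (hD : IsOpen D) (h𝓕 : ContDiffOn ℝ 1 𝓕 D) (hΦ : Φ.Smooth)
    (hΦD : ∀ x, sd (Φ.H x) ∈ D) (hgrad : ∀ x, gradSq Φ.a x ≠ 0) (hE : ∀ x, Φ.defect 𝓕 x = 0)
    (hQ : ∀ x, Φ.daQ x = 0) (hk : 1 ≤ k) (hglob : IsGlobalCoordinate Φ.a) :
    GaugesAway hk 𝓕 Φ Set.univ := by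
  obtain ⟨Ψ, Ψ', g, hΨ, hΨ', hleft, hright, hg⟩ := hglob
  obtain ⟨U, B, hU, hB, hUB⟩ := exists_potentials_of_coordinates (p := 2 * k - 1) (by omega)
    (by omega) hΨ hΨ' hΦ.1 hgrad hΦ.2.2 hQ isOpen_univ (fun x _ => hleft x) fun x _ t _ => by
      rw [hg, hright, hg, retract_apply_zero]
  exact gaugesAway_of_potentials hD h𝓕 hΦ hΦD hE hQ hk isOpen_univ hU hB hUB

lemma wedge_dScalar_Q (Φ : Fields k) (x : Spacetime k) :
    wedge (Nat.add_comm 1 (2 * k + 1)) (dScalar Φ.a x) (Φ.Q x) = Φ.daQ x := wedge_oneForm _ _ _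

end Gauging

end ChiralForm

end

open ChiralForm

theorem mainTheorem1 (k : ℕ) (hk : 1 ≤ k) (D : Set (SelfDual k)) (hD : IsOpen D)
    (𝓕 : SelfDual k → ℝ) (h𝓕 : ContDiffOn ℝ 1 𝓕 D) :
    -- `X = ∂𝓕/∂Y` is the anti-self-dual form with `d𝓕 = 2 ⟨dY, X⟩`
    (∀ Y ∈ D, hodge (gradForm 𝓕 Y) = -gradForm 𝓕 Y ∧
      ∀ ζ : SelfDual k, fderiv ℝ 𝓕 Y ζ =
        2 * formInner (ζ : SForm k (2 * k + 1)) (gradForm 𝓕 Y)) ∧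
    -- the gauge symmetries
    (∀ Φ : Fields k, Φ.Smooth → (∀ x, sd (Φ.H x) ∈ D) →
      (∀ U : Spacetime k → SForm k (2 * k - 1), ContDiff ℝ ∞ U →
        VariesBy 𝓕 Φ (gaugeA hk U) 0 ∧
        VariesBy 𝓕 Φ (gaugeR hk U) 0 ∧
        VariesBy 𝓕 Φ (gaugeAR hk Φ U) (current Φ (gaugeAR hk Φ U))) ∧
      ((∀ x, gradSq Φ.a x ≠ 0) → ∀ φ : Spacetime k → ℝ, ContDiff ℝ ∞ φ →
        VariesBy 𝓕 Φ (gaugePST Φ φ) (current Φ (gaugePST Φ φ)))) ∧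
    -- the consequences of the field equations of `A` and `R`
    (∀ Φ : Fields k, Φ.Smooth → (∀ x, sd (Φ.H x) ∈ D) → (∀ x, gradSq Φ.a x ≠ 0) →
      EqA 𝓕 Φ → EqR 𝓕 Φ →
        EqScalar 𝓕 Φ ∧
        (∀ x, NonlinearSelfDual 𝓕 (Φ.H x)) ∧
        (∀ x, wedge (Nat.add_comm 1 (2 * k + 1)) (dScalar Φ.a x) (Φ.Q x) = 0) ∧
        (∀ x, ∃ V : Set (Spacetime k), IsOpen V ∧ x ∈ V ∧ GaugesAway hk 𝓕 Φ V) ∧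
        (IsGlobalCoordinate Φ.a → GaugesAway hk 𝓕 Φ Set.univ)) ∧
    -- in the gauge `R = 0` the nonlinear self-duality relation is the only equation
    (∀ Φ : Fields k, Φ.Smooth → (∀ x, sd (Φ.H x) ∈ D) → (∀ x, gradSq Φ.a x ≠ 0) → Φ.R = 0 →
      ((EqA 𝓕 Φ ∧ EqR 𝓕 Φ ∧ EqScalar 𝓕 Φ) ↔ ∀ x, NonlinearSelfDual 𝓕 (Φ.F x))) := by
  have hsum : ∀ (Φ : Fields k) (x : Spacetime k), Φ.daQ x = 0 ↔
      wedge (Nat.add_comm 1 (2 * k + 1)) (dScalar Φ.a x) (Φ.Q x) = 0 := fun Φ x => by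
    rw [wedge_dScalar_Q]
  refine ⟨fun Y _ => ⟨hodge_gradForm 𝓕 Y, fderiv_eq_two_mul_formInner 𝓕 Y⟩, ?_, ?_, ?_⟩
  · exact fun Φ hΦ hΦD => ⟨fun U hU => ⟨variesBy_gaugeA hD h𝓕 hΦ hΦD hk hU,
      variesBy_gaugeR hD h𝓕 hΦ hΦD hk hU, variesBy_gaugeAR hD h𝓕 hΦ hΦD hk hU⟩,
      fun hgrad φ hφ => variesBy_gaugePST hD h𝓕 hΦ hΦD hgrad hφ⟩
  · intro Φ hΦ hΦD hgrad hA hR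
    have h := defect_eq_zero_and_daQ_eq_zero hD h𝓕 hΦ hΦD hgrad hA hR
    have hE : ∀ x, Φ.defect 𝓕 x = 0 := h.1
    have hQ : ∀ x, Φ.daQ x = 0 := h.2
    exact ⟨(fieldEquations_of_defect_eq_zero hD h𝓕 hΦ hΦD hE hQ).2.2, hE,
      fun x => (hsum Φ x).1 (hQ x),
      gaugesAway_nhds hD h𝓕 hΦ hΦD hgrad hE hQ hk,
      gaugesAway_univ hD h𝓕 hΦ hΦD hgrad hE hQ hk⟩
  · intro Φ hΦ hΦD hgrad hR0
    have hQ0 : ∀ x, Φ.Q x = 0 := Fields.Q_eq_zero hR0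
    have hH : ∀ x, Φ.H x = Φ.F x := fun x => by
      rw [Fields.H, hQ0, smul_zero, add_zero]
    constructor
    · rintro ⟨hA, hR, -⟩ x
      rw [← hH]
      exact (defect_eq_zero_and_daQ_eq_zero hD h𝓕 hΦ hΦD hgrad hA hR).1 x
    · intro h
      refine fieldEquations_of_defect_eq_zero hD h𝓕 hΦ hΦD (fun x => ?_) fun x => ?_
      · have := h x
        rwa [← hH] at this
      · rw [Fields.daQ, hQ0]
        exact covWedge_zero _ _
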